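/- All vector spaces are over $\mathbb{Q}$ and graded over $\mathbb{Z}$. An $L_\infty$ algebra $L$ has graded skew-symmetric brackets $\ell_k\colon L^{\otimes k}\to L$ of degree $k-2$ ($k\ge 1$) satisfying the generalized Jacobi identities. Let $(sL)_i=L_{i-1}$, let $\Lambda sL$ be the free graded-commutative algebra on $sL$ with the coproduct for which $sL$ is primitive, put $h_k=(-1)^{k(k-1)/2}\,s\circ\ell_k\circ(s^{-1})^{\otimes k}\colon\Lambda^k sL\to sL$, let $\delta_k$ be the coderivation of $\Lambda sL$ extending $h_k$, and $\delta=\sum_{k\ge1}\delta_k$. Then $(\Lambda sL,\delta)$ is a complex, filtered by $F_p=\mathbb{Q}\cdot 1\oplus\ker\Delta^p$ $(=\Lambda^{\le p}sL)$ for $p\ge 0$ and $F_p=0$ for $p<0$, where $\Delta^p$ is the $p$-th iterated reduced diagonal on the coaugmentation kernel. Its spectral sequence, the Quillen spectral sequence of $L$, has the pages $$E^r_p=\frac{Z^r_p}{Z^{r-1}_{p-1}+D^{r-1}_p},\qquad Z^r_p=F_p\cap\delta^{-1}(F_{p-r}),\quad D^r_p=F_p\cap\delta(F_{p+r}),$$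 with $d^r\colon E^r_p\to E^r_{p-r}$ induced by $\delta$; it collapses at $E^2$ if $d^r=0$ for all $r\ge2$. An $L_\infty$ morphism $L\to L'$ is a morphism of coaugmented differential graded coalgebras $(\Lambda sL,\delta)\to(\Lambda sL',\delta')$; it is a quasi-isomorphism if its linear part $(L,\ell_1)\to(L',\ell_1')$ is one, and two $L_\infty$ algebras are weakly equivalent if they are joined by a zig-zag of quasi-isomorphisms. $L$ is formal if it is weakly equivalent to its homology $H_*(L,\ell_1)$ endowed with an $L_\infty$ structure all of whose brackets vanish except possibly $\ell_2$, which is the one induced by the bracket $\ell_2$ of $L$. **Proposition.** (1) If $L=L_{\ge0}$ is a formal $L_\infty$ algebra, then its Quillen spectral sequence collapses at $E^2$. (2) Let $k\ge1$ and let $L$ be any $L_\infty$ algebra with $\ell_j=0$ for all $j<k$. Then the pages satisfy $E^0=\cdots=E^{k-1}$ (equal as subquotients of $\Lambda sL$, with $d^r=0$ for $0\le r<k-1$); for every $p$ the map $x\mapsto[x]$ is an isomorphism $\Lambda^p sL\cong E^{k-1}_p$, and under these isomorphisms $d^{k-1}$ is identified with $\delta_k\colon\Lambda^p sL\to\Lambda^{p-k+1}sL$.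 -/

import Mathlib

open scoped DirectSum TensorProduct

universe u

namespace Quillen

/-- A `ℤ`-graded rational vector space `V = ⨁ₙ Vₙ`. -/
structure GradedSpace where
  carrier : Type u
  [addCommGroup : AddCommGroup carrier]
  [module : Module ℚ carrier]
  gr : ℤ → Submodule ℚ carrier
  isInternal : DirectSum.IsInternal gr

namespace GradedSpace

attribute [instance] addCommGroup module

instance : CoeSort GradedSpace.{u} (Type u) := ⟨carrier⟩

variable (V : GradedSpace.{u})

noncomputable instance : DirectSum.Decomposition V.gr := V.isInternal.chooseDecomposition

/-- The suspension `sV`: `(sV)ᵢ = Vᵢ₋₁`. -/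
def susp : GradedSpace.{u} where
  carrier := V.carrier
  gr i := V.gr (i - 1)
  isInternal := by
    have h := V.isInternal
    rw [DirectSum.isInternal_submodule_iff_iSupIndep_and_iSup_eq_top] at h ⊢
    refine ⟨h.1.comp (Equiv.subRight (1 : ℤ)).injective, ?_⟩
    rw [← h.2]
    exact (Equiv.subRight (1 : ℤ)).iSup_comp (g := V.gr)

/-- The degree `+1` identification `s : V → sV`. -/
def s : V ≃ₗ[ℚ] V.susp := LinearEquiv.refl ℚ V.carrier

/-- The grading involution `v ↦ (-1)^|v| v`. -/
noncomputable def signOp : V →ₗ[ℚ] V :=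
  DirectSum.coeLinearMap V.gr ∘ₗ
    DirectSum.lmap (fun i : ℤ => (-1 : ℚ) ^ i • (LinearMap.id : V.gr i →ₗ[ℚ] V.gr i)) ∘ₗ
    (DirectSum.decomposeLinearEquiv V.gr).toLinearMap

theorem signOp_of_mem {i : ℤ} {v : V} (hv : v ∈ V.gr i) : V.signOp v = (-1 : ℚ) ^ i • v := by
  lift v to V.gr i using hv
  simp only [signOp, LinearMap.comp_apply, LinearEquiv.coe_coe, DirectSum.decomposeLinearEquiv_apply,
    DirectSum.decompose_coe]
  rw [← DirectSum.lof_eq_of ℚ, DirectSum.lmap_lof]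
  simp

/-- The projection of `V` onto its degree `n` part. -/
noncomputable def proj (n : ℤ) : V →ₗ[ℚ] V :=
  (V.gr n).subtype ∘ₗ DirectSum.component ℚ ℤ (fun i => V.gr i) n ∘ₗ
    (DirectSum.decomposeLinearEquiv V.gr).toLinearMap

theorem proj_apply (n : ℤ) (x : V) : V.proj n x = (DirectSum.decompose V.gr x n : V) := rfl

theorem proj_of_mem {n : ℤ} {x : V} (hx : x ∈ V.gr n) : V.proj n x = x :=
  DirectSum.decompose_of_mem_same V.gr hx

theorem proj_of_mem_ne {n m : ℤ} {x : V} (hx : x ∈ V.gr n) (h : n ≠ m) : V.proj m x = 0 :=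
  DirectSum.decompose_of_mem_ne V.gr hx h

theorem proj_mem (n : ℤ) (x : V) : V.proj n x ∈ V.gr n := (DirectSum.decompose V.gr x n).2

theorem proj_comm {d : V →ₗ[ℚ] V} (hd : ∀ n, ∀ x ∈ V.gr n, d x ∈ V.gr (n - 1)) (n : ℤ) (x : V) :
    d (V.proj n x) = V.proj (n - 1) (d x) := by
  induction x using DirectSum.Decomposition.inductionOn V.gr with
  | zero => simp
  | add a b ha hb => simp [ha, hb]
  | @homogeneous i a =>
    by_cases h : i = n
    · subst h
      rw [proj_of_mem V a.2, proj_of_mem V (hd _ _ a.2)]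
    · rw [proj_of_mem_ne V a.2 h, proj_of_mem_ne V (hd _ _ a.2) (by omega), map_zero]

/-- Homology of a graded space with respect to a linear map `d` of degree `-1`
(`ker d / im d`, graded by the degrees of representing cycles). -/
def homology (d : V →ₗ[ℚ] V) (hd : ∀ n, ∀ x ∈ V.gr n, d x ∈ V.gr (n - 1)) : GradedSpace.{u} where
  carrier := LinearMap.ker d ⧸ (LinearMap.range d).submoduleOf (LinearMap.ker d)
  gr n := ((V.gr n).submoduleOf (LinearMap.ker d)).map
    ((LinearMap.range d).submoduleOf (LinearMap.ker d)).mkQ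
  isInternal := by
    classical
    have hk (n : ℤ) : ∀ x ∈ LinearMap.ker d, V.proj n x ∈ LinearMap.ker d := fun x hx => by
      rw [LinearMap.mem_ker] at hx ⊢
      rw [proj_comm V hd, hx, map_zero]
    let P (n : ℤ) := (V.proj n).restrict (hk n)
    have hP (n : ℤ) : (LinearMap.range d).submoduleOf (LinearMap.ker d) ≤
        ((LinearMap.range d).submoduleOf (LinearMap.ker d)).comap (P n) := by
      rintro x ⟨y, hy⟩
      refine ⟨V.proj (n + 1) y, ?_⟩
      rw [proj_comm V hd, hy, add_sub_cancel_right]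
      rfl
    let Q (n : ℤ) := Submodule.mapQ _ _ (P n) (hP n)
    rw [DirectSum.isInternal_submodule_iff_iSupIndep_and_iSup_eq_top]
    constructor
    · rw [iSupIndep_def]
      intro n
      rw [Submodule.disjoint_def]
      intro x hx hx'
      have h1 : Q n x = x := by
        obtain ⟨y, hy, rfl⟩ := hx
        refine congrArg (Submodule.Quotient.mk) (Subtype.ext ?_)
        exact proj_of_mem V hy
      have h2 : (⨆ j, ⨆ (_ : j ≠ n), ((V.gr j).submoduleOf (LinearMap.ker d)).map
          ((LinearMap.range d).submoduleOf (LinearMap.ker d)).mkQ) ≤ LinearMap.ker (Q n) := by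
        refine iSup₂_le fun j hj => ?_
        rintro _ ⟨y, hy, rfl⟩
        have : P n y = 0 := Subtype.ext (proj_of_mem_ne V hy hj)
        rw [LinearMap.mem_ker]
        change Submodule.Quotient.mk (P n y) = _
        rw [this, Submodule.Quotient.mk_zero]
      rw [← h1]
      exact h2 hx'
    · rw [eq_top_iff]
      rintro x -
      obtain ⟨y, rfl⟩ := Submodule.mkQ_surjective _ x
      have hy : y = ∑ n ∈ (DirectSum.decompose V.gr (y : V)).support, P n y := by
        refine Subtype.ext ?_
        rw [AddSubmonoidClass.coe_finsetSum]
        exact (DirectSum.sum_support_decompose V.gr (y : V)).symm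
      rw [hy, map_sum]
      refine Submodule.sum_mem _ fun n _ => Submodule.mem_iSup_of_mem n ?_
      exact ⟨P n y, V.proj_mem n y, rfl⟩

end GradedSpace

/-! ### The free graded-commutative algebra and its coproduct -/

section Lam

variable (V : GradedSpace.{u})

/-- The two-sided ideal of the tensor algebra generated by `v ⊗ w - (-1)^(|v||w|) w ⊗ v`. -/
noncomputable def relIdeal : Ideal (TensorAlgebra ℚ V) :=
  (TwoSidedIdeal.span {z : TensorAlgebra ℚ V | ∃ i j : ℤ, ∃ v ∈ V.gr i, ∃ w ∈ V.gr j,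
    z = TensorAlgebra.ι ℚ v * TensorAlgebra.ι ℚ w
      - (-1 : ℚ) ^ (i * j) • (TensorAlgebra.ι ℚ w * TensorAlgebra.ι ℚ v)}).asIdeal

instance : (relIdeal V).IsTwoSided := by
  unfold relIdeal; infer_instance

/-- `ΛV = T(V) / (v ⊗ w - (-1)^(|v||w|) w ⊗ v)`. -/
def Lam : Type u := TensorAlgebra ℚ V ⧸ relIdeal V

noncomputable instance : Ring (Lam V) := inferInstanceAs (Ring (TensorAlgebra ℚ V ⧸ relIdeal V))

noncomputable instance : Algebra ℚ (Lam V) :=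
  inferInstanceAs (Algebra ℚ (TensorAlgebra ℚ V ⧸ relIdeal V))

namespace Lam

/-- The quotient map `T(V) → ΛV`. -/
noncomputable def mk : TensorAlgebra ℚ V →ₐ[ℚ] Lam V := Ideal.Quotient.mkₐ ℚ (relIdeal V)

theorem mk_surjective : Function.Surjective (mk V) := Ideal.Quotient.mkₐ_surjective ℚ _

/-- The inclusion `V → ΛV` of words of length one. -/
noncomputable def ι : V →ₗ[ℚ] Lam V := (mk V).toLinearMap ∘ₗ TensorAlgebra.ι ℚ

variable {V}

theorem mk_eq_zero {x : TensorAlgebra ℚ V} (hx : x ∈ relIdeal V) : mk V x = 0 :=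
  Ideal.Quotient.eq_zero_iff_mem.2 hx

theorem ι_mul_ι {i j : ℤ} {v w : V} (hv : v ∈ V.gr i) (hw : w ∈ V.gr j) :
    ι V v * ι V w = (-1 : ℚ) ^ (i * j) • (ι V w * ι V v) := by
  rw [← sub_eq_zero]
  have := mk_eq_zero (V := V) (TwoSidedIdeal.subset_span ⟨i, j, v, hv, w, hw, rfl⟩)
  simpa [ι] using this

/-- Algebra morphisms out of `ΛV` are linear maps with graded-commuting values. -/
noncomputable def lift {A : Type*} [Ring A] [Algebra ℚ A] (f : V →ₗ[ℚ] A)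
    (hf : ∀ i j : ℤ, ∀ v ∈ V.gr i, ∀ w ∈ V.gr j,
      f v * f w = (-1 : ℚ) ^ (i * j) • (f w * f v)) : Lam V →ₐ[ℚ] A :=
  Ideal.Quotient.liftₐ (relIdeal V) (TensorAlgebra.lift ℚ f) (by
    intro a ha
    induction ha using TwoSidedIdeal.span_induction with
    | mem x h =>
      obtain ⟨i, j, v, hv, w, hw, rfl⟩ := h
      simp [hf i j v hv w hw]
    | zero => simp
    | add x y _ _ hx hy => simp [hx, hy]
    | neg x _ hx => simp [hx]
    | left_absorb a x _ hx => simp [hx]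
    | right_absorb a x _ hx => simp [hx])

@[simp] theorem lift_ι {A : Type*} [Ring A] [Algebra ℚ A] (f : V →ₗ[ℚ] A) (hf) (v : V) :
    lift f hf (ι V v) = f v :=
  TensorAlgebra.lift_ι_apply f v

theorem algHom_ext {A : Type*} [Ring A] [Algebra ℚ A] {f g : Lam V →ₐ[ℚ] A}
    (h : f.toLinearMap ∘ₗ ι V = g.toLinearMap ∘ₗ ι V) : f = g := by
  refine Ideal.Quotient.algHom_ext (R₁ := ℚ) (TensorAlgebra.hom_ext ?_)
  exact h

variable (V)

/-- The degree `n` part of `ΛV`: the span of the words `v₁ ∧ ⋯ ∧ vₖ` in homogeneous elements with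
`|v₁| + ⋯ + |vₖ| = n`. -/
noncomputable def gr (n : ℤ) : Submodule ℚ (Lam V) :=
  Submodule.span ℚ {x | ∃ l : List (Σ i : ℤ, V.gr i),
    (l.map Sigma.fst).sum = n ∧ x = (l.map fun a => ι V (a.2 : V)).prod}

variable {V} in
theorem ι_mem_gr {i : ℤ} {v : V} (hv : v ∈ V.gr i) : ι V v ∈ gr V i :=
  Submodule.subset_span ⟨[⟨i, v, hv⟩], by simp, by simp⟩

instance : SetLike.GradedMonoid (gr V) where
  one_mem := Submodule.subset_span ⟨[], by simp, by simp⟩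
  mul_mem := by
    intro i j a b ha hb
    have := Submodule.mul_mem_mul ha hb
    rw [gr, gr, Submodule.span_mul_span] at this
    refine Submodule.span_mono ?_ this
    rintro _ ⟨_, ⟨l, hl, rfl⟩, _, ⟨m, hm, rfl⟩, rfl⟩
    exact ⟨l ++ m, by simp [hl, hm], by simp⟩

/-- Auxiliary: `v ↦ ∑ᵢ vᵢ`, with `vᵢ` placed in degree `i`. -/
noncomputable def gradedι : V →ₗ[ℚ] ⨁ i, gr V i :=
  DirectSum.lmap (fun i : ℤ => ((ι V).restrict (p := V.gr i) (q := gr V i)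
    fun _ h => ι_mem_gr h)) ∘ₗ (DirectSum.decomposeLinearEquiv V.gr).toLinearMap

theorem gradedι_of_mem {i : ℤ} {v : V} (hv : v ∈ V.gr i) :
    gradedι V v = DirectSum.of (fun i => gr V i) i ⟨ι V v, ι_mem_gr hv⟩ := by
  lift v to V.gr i using hv
  simp only [gradedι, LinearMap.comp_apply, LinearEquiv.coe_coe,
    DirectSum.decomposeLinearEquiv_apply, DirectSum.decompose_coe]
  rw [← DirectSum.lof_eq_of ℚ, DirectSum.lmap_lof]
  rfl

theorem gradedι_comm (i j : ℤ) (v : V) (hv : v ∈ V.gr i) (w : V) (hw : w ∈ V.gr j) :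
    gradedι V v * gradedι V w = (-1 : ℚ) ^ (i * j) • (gradedι V w * gradedι V v) := by
  rw [gradedι_of_mem V hv, gradedι_of_mem V hw, DirectSum.of_mul_of, DirectSum.of_mul_of,
    ← DirectSum.lof_eq_of ℚ, ← DirectSum.lof_eq_of ℚ, ← map_smul, DirectSum.lof_eq_of,
    DirectSum.lof_eq_of]
  refine DirectSum.of_eq_of_gradedMonoid_eq (Sigma.subtype_ext (add_comm _ _) ?_)
  exact ι_mul_ι hv hw

/-- Auxiliary: the decomposition of `ΛV` into its degrees. -/
noncomputable def toGraded : Lam V →ₐ[ℚ] ⨁ i, gr V i :=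
  lift (A := ⨁ i, gr V i) (gradedι V) (gradedι_comm V)

theorem toGraded_of_mem {i : ℤ} (x : gr V i) :
    toGraded V x = DirectSum.of (fun i => gr V i) i x := by
  obtain ⟨x, hx⟩ := x
  dsimp only
  induction hx using Submodule.span_induction with
  | zero => rw [map_zero]; exact (map_zero _).symm
  | add a b ha hb iha ihb => rw [map_add, iha, ihb, ← map_add]; rfl
  | smul c a ha iha =>
    rw [map_smul, iha, ← DirectSum.lof_eq_of ℚ, ← map_smul]; rfl
  | mem x h =>
    obtain ⟨l, hl, rfl⟩ := h
    induction l generalizing i with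
    | nil =>
      obtain rfl : 0 = i := by simpa using hl
      simp only [List.map_nil, List.prod_nil, map_one]
      rfl
    | cons a l ih =>
      subst hl
      simp only [List.map_cons, List.prod_cons, map_mul]
      rw [ih rfl, toGraded, lift_ι, gradedι_of_mem V a.2.2, DirectSum.of_mul_of]
      refine DirectSum.of_eq_of_gradedMonoid_eq (Sigma.subtype_ext ?_ rfl)
      change a.1 + (l.map Sigma.fst).sum = ((a :: l).map Sigma.fst).sum
      simp

noncomputable instance : GradedAlgebra (gr V) :=
  GradedAlgebra.ofAlgHom _ (toGraded V)
    (by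
      apply algHom_ext
      ext v
      induction v using DirectSum.Decomposition.inductionOn V.gr with
      | zero => simp
      | add a b ha hb => rw [map_add, ha, hb, map_add]
      | @homogeneous i a =>
        simp [toGraded, gradedι_of_mem V a.2, DirectSum.coeAlgHom_of])
    (fun i x => toGraded_of_mem V x)

/-- Auxiliary: `v ↦ v ⊗ 1 + 1 ⊗ v`. -/
noncomputable def primitive : V →ₗ[ℚ] gr V ᵍ⊗[ℚ] gr V :=
  (GradedTensorProduct.includeLeft (gr V) (gr V)).toLinearMap ∘ₗ ι V +
    (GradedTensorProduct.includeRight (gr V) (gr V)).toLinearMap ∘ₗ ι V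

theorem units_smul_eq {M : Type*} [AddCommGroup M] [Module ℚ M] (n : ℤ) (x : M) :
    (-1 : ℤˣ) ^ n • x = (-1 : ℚ) ^ n • x := by
  rcases Int.even_or_odd n with h | h
  · rw [h.neg_one_zpow, h.neg_one_zpow, one_smul, one_smul]
  · rw [h.neg_one_zpow, h.neg_one_zpow, Units.neg_smul, one_smul, neg_smul, one_smul]

theorem primitive_mul (i j : ℤ) (v : V) (hv : v ∈ V.gr i) (w : V) (hw : w ∈ V.gr j) :
    primitive V v * primitive V w =
      (((ι V v * ι V w) ᵍ⊗ₜ[ℚ] (1 : Lam V) : gr V ᵍ⊗[ℚ] gr V)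
        + (-1 : ℚ) ^ (i * j) • (ι V w ᵍ⊗ₜ[ℚ] ι V v : gr V ᵍ⊗[ℚ] gr V))
        + ((ι V v ᵍ⊗ₜ[ℚ] ι V w : gr V ᵍ⊗[ℚ] gr V)
        + ((1 : Lam V) ᵍ⊗ₜ[ℚ] (ι V v * ι V w) : gr V ᵍ⊗[ℚ] gr V)) := by
  have h1 := GradedTensorProduct.tmul_one_mul_coe_tmul (R := ℚ) (gr V) (gr V) (ι V v)
    ⟨ι V w, ι_mem_gr hw⟩ 1
  have h2 := GradedTensorProduct.tmul_one_mul_one_tmul (R := ℚ) (gr V) (gr V) (ι V v) (ι V w)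
  have h3 := GradedTensorProduct.tmul_coe_mul_coe_tmul (R := ℚ) (gr V) (gr V) 1
    ⟨ι V v, ι_mem_gr hv⟩ ⟨ι V w, ι_mem_gr hw⟩ 1
  have h4 := GradedTensorProduct.tmul_coe_mul_one_tmul (R := ℚ) (gr V) (gr V) 1
    ⟨ι V v, ι_mem_gr hv⟩ (ι V w)
  rw [one_mul, mul_one] at h3
  have h3' := h3.trans (units_smul_eq (i * j) _)
  have hp : ∀ x : V, primitive V x = (ι V x ᵍ⊗ₜ[ℚ] (1 : Lam V) : gr V ᵍ⊗[ℚ] gr V) +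
    ((1 : Lam V) ᵍ⊗ₜ[ℚ] ι V x : gr V ᵍ⊗[ℚ] gr V) := fun _ => rfl
  rw [hp, hp, mul_add, add_mul, add_mul]
  exact congrArg₂ (· + ·) (congrArg₂ (· + ·) h1 h3') (congrArg₂ (· + ·) h2 h4)

theorem primitive_comm (i j : ℤ) (v : V) (hv : v ∈ V.gr i) (w : V) (hw : w ∈ V.gr j) :
    primitive V v * primitive V w = (-1 : ℚ) ^ (i * j) • (primitive V w * primitive V v) := by
  have h : (-1 : ℚ) ^ (i * j) * (-1 : ℚ) ^ (i * j) = 1 := by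
    rw [← mul_zpow]; simp
  have hl : ∀ (c : ℚ) (x y : Lam V), ((c • x) ᵍ⊗ₜ[ℚ] y : gr V ᵍ⊗[ℚ] gr V) =
      c • (x ᵍ⊗ₜ[ℚ] y : gr V ᵍ⊗[ℚ] gr V) := fun c x y => rfl
  have hr : ∀ (c : ℚ) (x y : Lam V), (x ᵍ⊗ₜ[ℚ] (c • y) : gr V ᵍ⊗[ℚ] gr V) =
      c • (x ᵍ⊗ₜ[ℚ] y : gr V ᵍ⊗[ℚ] gr V) := fun c x y => TensorProduct.tmul_smul c x y
  rw [primitive_mul V i j v hv w hw, primitive_mul V j i w hw v hv, ι_mul_ι hv hw, mul_comm j i,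
    hl, hr]
  generalize (-1 : ℚ) ^ (i * j) = c at h ⊢
  simp only [smul_add, smul_smul, h, one_smul]
  ac_rfl

/-- The coproduct `Δ : ΛV → ΛV ⊗ ΛV` : the unique morphism of graded algebras (with the Koszul
sign rule on the target) for which the elements of `V` are primitive. -/
noncomputable def comulAlgHom : Lam V →ₐ[ℚ] gr V ᵍ⊗[ℚ] gr V :=
  lift (primitive V) (primitive_comm V)

/-- The coproduct of `ΛV`, as a linear map. -/
noncomputable def comul : Lam V →ₗ[ℚ] Lam V ⊗[ℚ] Lam V :=
  (GradedTensorProduct.of ℚ (gr V) (gr V)).symm.toLinearMap ∘ₗ (comulAlgHom V).toLinearMap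

/-- The counit (augmentation) `ΛV → ℚ`, which kills words of positive length. -/
noncomputable def counit : Lam V →ₐ[ℚ] ℚ := lift 0 (by simp)

end Lam

end Lam

/-! ### Linear maps out of `ΛV` given by graded-symmetric multilinear maps -/

section Descend

variable (V : GradedSpace.{u})

theorem span_words : (⊤ : Submodule ℚ (TensorAlgebra ℚ V)) ≤
    Submodule.span ℚ {x | ∃ l : List (Σ i : ℤ, V.gr i),
      x = (l.map fun a => TensorAlgebra.ι ℚ (a.2 : V)).prod} := by
  rintro x -
  induction x using TensorAlgebra.induction with
  | algebraMap r =>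
    rw [Algebra.algebraMap_eq_smul_one]
    exact Submodule.smul_mem _ _ (Submodule.subset_span ⟨[], by simp⟩)
  | ι v =>
    induction v using DirectSum.Decomposition.inductionOn V.gr with
    | zero => simp
    | add a b ha hb => rw [map_add]; exact Submodule.add_mem _ ha hb
    | @homogeneous i a => exact Submodule.subset_span ⟨[⟨i, a⟩], by simp⟩
  | add a b ha hb => exact Submodule.add_mem _ ha hb
  | mul a b ha hb =>
    have := Submodule.mul_mem_mul ha hb
    rw [Submodule.span_mul_span] at this
    refine Submodule.span_mono ?_ this
    rintro _ ⟨_, ⟨l, rfl⟩, _, ⟨m, rfl⟩, rfl⟩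
    exact ⟨l ++ m, by simp⟩

variable {V} {W : Type*} [AddCommGroup W] [Module ℚ W]

/-- Graded symmetry of a `k`-linear map, on adjacent transpositions of homogeneous arguments:
`m(…, x_b, x_a, …) = (-1)^(|x_a||x_b|) m(…, x_a, x_b, …)` for `b = a + 1`. -/
def GradedSymm {k : ℕ} (m : MultilinearMap ℚ (fun _ : Fin k => V) W) : Prop :=
  ∀ (d : Fin k → ℤ) (x : Fin k → V), (∀ i, x i ∈ V.gr (d i)) →
    ∀ a b : Fin k, (a : ℕ) + 1 = b →
      m (fun i => x (Equiv.swap a b i)) = (-1 : ℚ) ^ (d a * d b) • m x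

/-- The linear map `T(V) → W` given by a family of multilinear maps. -/
noncomputable def evalTensor (m : ∀ k : ℕ, MultilinearMap ℚ (fun _ : Fin k => V) W) :
    TensorAlgebra ℚ V →ₗ[ℚ] W :=
  DirectSum.toModule ℚ ℕ W (fun k => PiTensorProduct.lift (m k)) ∘ₗ
    TensorAlgebra.toDirectSum.toLinearMap

theorem evalTensor_prod (m : ∀ k : ℕ, MultilinearMap ℚ (fun _ : Fin k => V) W) {k : ℕ}
    (x : Fin k → V) :
    evalTensor m (List.ofFn fun i => TensorAlgebra.ι ℚ (x i)).prod = m k x := by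
  rw [← TensorAlgebra.tprod_apply, evalTensor, LinearMap.comp_apply, AlgHom.toLinearMap_apply,
    TensorAlgebra.toDirectSum_tensorPower_tprod, ← DirectSum.lof_eq_of ℚ, DirectSum.toModule_lof,
    PiTensorProduct.lift.tprod]

theorem ofFn_swap {α : Type*} (l₁ l₂ : List α) (v w : α)
    (a b : Fin (l₁ ++ v :: w :: l₂).length) (ha : (a : ℕ) = l₁.length)
    (hb : (b : ℕ) = l₁.length + 1) :
    List.ofFn (fun i => (l₁ ++ v :: w :: l₂).get (Equiv.swap a b i)) = l₁ ++ w :: v :: l₂ := by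
  apply List.ext_getElem
  · simp; omega
  · intro n h1 h2
    rw [List.getElem_ofFn, List.get_eq_getElem, Equiv.swap_apply_def]
    by_cases e1 : n = l₁.length
    · rw [if_pos (Fin.ext (by simp [e1, ha]))]
      simp [hb, e1]
    · rw [if_neg (fun h => e1 (by rw [← ha, ← h]))]
      by_cases e2 : n = l₁.length + 1
      · rw [if_pos (Fin.ext (by simp [e2, hb]))]
        simp [ha, e2]
      · rw [if_neg (fun h => e2 (by rw [← hb, ← h]))]
        by_cases e3 : n < l₁.length
        · simp [List.getElem_append_left, e3]
        · obtain ⟨k, rfl⟩ : ∃ k, n = l₁.length + (k + 2) := ⟨n - l₁.length - 2, by omega⟩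
          simp

theorem evalTensor_relation (m : ∀ k : ℕ, MultilinearMap ℚ (fun _ : Fin k => V) W)
    (hm : ∀ k, GradedSymm (m k)) (l₁ l₂ : List (Σ i : ℤ, V.gr i)) (v w : Σ i : ℤ, V.gr i) :
    evalTensor m ((l₁ ++ w :: v :: l₂).map fun a => TensorAlgebra.ι ℚ (a.2 : V)).prod =
    (-1 : ℚ) ^ (v.1 * w.1) •
      evalTensor m ((l₁ ++ v :: w :: l₂).map fun a => TensorAlgebra.ι ℚ (a.2 : V)).prod := by
  let l := l₁ ++ v :: w :: l₂
  have hl : l.length = l₁.length + (l₂.length + 2) := by simp [l]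
  let a : Fin l.length := ⟨l₁.length, by omega⟩
  let b : Fin l.length := ⟨l₁.length + 1, by omega⟩
  have h := hm l.length (fun i => (l.get i).1) (fun i => ((l.get i).2 : V))
    (fun i => (l.get i).2.2) a b rfl
  have e1 : l = List.ofFn l.get := (List.ofFn_get l).symm
  have ha : l.get a = v := by simp [l, a]
  have hb : l.get b = w := by simp [l, b]
  rw [ha, hb] at h
  rw [← ofFn_swap l₁ l₂ v w a b rfl rfl]
  change _ = _ • evalTensor m ((l.map _).prod)
  conv_rhs => rw [e1]
  rw [List.map_ofFn, List.map_ofFn]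
  exact (evalTensor_prod m _).trans (h.trans (congrArg _ (evalTensor_prod m _).symm))

theorem evalTensor_relIdeal (m : ∀ k : ℕ, MultilinearMap ℚ (fun _ : Fin k => V) W)
    (hm : ∀ k, GradedSymm (m k)) (x : TensorAlgebra ℚ V) (hx : x ∈ relIdeal V) :
    evalTensor m x = 0 := by
  have key : ∀ i j : ℤ, ∀ v ∈ V.gr i, ∀ w ∈ V.gr j, ∀ p q : TensorAlgebra ℚ V,
      evalTensor m (p * (TensorAlgebra.ι ℚ v * TensorAlgebra.ι ℚ w
        - (-1 : ℚ) ^ (i * j) • (TensorAlgebra.ι ℚ w * TensorAlgebra.ι ℚ v)) * q) = 0 := by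
    intro i j v hv w hw p q
    have hp := span_words V (Submodule.mem_top (x := p))
    have hq := span_words V (Submodule.mem_top (x := q))
    induction hp using Submodule.span_induction with
    | zero => simp
    | add p p' _ _ h h' => rw [add_mul, add_mul, map_add, h, h', add_zero]
    | smul c p _ h => rw [smul_mul_assoc, smul_mul_assoc, map_smul, h, smul_zero]
    | mem p hp =>
      induction hq using Submodule.span_induction with
      | zero => simp
      | add q q' _ _ h h' => rw [mul_add, map_add, h, h', add_zero]
      | smul c q _ h => rw [mul_smul_comm, map_smul, h, smul_zero]
      | mem q hq =>
        obtain ⟨l₁, rfl⟩ := hp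
        obtain ⟨l₂, rfl⟩ := hq
        have h := evalTensor_relation m hm l₁ l₂ ⟨j, w, hw⟩ ⟨i, v, hv⟩
        simp only [List.map_append, List.map_cons, List.prod_append, List.prod_cons] at h
        simp only [mul_sub, sub_mul, map_sub, mul_smul_comm, smul_mul_assoc, map_smul, mul_assoc]
        rw [h, mul_comm j i, sub_self]
  have hx' := TwoSidedIdeal.mem_span_iff_mem_addSubgroup_closure.1 (TwoSidedIdeal.mem_asIdeal.1 hx)
  clear hx
  induction hx' using AddSubgroup.closure_induction with
  | zero => simp
  | add x y _ _ hx hy => rw [map_add, hx, hy, add_zero]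
  | neg x _ hx => rw [map_neg, hx, neg_zero]
  | mem x h =>
    obtain ⟨_, ⟨p, -, _, ⟨i, j, v, hv, w, hw, rfl⟩, rfl⟩, q, -, rfl⟩ := h
    exact key i j v hv w hw p q

/-- The linear map `ΛV → W` given on words by a family of graded-symmetric multilinear maps:
`v₁ ∧ ⋯ ∧ vₖ ↦ mₖ(v₁, …, vₖ)`. -/
noncomputable def Lam.descend (m : ∀ k : ℕ, MultilinearMap ℚ (fun _ : Fin k => V) W)
    (hm : ∀ k, GradedSymm (m k)) : Lam V →ₗ[ℚ] W :=
  Submodule.liftQ ((relIdeal V).restrictScalars ℚ) (evalTensor m) (evalTensor_relIdeal m hm)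

theorem Lam.descend_prod (m : ∀ k : ℕ, MultilinearMap ℚ (fun _ : Fin k => V) W)
    (hm : ∀ k, GradedSymm (m k)) {k : ℕ} (x : Fin k → V) :
    Lam.descend m hm (List.ofFn fun i => Lam.ι V (x i)).prod = m k x := by
  have : (List.ofFn fun i => Lam.ι V (x i)).prod =
      Lam.mk V (List.ofFn fun i => TensorAlgebra.ι ℚ (x i)).prod := by
    rw [map_list_prod, List.map_ofFn]; rfl
  rw [this, ← evalTensor_prod m x]
  rfl

end Descend

/-! ### `L∞` algebras -/

/-- The Koszul sign `ε(σ)` of a permutation of homogeneous elements of degrees `d`, determined by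
`x₁ ∧ ⋯ ∧ xₙ = ε(σ) x_{σ(1)} ∧ ⋯ ∧ x_{σ(n)}` in the free graded-commutative algebra: each inversion
contributes `(-1)^(product of the degrees)`. -/
def koszulSign {n : ℕ} (d : Fin n → ℤ) (σ : Equiv.Perm (Fin n)) : ℚ :=
  ∏ a : Fin n, ∏ b : Fin n, if a < b ∧ σ b < σ a then (-1 : ℚ) ^ (d (σ a) * d (σ b)) else 1

/-- The signature of a permutation, as a rational number. -/
def sgn {n : ℕ} (σ : Equiv.Perm (Fin n)) : ℚ := ((Equiv.Perm.sign σ : ℤ) : ℚ)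

/-- `σ ∈ S(i, n - i)`: `σ` is increasing on the first `i` and on the last `n - i` positions. -/
def IsShuffle {n : ℕ} (i : ℕ) (σ : Equiv.Perm (Fin n)) : Prop :=
  ∀ a b : Fin n, a < b → ((b : ℕ) < i ∨ i ≤ (a : ℕ)) → σ a < σ b

instance {n : ℕ} (i : ℕ) : DecidablePred (IsShuffle (n := n) i) := fun σ =>
  inferInstanceAs (Decidable (∀ a b : Fin n, a < b → ((b : ℕ) < i ∨ i ≤ (a : ℕ)) → σ a < σ b))

/-- An `L∞` structure on the graded vector space `V`: brackets `ℓₖ`, `k ≥ 1`, of degree `k - 2`,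
skew-symmetric in the graded sense and satisfying the generalized Jacobi identities. There is no
bracket with zero inputs; this is encoded by `ℓ 0 = 0`. -/
structure LInfinityStructure (V : GradedSpace.{u}) where
  ℓ : ∀ k : ℕ, MultilinearMap ℚ (fun _ : Fin k => V) V
  ℓ_zero : ℓ 0 = 0
  degree : ∀ (k : ℕ) (d : Fin k → ℤ) (x : Fin k → V), (∀ a, x a ∈ V.gr (d a)) →
    ℓ k x ∈ V.gr (∑ a, d a + k - 2)
  skew : ∀ (k : ℕ) (d : Fin k → ℤ) (x : Fin k → V), (∀ a, x a ∈ V.gr (d a)) →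
    ∀ σ : Equiv.Perm (Fin k), ℓ k (fun a => x (σ a)) = (koszulSign d σ * sgn σ) • ℓ k x
  /-- Here the inner bracket has `i + 1` inputs (`i = 0, …, n - 1`) and the outer one
  `(n - (i + 1)) + 1` inputs. -/
  jacobi : ∀ (n : ℕ), 1 ≤ n → ∀ (d : Fin n → ℤ) (x : Fin n → V), (∀ a, x a ∈ V.gr (d a)) →
    ∑ i : Fin n, ∑ σ : Equiv.Perm (Fin n) with IsShuffle (i + 1) σ,
      (koszulSign d σ * sgn σ * (-1 : ℚ) ^ (((i : ℕ) + 1) * (n - ((i : ℕ) + 1)))) •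
        ℓ (n - ((i : ℕ) + 1) + 1)
          (Fin.cons (ℓ ((i : ℕ) + 1) fun a => x (σ (Fin.castLE i.isLt a)))
            (fun b : Fin (n - ((i : ℕ) + 1)) => x (σ ⟨(i : ℕ) + 1 + b, by omega⟩)) :
              Fin (n - ((i : ℕ) + 1) + 1) → V) = 0

namespace LInfinityStructure

variable {V : GradedSpace.{u}} (L : LInfinityStructure V)

/-- The differential `∂ = ℓ₁`. -/
noncomputable def diff : V →ₗ[ℚ] V := (MultilinearMap.ofSubsingleton ℚ V V (0 : Fin 1)).symm (L.ℓ 1)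

theorem diff_apply (x : V) : L.diff x = L.ℓ 1 (fun _ => x) := rfl

theorem diff_mem (n : ℤ) (x : V) (hx : x ∈ V.gr n) : L.diff x ∈ V.gr (n - 1) := by
  have h := L.degree 1 (fun _ => n) (fun _ => x) (fun _ => hx)
  rw [diff_apply]
  convert h using 2
  simp
  ring

/-- The homology `H_*(L) = H_*(L, ℓ₁)`. -/
noncomputable def homology : GradedSpace.{u} := V.homology L.diff L.diff_mem

/-- The class in `H_*(L)` of a cycle. -/
noncomputable def homologyClass : LinearMap.ker L.diff →ₗ[ℚ] L.homology :=
  ((LinearMap.range L.diff).submoduleOf (LinearMap.ker L.diff)).mkQ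

/-- `hₖ = (-1)^(k(k-1)/2) s ∘ ℓₖ ∘ (s⁻¹)^{⊗k}`. By the Koszul rule `(s⁻¹)^{⊗k}` sends
`y₁ ⊗ ⋯ ⊗ yₖ` to `∏ᵢ (-1)^((k - i)|yᵢ|)` times `s⁻¹y₁ ⊗ ⋯ ⊗ s⁻¹yₖ`, because the `k - i` copies of `s⁻¹`
to the right of the `i`-th one move past `yᵢ`. -/
noncomputable def h (k : ℕ) : MultilinearMap ℚ (fun _ : Fin k => V.susp) V.susp :=
  (-1 : ℚ) ^ (k * (k - 1) / 2) • V.s.toLinearMap.compMultilinearMap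
    ((L.ℓ k).compLinearMap fun i : Fin k => V.s.symm.toLinearMap ∘ₗ V.susp.signOp ^ (k - 1 - (i : ℕ)))

theorem koszulSign_swap {k : ℕ} (d : Fin k → ℤ) (a b : Fin k) (hab : (a : ℕ) + 1 = b) :
    koszulSign d (Equiv.swap a b) = (-1 : ℚ) ^ (d a * d b) := by
  have hlt : a < b := by rw [Fin.lt_def]; omega
  have key : ∀ i j : Fin k, (i < j ∧ Equiv.swap a b j < Equiv.swap a b i) ↔ (i = a ∧ j = b) := by
    intro i j
    constructor
    · rintro ⟨h1, h2⟩
      rw [Equiv.swap_apply_def, Equiv.swap_apply_def] at h2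
      split_ifs at h2 <;> simp only [Fin.lt_def, Fin.ext_iff] at * <;> omega
    · rintro ⟨rfl, rfl⟩
      rw [Equiv.swap_apply_left, Equiv.swap_apply_right]
      exact ⟨hlt, hlt⟩
  unfold koszulSign
  simp only [key]
  rw [Finset.prod_eq_single a, Finset.prod_eq_single b]
  · simp [mul_comm]
  · intro j _ hj; simp [hj]
  · simp
  · intro i _ hi; simp [hi]
  · simp

theorem signOp_pow_of_mem {i : ℤ} {v : V} (hv : v ∈ V.gr i) (n : ℕ) :
    (V.signOp ^ n) v = ((-1 : ℚ) ^ i) ^ n • v := by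
  induction n with
  | zero => simp
  | succ n ih =>
    rw [pow_succ', Module.End.mul_apply, ih, map_smul, V.signOp_of_mem hv, smul_smul, pow_succ]

theorem h_apply {k : ℕ} (d : Fin k → ℤ) (x : Fin k → V.susp) (hx : ∀ i, x i ∈ V.susp.gr (d i)) :
    L.h k x = (-1 : ℚ) ^ (k * (k - 1) / 2) • (∏ i, ((-1 : ℚ) ^ d i) ^ (k - 1 - (i : ℕ))) •
      V.s (L.ℓ k fun i => V.s.symm (x i)) := by
  have h1 : ∀ i : Fin k, (V.s.symm.toLinearMap ∘ₗ V.susp.signOp ^ (k - 1 - (i : ℕ))) (x i) =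
      ((-1 : ℚ) ^ d i) ^ (k - 1 - (i : ℕ)) • V.s.symm (x i) := fun i => by
    rw [LinearMap.comp_apply, signOp_pow_of_mem (hx i), map_smul]; rfl
  unfold h
  rw [smul_apply, LinearMap.compMultilinearMap_apply,
    MultilinearMap.compLinearMap_apply]
  simp only [h1]
  rw [MultilinearMap.map_smul_univ, map_smul]
  rfl

theorem h_gradedSymm (k : ℕ) : GradedSymm (L.h k) := by
  intro d x hx a b hab
  have hne : a ≠ b := by intro h; rw [h] at hab; omega
  rw [L.h_apply d x hx, L.h_apply (fun i => d (Equiv.swap a b i)) _ (fun i => hx _),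
    L.skew k (fun i => d i - 1) (fun i => V.s.symm (x i)) hx (Equiv.swap a b),
    koszulSign_swap _ a b hab]
  have hs : sgn (Equiv.swap a b) = -1 := by simp [sgn, Equiv.Perm.sign_swap hne]
  have hu : ∀ i, (-1 : ℚ) ^ d i * (-1 : ℚ) ^ d i = 1 := fun i => by rw [← mul_zpow]; simp
  have hprod : ∏ i, ((-1 : ℚ) ^ d (Equiv.swap a b i)) ^ (k - 1 - (i : ℕ)) =
      (-1 : ℚ) ^ d a * (-1 : ℚ) ^ d b * ∏ i, ((-1 : ℚ) ^ d i) ^ (k - 1 - (i : ℕ)) := by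
    rw [← Equiv.prod_comp (Equiv.swap a b)]
    simp only [Equiv.swap_apply_self]
    have hg : (-1 : ℚ) ^ d a * (-1 : ℚ) ^ d b =
        ∏ i, ((if i = a then (-1 : ℚ) ^ d a else 1) * (if i = b then (-1 : ℚ) ^ d b else 1)) := by
      rw [Finset.prod_mul_distrib]; simp
    rw [hg, ← Finset.prod_mul_distrib]
    refine Finset.prod_congr rfl fun i _ => ?_
    have hb := b.2
    by_cases hia : i = a
    · subst hia
      rw [Equiv.swap_apply_left, if_pos rfl, if_neg hne, mul_one,
        show k - 1 - (i : ℕ) = (k - 1 - (b : ℕ)) + 1 by omega, pow_succ', ← mul_assoc, hu, one_mul]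
    · by_cases hib : i = b
      · subst hib
        rw [Equiv.swap_apply_right, if_neg hia, if_pos rfl, one_mul,
          show k - 1 - (a : ℕ) = (k - 1 - (i : ℕ)) + 1 by omega, pow_succ']
      · rw [Equiv.swap_apply_of_ne_of_ne hia hib, if_neg hia, if_neg hib, one_mul, one_mul]
  have hsign : (-1 : ℚ) ^ d a * (-1 : ℚ) ^ d b * ((-1 : ℚ) ^ ((d a - 1) * (d b - 1)) * -1) =
      (-1 : ℚ) ^ (d a * d b) := by
    have h1 : (d a - 1) * (d b - 1) = d a * d b - d a - d b + 1 := by ring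
    have hz : (-1 : ℚ) ≠ 0 := by norm_num
    rw [h1, zpow_add₀ hz, zpow_sub₀ hz, zpow_sub₀ hz]
    have := hu a
    have := hu b
    field_simp
  rw [hs, hprod, map_smul, ← hsign]
  simp only [smul_smul]
  congr 1
  ring

end LInfinityStructure

/-! ### The Quillen chains -/

namespace Lam

variable {V : GradedSpace.{u}}

theorem gradedSymm_single (m : ∀ k : ℕ, MultilinearMap ℚ (fun _ : Fin k => V) V)
    (hm : ∀ k, GradedSymm (m k)) (k j : ℕ) : GradedSymm (if j = k then m j else 0) := by
  split_ifs
  · exact hm j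
  · intro d x _ a b _
    simp

/-- The extension of a linear map `f : ΛV → V` to `ΛV → ΛV`, `x ↦ ∑ f(x₍₁₎) ∧ x₍₂₎`. On words,
`v₁ ∧ ⋯ ∧ vₚ ↦ ∑ ε f(v_{i₁} ∧ ⋯ ∧ v_{iₖ}) ∧ v₁ ∧ ⋯ v̂_{i₁} ⋯ v̂_{iₖ} ⋯ ∧ vₚ`, the sum being over all
subsets of the letters; this is the extension of `f` as a coderivation when `f` is homogeneous. -/
noncomputable def coderivation (f : Lam V →ₗ[ℚ] V) : Lam V →ₗ[ℚ] Lam V :=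
  LinearMap.mul' ℚ (Lam V) ∘ₗ TensorProduct.map (ι V ∘ₗ f) LinearMap.id ∘ₗ comul V

variable (V)

/-- The family of multilinear maps with the identity of `V` for `k = 1` and `0` for `k ≠ 1`. -/
noncomputable def idFamily : ∀ k : ℕ, MultilinearMap ℚ (fun _ : Fin k => V) V
  | 1 => MultilinearMap.ofSubsingleton ℚ V V (0 : Fin 1) LinearMap.id
  | _ => 0

theorem idFamily_gradedSymm : ∀ k, GradedSymm (idFamily V k)
  | 0 => fun _ _ _ a => a.elim0
  | 1 => fun _ _ _ a b h => by omega
  | _ + 2 => fun _ _ _ _ _ _ => by simp [idFamily]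

/-- The projection `π : ΛV → V` onto the words of length one. -/
noncomputable def proj : Lam V →ₗ[ℚ] V := descend (idFamily V) (idFamily_gradedSymm V)

/-- `ΛᵖV`, the span of the words of length `p` (zero for negative `p`). -/
noncomputable def word (p : ℤ) : Submodule ℚ (Lam V) :=
  if 0 ≤ p then LinearMap.range (ι V) ^ p.toNat else ⊥

/-- The projection of `ΛV` onto the coaugmentation kernel, `x ↦ x - ε(x) 1`. -/
noncomputable def toCoaugKer : Lam V →ₗ[ℚ] Lam V :=
  LinearMap.id - (Algebra.linearMap ℚ (Lam V)) ∘ₗ (counit V).toLinearMap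

/-- The reduced diagonal, `x ↦ Δ x - (1 ⊗ x + x ⊗ 1)` for `x` in the coaugmentation kernel,
extended by `0` on `1`. -/
noncomputable def reducedComul : Lam V →ₗ[ℚ] Lam V ⊗[ℚ] Lam V :=
  (comul V - (TensorProduct.mk ℚ (Lam V) (Lam V) 1 + (TensorProduct.mk ℚ (Lam V) (Lam V)).flip 1))
    ∘ₗ toCoaugKer V

/-- The iterated reduced diagonals `Δⁿ : C → C^{⊗(n+1)}` of `C = ΛV`: `Δ⁰` is the identity of the
coaugmentation kernel (extended by `0` on `1`), and `Δⁿ⁺¹ = (Δⁿ ⊗ id) ∘ Δ̄`. The tensor power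
`C^{⊗(n+1)}` is the component of degree `n + 1` of the tensor algebra `T(C)`. -/
noncomputable def iterComul : ℕ → Lam V →ₗ[ℚ] TensorAlgebra ℚ (Lam V)
  | 0 => TensorAlgebra.ι ℚ ∘ₗ toCoaugKer V
  | n + 1 => LinearMap.mul' ℚ _ ∘ₗ
      TensorProduct.map (iterComul n) (TensorAlgebra.ι ℚ) ∘ₗ reducedComul V

/-- The increasing filtration `F_p = ℚ·1 ⊕ ker Δᵖ = Λ^{≤p}V` (zero for negative `p`). -/
noncomputable def filtration (p : ℤ) : Submodule ℚ (Lam V) :=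
  if 0 ≤ p then LinearMap.ker (iterComul V p.toNat) else ⊥

end Lam

namespace LInfinityStructure

variable {V : GradedSpace.{u}} (L : LInfinityStructure V)

/-- The differential `δ` of the Quillen chains `𝒞(L) = (ΛsL, δ)`, the coderivation extending all
the `hₖ` simultaneously. -/
noncomputable def δ : Lam V.susp →ₗ[ℚ] Lam V.susp :=
  Lam.coderivation (Lam.descend L.h L.h_gradedSymm)

/-- The summand `δₖ` of `δ`: the coderivation extending `hₖ`. -/
noncomputable def δPart (k : ℕ) : Lam V.susp →ₗ[ℚ] Lam V.susp :=
  Lam.coderivation (Lam.descend (fun j => if j = k then L.h j else 0)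
    (Lam.gradedSymm_single L.h L.h_gradedSymm k))

end LInfinityStructure

/-! ### The spectral sequence of a filtered complex -/

section SpectralSequence

variable {C : Type u} [AddCommGroup C] [Module ℚ C] (δ : C →ₗ[ℚ] C) (F : ℤ → Submodule ℚ C)

/-- `(C, δ)` is a differential module with increasing filtration `F` by differential submodules. -/
structure IsFilteredComplex : Prop where
  sq_zero : δ ∘ₗ δ = 0
  mono : Monotone F
  map_le : ∀ p, (F p).map δ ≤ F p

/-- `Zʳ_p = F_p ∩ δ⁻¹(F_{p-r})`. -/
def cyc (r p : ℤ) : Submodule ℚ C := F p ⊓ (F (p - r)).comap δ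

/-- `Dʳ_p = F_p ∩ δ(F_{p+r})`. -/
def bdry (r p : ℤ) : Submodule ℚ C := F p ⊓ (F (p + r)).map δ

/-- The denominator `Zʳ⁻¹_{p-1} + Dʳ⁻¹_p` of the page `Eʳ_p`. -/
def den (r p : ℤ) : Submodule ℚ C := cyc δ F (r - 1) (p - 1) ⊔ bdry δ F (r - 1) p

/-- `Eʳ_p = Zʳ_p / (Zʳ⁻¹_{p-1} + Dʳ⁻¹_p)`. -/
abbrev Page (r p : ℤ) : Type u := cyc δ F r p ⧸ (den δ F r p).submoduleOf (cyc δ F r p)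

/-- The class in `Eʳ_p` of an element of `Zʳ_p`. -/
def pageMk (r p : ℤ) : cyc δ F r p →ₗ[ℚ] Page δ F r p :=
  ((den δ F r p).submoduleOf (cyc δ F r p)).mkQ

variable {δ F}

theorem map_cyc (hδ : IsFilteredComplex δ F) (r p : ℤ) :
    ∀ x ∈ cyc δ F r p, δ x ∈ cyc δ F r (p - r) := by
  rintro x ⟨-, h⟩
  refine ⟨h, ?_⟩
  have : δ (δ x) = 0 := LinearMap.congr_fun hδ.sq_zero x
  change δ (δ x) ∈ F (p - r - r)
  rw [this]
  exact Submodule.zero_mem _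

theorem map_den (hδ : IsFilteredComplex δ F) (r p : ℤ) :
    ∀ x ∈ den δ F r p, δ x ∈ den δ F r (p - r) := by
  intro x hx
  obtain ⟨y, ⟨hy1, hy2⟩, z, ⟨-, w, -, rfl⟩, rfl⟩ := Submodule.mem_sup.1 hx
  have : δ (δ w) = 0 := LinearMap.congr_fun hδ.sq_zero w
  rw [map_add, this, add_zero]
  refine Submodule.mem_sup_right ⟨?_, y, ?_, rfl⟩
  · have h : δ y ∈ F (p - 1 - (r - 1)) := hy2
    rwa [show p - 1 - (r - 1) = p - r by ring] at h
  · rw [show p - r + (r - 1) = p - 1 by ring]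
    exact hy1

/-- The differential `dʳ : Eʳ_p → Eʳ_{p-r}`, induced by `δ : Zʳ_p → Zʳ_{p-r}`. -/
def pageD (hδ : IsFilteredComplex δ F) (r p : ℤ) : Page δ F r p →ₗ[ℚ] Page δ F r (p - r) :=
  Submodule.mapQ _ _ (δ.restrict (map_cyc hδ r p)) fun x hx => map_den hδ r p x hx

/-- The spectral sequence collapses at `E^n`: all `dʳ` with `r ≥ n` vanish. -/
def CollapsesAt (hδ : IsFilteredComplex δ F) (n : ℤ) : Prop :=
  ∀ r : ℤ, n ≤ r → ∀ p : ℤ, pageD hδ r p = 0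

end SpectralSequence

/-! ### Formality -/

/-- An `L∞` algebra: a graded vector space with an `L∞` structure. -/
structure LInfinityAlgebra where
  space : GradedSpace.{u}
  str : LInfinityStructure space

namespace LInfinityAlgebra

/-- The underlying graded coalgebra `ΛsL` of the Quillen chains on `L`. -/
abbrev Chains (L : LInfinityAlgebra.{u}) : Type u := Lam L.space.susp

/-- The differential of the Quillen chains on `L`. -/
noncomputable abbrev δ (L : LInfinityAlgebra.{u}) : L.Chains →ₗ[ℚ] L.Chains := L.str.δ

/-- The filtration of the Quillen chains on `L`. -/
noncomputable abbrev F (L : LInfinityAlgebra.{u}) : ℤ → Submodule ℚ L.Chains :=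
  Lam.filtration L.space.susp

/-- `L = L_{≥0}`. -/
def Nonneg (L : LInfinityAlgebra.{u}) : Prop := ∀ n : ℤ, n < 0 → L.space.gr n = ⊥

/-- An `L∞` morphism `L → L'`, as a morphism of (coaugmented) differential graded coalgebras
`(ΛsL, δ) → (ΛsL', δ')`. -/
structure Hom (L L' : LInfinityAlgebra.{u}) where
  toLinearMap : L.Chains →ₗ[ℚ] L'.Chains
  map_gr : ∀ n, ∀ x ∈ Lam.gr L.space.susp n, toLinearMap x ∈ Lam.gr L'.space.susp n
  map_one : toLinearMap 1 = 1
  counit_comp : (Lam.counit L'.space.susp).toLinearMap ∘ₗ toLinearMap =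
    (Lam.counit L.space.susp).toLinearMap
  comul_comp : Lam.comul L'.space.susp ∘ₗ toLinearMap =
    TensorProduct.map toLinearMap toLinearMap ∘ₗ Lam.comul L.space.susp
  δ_comp : L'.δ ∘ₗ toLinearMap = toLinearMap ∘ₗ L.δ

namespace Hom

variable {L L' : LInfinityAlgebra.{u}} (f : Hom L L')

/-- The linear part `f₁ = s⁻¹ ∘ π f ∘ s : L → L'`. -/
noncomputable def linearPart : L.space →ₗ[ℚ] L'.space :=
  L'.space.s.symm.toLinearMap ∘ₗ Lam.proj L'.space.susp ∘ₗ f.toLinearMap ∘ₗ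
    Lam.ι L.space.susp ∘ₗ L.space.s.toLinearMap

/-- `f` is an `L∞` quasi-isomorphism: `f₁ : (L, ℓ₁) → (L', ℓ₁')` is a chain map which is injective
and surjective on homology. -/
def IsQuasiIso : Prop :=
  (∀ x, L'.str.diff (f.linearPart x) = f.linearPart (L.str.diff x)) ∧
  (∀ x, L.str.diff x = 0 → (∃ y', L'.str.diff y' = f.linearPart x) → ∃ y, L.str.diff y = x) ∧
  (∀ x', L'.str.diff x' = 0 →
    ∃ x, L.str.diff x = 0 ∧ ∃ y', f.linearPart x - x' = L'.str.diff y')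

end Hom

/-- Weak equivalence: the existence of a zig-zag of `L∞` quasi-isomorphisms. -/
def WeaklyEquivalent : LInfinityAlgebra.{u} → LInfinityAlgebra.{u} → Prop :=
  Relation.EqvGen fun L L' => ∃ f : Hom L L', f.IsQuasiIso

/-- `L` is formal: it is weakly equivalent to its homology, endowed with the `L∞` structure whose
only possibly nonzero bracket is the `ℓ₂` induced by the one of `L`, `ℓ₂([x], [y]) = [ℓ₂(x, y)]`. -/
def IsFormal (L : LInfinityAlgebra.{u}) : Prop :=
  ∃ M : LInfinityStructure L.str.homology,
    (∀ k : ℕ, k ≠ 2 → M.ℓ k = 0) ∧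
    (∀ x y : LinearMap.ker L.str.diff, ∃ z : LinearMap.ker L.str.diff,
      (z : L.space) = L.str.ℓ 2 ![(x : L.space), (y : L.space)] ∧
      M.ℓ 2 ![L.str.homologyClass x, L.str.homologyClass y] = L.str.homologyClass z) ∧
    WeaklyEquivalent L ⟨L.str.homology, M⟩

end LInfinityAlgebra

end Quillen

/-!
The filtration `F_p` is the sum of `Λᵖ` and `F_{p-1}`. If the brackets below `ℓₖ` vanish, `δ`
lowers the filtration by `k - 1` and agrees with `δₖ` up to terms which are lower still, so nothing
happens before `E^{k-1}_p = F_p / F_{p-1} ≅ Λᵖ`, and `d^{k-1}` is `δₖ`.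

The differential `dʳ` vanishes on `E^r_p` if and only if every cycle modulo `F_{p-r}` in `F_p`
becomes a cycle modulo `F_{p-r-1}` after a correction in `F_{p-1}`. When only `ℓ₂` is nonzero, `δ`
is homogeneous for the word length, so that subtracting the part in `F_{p-1}` already is such a
correction. For `r ≥ 1` the condition is invariant under filtered maps which induce isomorphisms on
the homology of every `F_p / F_{p-1}`, hence of every `F_p / F_q`. A quasi-isomorphism of `L∞`
algebras is such a map: on `F_p / F_{p-1}` it is `Λᵖ` of its linear part, and over `ℚ` the functor
`Λᵖ` preserves homology isomorphisms. For the latter, a contraction of a complex onto its homology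
extends to derivations of `Λ`, whose anticommutator counts the letters in the acyclic part of a
word; away from its kernel, dividing by that number gives a contracting homotopy.
-/

namespace Quillen

theorem negOne_zpow_mul_self (n : ℤ) : (-1 : ℚ) ^ n * (-1 : ℚ) ^ n = 1 := by
  rw [← mul_zpow]; simp

theorem negOne_zpow_add (m n : ℤ) : (-1 : ℚ) ^ (m + n) = (-1 : ℚ) ^ m * (-1 : ℚ) ^ n :=
  zpow_add₀ (by norm_num) m n

namespace GradedSpace

variable {V : GradedSpace.{u}}

@[elab_as_elim]
theorem homogeneous_induction {P : V → Prop} (zero : P 0)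
    (add : ∀ x y, P x → P y → P (x + y)) (mem : ∀ i, ∀ x ∈ V.gr i, P x) (x : V) : P x := by
  induction x using DirectSum.Decomposition.inductionOn V.gr with
  | zero => exact zero
  | add a b ha hb => exact add _ _ ha hb
  | @homogeneous i a => exact mem i a a.2

variable (V) in
/-- The operator `v ↦ (-1)^(i|v|) v`, the Koszul sign of moving an element of degree `i` past
`v`. -/
noncomputable def twist (i : ℤ) : V →ₗ[ℚ] V :=
  if Even i then LinearMap.id else V.signOp

theorem twist_of_mem (i : ℤ) {n : ℤ} {v : V} (hv : v ∈ V.gr n) :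
    V.twist i v = (-1 : ℚ) ^ (i * n) • v := by
  unfold twist
  split_ifs with h
  · rw [zpow_mul, h.neg_one_zpow, one_zpow, one_smul, LinearMap.id_apply]
  · rw [zpow_mul, (Int.not_even_iff_odd.1 h).neg_one_zpow, V.signOp_of_mem hv]

theorem twist_mem (i n : ℤ) (v : V) (hv : v ∈ V.gr n) : V.twist i v ∈ V.gr n := by
  rw [twist_of_mem i hv]
  exact Submodule.smul_mem _ _ hv

end GradedSpace

namespace Lam

variable {V W : GradedSpace.{u}}

/-! ### Words -/

@[elab_as_elim]
theorem word_induction {P : Lam V → Prop} (add : ∀ x y, P x → P y → P (x + y))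
    (smul : ∀ (c : ℚ) x, P x → P (c • x)) (one : P 1)
    (mul : ∀ i, ∀ v ∈ V.gr i, ∀ x, P x → P (ι V v * x)) (x : Lam V) : P x := by
  obtain ⟨x, rfl⟩ := mk_surjective V x
  have hx := span_words V (Submodule.mem_top (x := x))
  induction hx using Submodule.span_induction with
  | zero => simpa using smul 0 1 one
  | add x y _ _ hx hy => rw [map_add]; exact add _ _ hx hy
  | smul c x _ hx => rw [map_smul]; exact smul _ _ hx
  | mem x hx =>
    obtain ⟨l, rfl⟩ := hx
    induction l with
    | nil => simpa using one
    | cons a l ih =>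
      rw [List.map_cons, List.prod_cons, map_mul]
      exact mul a.1 a.2 a.2.2 _ ih

theorem ι_mul_mem_gr {i n : ℤ} {v : V} (hv : v ∈ V.gr i) {x : Lam V} (hx : x ∈ gr V n) :
    ι V v * x ∈ gr V (i + n) :=
  SetLike.GradedMul.mul_mem (ι_mem_gr hv) hx

theorem gr_le {S : ℤ → Submodule ℚ (Lam V)} (one : 1 ∈ S 0)
    (mul : ∀ i, ∀ v ∈ V.gr i, ∀ n, ∀ x ∈ gr V n, x ∈ S n → ι V v * x ∈ S (i + n)) (n : ℤ) :
    gr V n ≤ S n := by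
  refine Submodule.span_le.2 ?_
  rintro _ ⟨l, rfl, rfl⟩
  induction l with
  | nil => simpa using one
  | cons a l ih =>
    simp only [List.map_cons, List.prod_cons, List.sum_cons]
    exact mul _ _ a.2.2 _ _ (Submodule.subset_span ⟨l, rfl, rfl⟩) ih

variable (V) in
/-- `ΛⁿV` for a natural number `n`: the span of the words of length `n`. -/
noncomputable def wordLen (n : ℕ) : Submodule ℚ (Lam V) := LinearMap.range (ι V) ^ n

theorem word_natCast (n : ℕ) : word V n = wordLen V n := by
  simp [word, wordLen]

theorem word_of_neg {p : ℤ} (hp : p < 0) : word V p = ⊥ := by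
  simp [word, hp]

theorem mem_wordLen_zero {x : Lam V} : x ∈ wordLen V 0 ↔ ∃ c : ℚ, c • 1 = x := by
  simp only [wordLen, pow_zero, Submodule.mem_one, Algebra.algebraMap_eq_smul_one]

theorem mem_wordLen_one {x : Lam V} : x ∈ wordLen V 1 ↔ ∃ v, ι V v = x := by
  rw [wordLen, pow_one, LinearMap.mem_range]

theorem one_mem_wordLen : (1 : Lam V) ∈ wordLen V 0 := mem_wordLen_zero.2 ⟨1, one_smul ℚ 1⟩

theorem ι_mem_wordLen (v : V) : ι V v ∈ wordLen V 1 := mem_wordLen_one.2 ⟨v, rfl⟩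

theorem ι_mul_mem_wordLen (v : V) {n : ℕ} {x : Lam V} (hx : x ∈ wordLen V n) :
    ι V v * x ∈ wordLen V (n + 1) := by
  rw [wordLen, pow_succ']
  exact Submodule.mul_mem_mul ⟨v, rfl⟩ hx

theorem wordLen_zero_le {S : Submodule ℚ (Lam V)} (one : 1 ∈ S) : wordLen V 0 ≤ S := by
  rw [wordLen, pow_zero]
  exact Submodule.one_le.2 one

theorem wordLen_succ_le {n : ℕ} {S : Submodule ℚ (Lam V)}
    (mul : ∀ i, ∀ v ∈ V.gr i, ∀ x ∈ wordLen V n, ι V v * x ∈ S) : wordLen V (n + 1) ≤ S := by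
  rw [wordLen, pow_succ', Submodule.mul_le]
  rintro _ ⟨v, rfl⟩ x hx
  induction v using GradedSpace.homogeneous_induction with
  | zero => simp
  | add a b ha hb => rw [map_add, add_mul]; exact S.add_mem ha hb
  | mem i v hv => exact mul i v hv x hx

/-! ### Functoriality -/

/-- The algebra map `Λφ : ΛV → ΛW` induced by a linear map `φ` of degree `0`. -/
noncomputable def map (φ : V →ₗ[ℚ] W) (hφ : ∀ n, ∀ v ∈ V.gr n, φ v ∈ W.gr n) :
    Lam V →ₐ[ℚ] Lam W :=
  lift (ι W ∘ₗ φ) fun i j v hv w hw => ι_mul_ι (hφ i v hv) (hφ j w hw)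

theorem map_ι (φ : V →ₗ[ℚ] W) (hφ) (v : V) : map φ hφ (ι V v) = ι W (φ v) := lift_ι _ _ v

theorem map_mem_wordLen (φ : V →ₗ[ℚ] W) (hφ) {n : ℕ} {x : Lam V} (hx : x ∈ wordLen V n) :
    map φ hφ x ∈ wordLen W n := by
  suffices h : wordLen V n ≤ (wordLen W n).comap (map φ hφ).toLinearMap from h hx
  clear hx
  induction n with
  | zero => exact wordLen_zero_le (by simpa using one_mem_wordLen)
  | succ n ih =>
    refine wordLen_succ_le fun i v _ x hx => ?_
    simpa [map_ι] using ι_mul_mem_wordLen (φ v) (ih hx)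

variable (V) in
/-- The operator `x ↦ (-1)^(i|x|) x` of `ΛV`, the Koszul sign of moving an element of degree `i`
past `x`. -/
noncomputable def twist (i : ℤ) : Lam V →ₐ[ℚ] Lam V := map (V.twist i) (V.twist_mem i)

theorem twist_mem_wordLen (i : ℤ) {n : ℕ} {x : Lam V} (hx : x ∈ wordLen V n) :
    twist V i x ∈ wordLen V n :=
  map_mem_wordLen _ _ hx

theorem twist_ι (i : ℤ) {j : ℤ} {v : V} (hv : v ∈ V.gr j) :
    twist V i (ι V v) = (-1 : ℚ) ^ (i * j) • ι V v := by
  rw [twist, map_ι, GradedSpace.twist_of_mem i hv, map_smul]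

theorem twist_of_mem (i : ℤ) {n : ℤ} {x : Lam V} (hx : x ∈ gr V n) :
    twist V i x = (-1 : ℚ) ^ (i * n) • x := by
  refine gr_le (S := fun n => LinearMap.eqLocus (twist V i).toLinearMap
    ((-1 : ℚ) ^ (i * n) • LinearMap.id)) (by simp) (fun j v hv n x _ hx => ?_) n hx
  change twist V i x = (-1 : ℚ) ^ (i * n) • x at hx
  change twist V i (ι V v * x) = (-1 : ℚ) ^ (i * (j + n)) • (ι V v * x)
  rw [map_mul, hx, twist_ι i hv, smul_mul_smul_comm, mul_add, negOne_zpow_add]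

theorem twist_mul_ι {i : ℤ} {v : V} (hv : v ∈ V.gr i) (x : Lam V) :
    twist V i x * ι V v = ι V v * x := by
  induction x using word_induction with
  | add x y hx hy => rw [map_add, add_mul, mul_add, hx, hy]
  | smul c x hx => rw [map_smul, smul_mul_assoc, mul_smul_comm, hx]
  | one => simp
  | mul j w hw x hx =>
    rw [map_mul, mul_assoc, hx, twist_ι i hw, smul_mul_assoc, ← mul_assoc, ← mul_assoc,
      ι_mul_ι hv hw, smul_mul_assoc]

/-! ### The coproduct -/

theorem comul_one : comul V 1 = 1 ⊗ₜ 1 := by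
  simp only [comul, LinearMap.comp_apply, AlgHom.toLinearMap_apply, map_one]
  rfl

theorem primitive_mul_of {i : ℤ} {v : V} (hv : v ∈ V.gr i) (y : Lam V ⊗[ℚ] Lam V) :
    (GradedTensorProduct.of ℚ (gr V) (gr V)).symm
        (primitive V v * GradedTensorProduct.of ℚ (gr V) (gr V) y) =
      TensorProduct.map (LinearMap.mulLeft ℚ (ι V v)) LinearMap.id y +
      TensorProduct.map (twist V i).toLinearMap (LinearMap.mulLeft ℚ (ι V v)) y := by
  induction y using TensorProduct.induction_on with
  | zero => simp
  | add a b ha hb => simp only [map_add, mul_add, ha, hb]; abel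
  | tmul a b =>
    induction a using DirectSum.Decomposition.inductionOn (gr V) with
    | zero => simp
    | add a a' ha ha' =>
      simp only [TensorProduct.add_tmul, map_add, mul_add, ha, ha']; abel
    | @homogeneous n a =>
      have left := GradedTensorProduct.tmul_one_mul_coe_tmul (R := ℚ) (gr V) (gr V) (ι V v) a b
      have right := GradedTensorProduct.tmul_coe_mul_coe_tmul (R := ℚ) (gr V) (gr V) 1
        ⟨ι V v, ι_mem_gr hv⟩ a b
      rw [one_mul] at right
      have hp : primitive V v = (ι V v ᵍ⊗ₜ[ℚ] (1 : Lam V) : gr V ᵍ⊗[ℚ] gr V) +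
        ((1 : Lam V) ᵍ⊗ₜ[ℚ] ι V v : gr V ᵍ⊗[ℚ] gr V) := rfl
      rw [hp, add_mul, map_add]
      refine congrArg₂ (· + ·) left ((right.trans (units_smul_eq (i * n) _)).trans ?_)
      rw [TensorProduct.map_tmul, AlgHom.toLinearMap_apply, twist_of_mem i a.2]
      rfl

theorem comul_ι_mul {i : ℤ} {v : V} (hv : v ∈ V.gr i) (x : Lam V) :
    comul V (ι V v * x) =
      TensorProduct.map (LinearMap.mulLeft ℚ (ι V v)) LinearMap.id (comul V x) +
      TensorProduct.map (twist V i).toLinearMap (LinearMap.mulLeft ℚ (ι V v)) (comul V x) := by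
  rw [← primitive_mul_of hv, ← show comulAlgHom V (ι V v) = primitive V v from lift_ι _ _ v]
  simp only [comul, LinearMap.comp_apply, AlgHom.toLinearMap_apply, map_mul]
  rfl

theorem counit_ι_mul (v : V) (x : Lam V) : counit V (ι V v * x) = 0 := by
  simp [counit]

theorem counit_twist (i : ℤ) (x : Lam V) : counit V (twist V i x) = counit V x := by
  have h : (counit V).comp (twist V i) = counit V :=
    algHom_ext (LinearMap.ext fun v => by simp [counit, twist, map_ι])
  exact DFunLike.congr_fun h x

theorem toCoaugKer_apply (x : Lam V) : toCoaugKer V x = x - counit V x • 1 := by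
  simp [toCoaugKer, Algebra.algebraMap_eq_smul_one]

theorem toCoaugKer_one : toCoaugKer V 1 = 0 := by simp [toCoaugKer_apply]

theorem toCoaugKer_ι_mul (v : V) (x : Lam V) : toCoaugKer V (ι V v * x) = ι V v * x := by
  rw [toCoaugKer_apply, counit_ι_mul, zero_smul, sub_zero]

/-! ### The grading by word length -/

instance : SetLike.GradedMonoid (wordLen V) :=
  inferInstanceAs (SetLike.GradedMonoid (LinearMap.range (ι V) ^ · : ℕ → Submodule ℚ (Lam V)))

variable (V) in
/-- The inclusion `V → Λ¹V ⊆ ⨁ₙ ΛⁿV`. -/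
noncomputable def letter : V →ₗ[ℚ] ⨁ n, wordLen V n :=
  DirectSum.lof ℚ ℕ (fun n => wordLen V n) 1 ∘ₗ (ι V).codRestrict (wordLen V 1) ι_mem_wordLen

theorem letter_apply (v : V) :
    letter V v = DirectSum.of (fun n => wordLen V n) 1 ⟨ι V v, ι_mem_wordLen v⟩ := rfl

theorem letter_comm (i j : ℤ) (v : V) (hv : v ∈ V.gr i) (w : V) (hw : w ∈ V.gr j) :
    letter V v * letter V w = (-1 : ℚ) ^ (i * j) • (letter V w * letter V v) := by
  simp only [letter_apply, DirectSum.of_mul_of]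
  simp only [← DirectSum.lof_eq_of ℚ, ← map_smul]
  exact congrArg _ (Subtype.ext (ι_mul_ι hv hw))

variable (V) in
/-- The decomposition of the elements of `ΛV` by word length. -/
noncomputable def toWordLen : Lam V →ₐ[ℚ] ⨁ n, wordLen V n :=
  lift (A := ⨁ n, wordLen V n) (letter V) letter_comm

theorem toWordLen_of_mem {n : ℕ} {x : Lam V} (hx : x ∈ wordLen V n) :
    toWordLen V x = DirectSum.of (fun n => wordLen V n) n ⟨x, hx⟩ := by
  induction n generalizing x with
  | zero =>
    obtain ⟨c, rfl⟩ := mem_wordLen_zero.1 hx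
    rw [map_smul, map_one, DirectSum.one_def, ← DirectSum.lof_eq_of ℚ, ← DirectSum.lof_eq_of ℚ,
      ← map_smul]
    rfl
  | succ n ih =>
    let S := LinearMap.eqLocus ((toWordLen V).toLinearMap ∘ₗ (wordLen V (n + 1)).subtype)
      (DirectSum.lof ℚ ℕ (fun n => wordLen V n) (n + 1))
    suffices h : wordLen V (n + 1) ≤ S.map (wordLen V (n + 1)).subtype by
      obtain ⟨y, hy, rfl⟩ := h hx
      exact hy
    refine wordLen_succ_le fun i v _ x hx =>
      ⟨⟨ι V v * x, ι_mul_mem_wordLen v hx⟩, ?_, rfl⟩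
    change toWordLen V (ι V v * x) = DirectSum.of (fun n => wordLen V n) (n + 1) _
    rw [map_mul, ih hx, toWordLen, lift_ι, letter_apply, DirectSum.of_mul_of]
    exact DirectSum.of_eq_of_gradedMonoid_eq (Sigma.subtype_ext (add_comm 1 n) rfl)

noncomputable instance : GradedAlgebra (wordLen V) :=
  GradedAlgebra.ofAlgHom _ (toWordLen V)
    (algHom_ext (LinearMap.ext fun v => by
      simp [toWordLen, letter_apply, DirectSum.coeAlgHom_of]))
    fun _ x => toWordLen_of_mem x.2

theorem linearMap_ext_wordLen {M : Type*} [AddCommGroup M] [Module ℚ M] {f g : Lam V →ₗ[ℚ] M}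
    (h : ∀ n, ∀ x ∈ wordLen V n, f x = g x) : f = g :=
  DirectSum.decompose_lhom_ext (wordLen V) fun n => LinearMap.ext fun x => h n x x.2

variable (V) in
/-- The projection of `ΛV` onto the span of the words of length `n`. -/
noncomputable def lenProj (n : ℕ) : Lam V →ₗ[ℚ] Lam V := GradedAlgebra.proj (wordLen V) n

theorem lenProj_mem (n : ℕ) (x : Lam V) : lenProj V n x ∈ wordLen V n :=
  (DirectSum.decompose (wordLen V) x n).2

theorem lenProj_of_mem {n : ℕ} {x : Lam V} (hx : x ∈ wordLen V n) : lenProj V n x = x :=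
  DirectSum.decompose_of_mem_same _ hx

theorem lenProj_of_mem_ne {m n : ℕ} (h : m ≠ n) {x : Lam V} (hx : x ∈ wordLen V m) :
    lenProj V n x = 0 :=
  DirectSum.decompose_of_mem_ne _ hx h

theorem exists_eq_sum_lenProj (x : Lam V) : ∃ s : Finset ℕ, x = ∑ n ∈ s, lenProj V n x := by
  classical
  exact ⟨_, (DirectSum.sum_support_decompose (wordLen V) x).symm⟩

variable (V) in
/-- The operator which multiplies words of length `n` by `α n`. -/
noncomputable def scale (α : ℕ → ℚ) : Lam V →ₗ[ℚ] Lam V :=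
  DirectSum.coeLinearMap (wordLen V) ∘ₗ
    DirectSum.lmap (fun n : ℕ => α n • (LinearMap.id : wordLen V n →ₗ[ℚ] wordLen V n)) ∘ₗ
    (DirectSum.decomposeLinearEquiv (wordLen V)).toLinearMap

theorem scale_of_mem (α : ℕ → ℚ) {n : ℕ} {x : Lam V} (hx : x ∈ wordLen V n) :
    scale V α x = α n • x := by
  lift x to wordLen V n using hx
  simp only [scale, LinearMap.comp_apply, LinearEquiv.coe_coe,
    DirectSum.decomposeLinearEquiv_apply, DirectSum.decompose_coe]
  rw [← DirectSum.lof_eq_of ℚ, DirectSum.lmap_lof]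
  simp

theorem lenProj_eq_scale (n : ℕ) : lenProj V n = scale V (Pi.single n 1) :=
  linearMap_ext_wordLen fun m x hx => by
    rw [scale_of_mem _ hx]
    obtain rfl | h := eq_or_ne m n
    · rw [lenProj_of_mem hx, Pi.single_eq_same, one_smul]
    · rw [lenProj_of_mem_ne h hx, Pi.single_eq_of_ne h, zero_smul]

theorem toCoaugKer_eq_scale : toCoaugKer V = scale V (fun n => if n = 0 then 0 else 1) := by
  refine linearMap_ext_wordLen fun n x hx => ?_
  rw [scale_of_mem _ hx]
  cases n with
  | zero =>
    obtain ⟨c, rfl⟩ := mem_wordLen_zero.1 hx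
    simp [toCoaugKer_one]
  | succ n =>
    suffices h : wordLen V (n + 1) ≤ LinearMap.eqLocus (toCoaugKer V) LinearMap.id by
      simpa using h hx
    exact wordLen_succ_le fun i v _ x _ => toCoaugKer_ι_mul v x

theorem scale_comp_mulLeft (α : ℕ → ℚ) (v : V) :
    scale V α ∘ₗ LinearMap.mulLeft ℚ (ι V v) =
      LinearMap.mulLeft ℚ (ι V v) ∘ₗ scale V (fun n => α (n + 1)) :=
  linearMap_ext_wordLen fun n x hx => by
    simp [scale_of_mem _ hx, scale_of_mem _ (ι_mul_mem_wordLen v hx)]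

theorem scale_comp_twist (α : ℕ → ℚ) (i : ℤ) :
    scale V α ∘ₗ (twist V i).toLinearMap = (twist V i).toLinearMap ∘ₗ scale V α :=
  linearMap_ext_wordLen fun n x hx => by
    simp [scale_of_mem _ hx, scale_of_mem _ (twist_mem_wordLen i hx)]

end Lam

/-- The binomial convolution `n ↦ ∑ (n choose a) α(a) β(n - a)`. -/
def binomConv (α β : ℕ → ℚ) (n : ℕ) : ℚ :=
  ∑ ab ∈ Finset.HasAntidiagonal.antidiagonal n, n.choose ab.1 * (α ab.1 * β ab.2)

theorem binomConv_zero (α β : ℕ → ℚ) : binomConv α β 0 = α 0 * β 0 := by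
  simp [binomConv]

theorem binomConv_succ (α β : ℕ → ℚ) (n : ℕ) : binomConv α β (n + 1) =
    binomConv (fun a => α (a + 1)) β n + binomConv α (fun b => β (b + 1)) n := by
  rw [binomConv, Finset.sum_antidiagonal_choose_succ_mul (fun a b => α a * β b), add_comm]
  refine congrArg (· + _) (Finset.sum_congr rfl fun ab hab => ?_)
  rw [Nat.choose_symm_of_eq_add (Finset.HasAntidiagonal.mem_antidiagonal.1 hab).symm]

theorem binomConv_nonneg {α β : ℕ → ℚ} (hα : 0 ≤ α) (hβ : 0 ≤ β) : 0 ≤ binomConv α β :=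
  fun _ => Finset.sum_nonneg fun _ _ =>
    mul_nonneg (Nat.cast_nonneg _) (mul_nonneg (hα _) (hβ _))

theorem binomConv_pos {α β : ℕ → ℚ} (hα : 0 ≤ α) (hβ : 0 ≤ β) {a b : ℕ} (ha : 0 < α a)
    (hb : 0 < β b) : 0 < binomConv α β (a + b) := by
  refine Finset.sum_pos' (fun _ _ => mul_nonneg (Nat.cast_nonneg _) (mul_nonneg (hα _) (hβ _)))
    ⟨(a, b), Finset.HasAntidiagonal.mem_antidiagonal.2 rfl, ?_⟩
  have := Nat.choose_pos (Nat.le_add_right a b)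
  positivity

theorem binomConv_single (a b : ℕ) : binomConv (Pi.single a 1) (Pi.single b 1) =
    Pi.single (a + b) ((a + b).choose a : ℚ) := by
  ext n
  have hne {c d : ℕ} (h : (c, d) ≠ (a, b)) :
      (Pi.single a 1 : ℕ → ℚ) c * (Pi.single b 1 : ℕ → ℚ) d = 0 := by
    rw [Ne, Prod.mk.injEq, not_and_or] at h
    obtain h | h := h <;> simp [Pi.single_eq_of_ne h]
  obtain rfl | hn := eq_or_ne n (a + b)
  · rw [binomConv, Finset.sum_eq_single (a, b)]
    · simp
    · exact fun _ _ h => by rw [hne h, mul_zero]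
    · simp
  · rw [Pi.single_eq_of_ne hn, binomConv]
    refine Finset.sum_eq_zero fun ⟨c, d⟩ hcd => ?_
    rw [hne, mul_zero]
    rintro ⟨⟩
    exact hn (Finset.HasAntidiagonal.mem_antidiagonal.1 hcd).symm

namespace Lam

variable {V W : GradedSpace.{u}} {A : Type*} [Ring A] [Algebra ℚ A]

/-! ### Convolution -/

/-- The convolution product `x ↦ ∑ f(x₍₁₎) g(x₍₂₎)` of linear maps from `ΛV` to an algebra. -/
noncomputable def conv (f g : Lam V →ₗ[ℚ] A) : Lam V →ₗ[ℚ] A :=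
  LinearMap.mul' ℚ A ∘ₗ TensorProduct.map f g ∘ₗ comul V

theorem conv_one (f g : Lam V →ₗ[ℚ] A) : conv f g 1 = f 1 * g 1 := by
  simp [conv, comul_one]

theorem conv_ι_mul (f g : Lam V →ₗ[ℚ] A) {i : ℤ} {v : V} (hv : v ∈ V.gr i) (x : Lam V) :
    conv f g (ι V v * x) = conv (f ∘ₗ LinearMap.mulLeft ℚ (ι V v)) g x +
      conv (f ∘ₗ (twist V i).toLinearMap) (g ∘ₗ LinearMap.mulLeft ℚ (ι V v)) x := by
  simp only [conv, LinearMap.comp_apply, comul_ι_mul hv, map_add, TensorProduct.map_map,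
    LinearMap.comp_id]

theorem conv_sub_right (f g g' : Lam V →ₗ[ℚ] A) : conv f (g - g') = conv f g - conv f g' := by
  rw [conv, ← TensorProduct.mapBilinear_apply, map_sub, LinearMap.sub_comp,
    LinearMap.comp_sub]
  rfl

theorem conv_zero_left (g : Lam V →ₗ[ℚ] A) : conv 0 g = 0 := by
  rw [conv, TensorProduct.map_zero_left, LinearMap.zero_comp, LinearMap.comp_zero]

theorem conv_zero_right (f : Lam V →ₗ[ℚ] A) : conv f 0 = 0 := by
  rw [conv, TensorProduct.map_zero_right, LinearMap.zero_comp, LinearMap.comp_zero]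

theorem comp_conv {B : Type*} [Ring B] [Algebra ℚ B] (φ : A →ₐ[ℚ] B) (f g : Lam V →ₗ[ℚ] A) :
    φ.toLinearMap ∘ₗ conv f g = conv (φ.toLinearMap ∘ₗ f) (φ.toLinearMap ∘ₗ g) := by
  have h : φ.toLinearMap ∘ₗ LinearMap.mul' ℚ A =
      LinearMap.mul' ℚ B ∘ₗ TensorProduct.map φ.toLinearMap φ.toLinearMap :=
    TensorProduct.ext' fun a b => by simp
  rw [conv, ← LinearMap.comp_assoc, h, conv, TensorProduct.map_comp]
  rfl

theorem conv_comp {f : Lam V →ₗ[ℚ] Lam W}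
    (hf : comul W ∘ₗ f = TensorProduct.map f f ∘ₗ comul V) (g h : Lam W →ₗ[ℚ] A) :
    conv g h ∘ₗ f = conv (g ∘ₗ f) (h ∘ₗ f) := by
  simp only [conv, LinearMap.comp_assoc, hf, TensorProduct.map_comp]

theorem conv_mulLeft_comp (a : A) (f g : Lam V →ₗ[ℚ] A) :
    conv (LinearMap.mulLeft ℚ a ∘ₗ f) g = LinearMap.mulLeft ℚ a ∘ₗ conv f g := by
  have h : LinearMap.mul' ℚ A ∘ₗ TensorProduct.map (LinearMap.mulLeft ℚ a) LinearMap.id =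
      LinearMap.mulLeft ℚ a ∘ₗ LinearMap.mul' ℚ A :=
    TensorProduct.ext' fun b c => by simp [mul_assoc]
  rw [conv, ← LinearMap.id_comp g, TensorProduct.map_comp, LinearMap.comp_assoc,
    ← LinearMap.comp_assoc, h]
  rfl

theorem conv_mulLeft_comp_of_commute {f f' : Lam V →ₗ[ℚ] A} {a : A}
    (h : ∀ x, f' x * a = a * f x) (g : Lam V →ₗ[ℚ] A) :
    conv f' (LinearMap.mulLeft ℚ a ∘ₗ g) = LinearMap.mulLeft ℚ a ∘ₗ conv f g := by
  have hmul : LinearMap.mul' ℚ A ∘ₗ TensorProduct.map f' (LinearMap.mulLeft ℚ a ∘ₗ g) =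
      LinearMap.mulLeft ℚ a ∘ₗ LinearMap.mul' ℚ A ∘ₗ TensorProduct.map f g :=
    TensorProduct.ext' fun b c => by simp [← mul_assoc, h]
  rw [conv, ← LinearMap.comp_assoc, hmul]
  rfl

theorem conv_counit_smul (f : Lam V →ₗ[ℚ] A) (a : A) (x : Lam V) :
    conv f ((LinearMap.toSpanSingleton ℚ A a) ∘ₗ (counit V).toLinearMap) x = f x * a := by
  induction x using word_induction generalizing f with
  | add x y hx hy => rw [map_add, map_add, hx, hy, add_mul]
  | smul c x hx => rw [map_smul, map_smul, hx, smul_mul_assoc]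
  | one => simp [conv_one]
  | mul i v hv x hx =>
    have h : (LinearMap.toSpanSingleton ℚ A a ∘ₗ (counit V).toLinearMap) ∘ₗ
        LinearMap.mulLeft ℚ (ι V v) = 0 :=
      LinearMap.ext fun y => by simp [counit_ι_mul]
    rw [conv_ι_mul _ _ hv, h, conv_zero_right, hx]
    simp

theorem conv_counit_smul_left (a : A) (g : Lam V →ₗ[ℚ] A) (x : Lam V) :
    conv (LinearMap.toSpanSingleton ℚ A a ∘ₗ (counit V).toLinearMap) g x = a * g x := by
  induction x using word_induction generalizing g with
  | add x y hx hy => rw [map_add, map_add, hx, hy, mul_add]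
  | smul c x hx => rw [map_smul, map_smul, hx, mul_smul_comm]
  | one => simp [conv_one]
  | mul i v hv x hx =>
    have hmul : (LinearMap.toSpanSingleton ℚ A a ∘ₗ (counit V).toLinearMap) ∘ₗ
        LinearMap.mulLeft ℚ (ι V v) = 0 :=
      LinearMap.ext fun y => by simp [counit_ι_mul]
    have htwist : (LinearMap.toSpanSingleton ℚ A a ∘ₗ (counit V).toLinearMap) ∘ₗ
        (twist V i).toLinearMap = LinearMap.toSpanSingleton ℚ A a ∘ₗ (counit V).toLinearMap :=
      LinearMap.ext fun y => by simp [counit_twist]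
    rw [conv_ι_mul _ _ hv, hmul, htwist, conv_zero_left, LinearMap.zero_apply, zero_add, hx]
    simp

theorem conv_mem_of_wordLen {n : ℕ} {f g : Lam V →ₗ[ℚ] A} {S : Submodule ℚ A}
    (h : ∀ a b, a + b = n → ∀ y ∈ wordLen V a, ∀ z ∈ wordLen V b, f y * g z ∈ S)
    {x : Lam V} (hx : x ∈ wordLen V n) : conv f g x ∈ S := by
  suffices hS : wordLen V n ≤ S.comap (conv f g) from hS hx
  clear hx x
  induction n generalizing f g with
  | zero =>
    refine wordLen_zero_le ?_
    rw [Submodule.mem_comap, conv_one]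
    exact h 0 0 rfl 1 one_mem_wordLen 1 one_mem_wordLen
  | succ n ih =>
    refine wordLen_succ_le fun i v hv x hx => ?_
    rw [Submodule.mem_comap, conv_ι_mul f g hv]
    refine S.add_mem (ih (fun a b hab y hy z hz => ?_) hx) (ih (fun a b hab y hy z hz => ?_) hx)
    · exact h (a + 1) b (by omega) _ (ι_mul_mem_wordLen v hy) z hz
    · exact h a (b + 1) (by omega) _ (twist_mem_wordLen i hy) _ (ι_mul_mem_wordLen v hz)

theorem conv_congr_of_wordLen {n : ℕ} {f g f' g' : Lam V →ₗ[ℚ] A}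
    (h : ∀ a b, a + b = n → ∀ y ∈ wordLen V a, ∀ z ∈ wordLen V b, f y * g z = f' y * g' z)
    {x : Lam V} (hx : x ∈ wordLen V n) : conv f g x = conv f' g' x := by
  have hmem : conv (f.prod f') (g.prod g') x ∈
      LinearMap.eqLocus (LinearMap.fst ℚ A A) (LinearMap.snd ℚ A A) :=
    conv_mem_of_wordLen h hx
  have hfst := LinearMap.congr_fun (comp_conv (AlgHom.fst ℚ A A) (f.prod f') (g.prod g')) x
  have hsnd := LinearMap.congr_fun (comp_conv (AlgHom.snd ℚ A A) (f.prod f') (g.prod g')) x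
  exact hfst.symm.trans (hmem.trans hsnd)

theorem conv_scale (α β : ℕ → ℚ) : conv (scale V α) (scale V β) = scale V (binomConv α β) := by
  refine linearMap_ext_wordLen fun n x hx => ?_
  rw [scale_of_mem _ hx]
  suffices h : wordLen V n ≤ LinearMap.eqLocus (conv (scale V α) (scale V β))
      (binomConv α β n • LinearMap.id) from h hx
  clear hx x
  induction n generalizing α β with
  | zero =>
    refine wordLen_zero_le ?_
    simp [conv_one, scale_of_mem _ one_mem_wordLen, binomConv_zero, smul_smul, mul_comm]
  | succ n ih =>
    refine wordLen_succ_le fun i v hv x hx => ?_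
    have left : conv (scale V fun a => α (a + 1)) (scale V β) x = _ := ih _ β hx
    have right : conv (scale V α) (scale V fun b => β (b + 1)) x = _ := ih α _ hx
    rw [LinearMap.mem_eqLocus, conv_ι_mul _ _ hv, scale_comp_mulLeft, scale_comp_twist,
      scale_comp_mulLeft, conv_mulLeft_comp,
      conv_mulLeft_comp_of_commute (fun y => twist_mul_ι hv _),
      LinearMap.comp_apply, LinearMap.comp_apply, left, right, ← map_add, binomConv_succ]
    simp [add_smul, mul_add]

theorem conv_lenProj (a b : ℕ) :
    conv (lenProj V a) (lenProj V b) = ((a + b).choose a : ℚ) • lenProj V (a + b) := by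
  refine linearMap_ext_wordLen fun n x hx => ?_
  rw [lenProj_eq_scale, lenProj_eq_scale, conv_scale, binomConv_single, lenProj_eq_scale,
    LinearMap.smul_apply, scale_of_mem _ hx, scale_of_mem _ hx, smul_smul, Pi.single_apply,
    Pi.single_apply, mul_ite, mul_one, mul_zero]

/-! ### The iterated reduced diagonal -/

theorem iterComul_one (m : ℕ) : iterComul V m 1 = 0 := by
  cases m <;> simp [iterComul, reducedComul, toCoaugKer_one]

theorem iterComul_succ (m : ℕ) : iterComul V (m + 1) =
    conv (iterComul V m) (TensorAlgebra.ι ℚ ∘ₗ toCoaugKer V) := by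
  have hconv : conv (iterComul V m) (TensorAlgebra.ι ℚ ∘ₗ toCoaugKer V) =
      conv (iterComul V m) (TensorAlgebra.ι ℚ) -
        LinearMap.mulRight ℚ (TensorAlgebra.ι ℚ (1 : Lam V)) ∘ₗ iterComul V m := by
    have hT : TensorAlgebra.ι ℚ ∘ₗ toCoaugKer V = TensorAlgebra.ι ℚ -
        LinearMap.toSpanSingleton ℚ _ (TensorAlgebra.ι ℚ (1 : Lam V)) ∘ₗ (counit V).toLinearMap :=
      LinearMap.ext fun x => by simp [toCoaugKer_apply]
    rw [hT, conv_sub_right]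
    exact congrArg _ (LinearMap.ext fun x => conv_counit_smul _ _ x)
  have hred : iterComul V (m + 1) =
      conv (iterComul V m) (TensorAlgebra.ι ℚ ∘ₗ toCoaugKer V) ∘ₗ toCoaugKer V := by
    rw [hconv]
    ext x
    simp [iterComul, reducedComul, conv, iterComul_one]
  rw [hred]
  ext x
  simp [toCoaugKer_apply x, conv_one, iterComul_one]

theorem iterComul_of_mem {m n : ℕ} (hnm : n ≤ m) {x : Lam V} (hx : x ∈ wordLen V n) :
    iterComul V m x = 0 := by
  have hzero : ∀ {y : Lam V}, y ∈ wordLen V 0 → toCoaugKer V y = 0 := fun hy => by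
    rw [toCoaugKer_eq_scale, scale_of_mem _ hy, if_pos rfl, zero_smul]
  induction m generalizing n x with
  | zero =>
    obtain rfl : n = 0 := by omega
    rw [iterComul, LinearMap.comp_apply, hzero hx, map_zero]
  | succ m ih =>
    rw [iterComul_succ, ← Submodule.mem_bot ℚ]
    refine conv_mem_of_wordLen (fun a b hab y hy z hz => ?_) hx
    rw [Submodule.mem_bot]
    obtain rfl | hb := Nat.eq_zero_or_pos b
    · rw [LinearMap.comp_apply, hzero hz, map_zero, mul_zero]
    · rw [ih (by omega) hy, zero_mul]

/-- The number of surjections from a set with `n` elements onto a set with `m + 1` elements, the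
scalar by which the product of the letters of the `m`-th iterated reduced diagonal acts on words of
length `n`. -/
def surjCount : ℕ → ℕ → ℚ
  | 0 => fun n => if n = 0 then 0 else 1
  | m + 1 => binomConv (surjCount m) (fun n => if n = 0 then 0 else 1)

theorem surjCount_nonneg (m : ℕ) : 0 ≤ surjCount m := by
  have h : (0 : ℕ → ℚ) ≤ fun n => if n = 0 then 0 else 1 := fun n => by
    rw [Pi.zero_apply]; beta_reduce; split_ifs <;> norm_num
  induction m with
  | zero => exact h
  | succ m ih => exact binomConv_nonneg ih h

theorem surjCount_pos {m n : ℕ} (h : m < n) : 0 < surjCount m n := by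
  induction m generalizing n with
  | zero => simp [surjCount, h.ne']
  | succ m ih =>
    obtain ⟨n, rfl⟩ : ∃ k, n = k + 1 := ⟨n - 1, by omega⟩
    exact binomConv_pos (b := 1) (surjCount_nonneg m) (surjCount_nonneg 0) (ih (by omega)) one_pos

theorem lift_iterComul (m : ℕ) :
    (TensorAlgebra.lift ℚ LinearMap.id : TensorAlgebra ℚ (Lam V) →ₐ[ℚ] Lam V).toLinearMap ∘ₗ
      iterComul V m = scale V (surjCount m) := by
  have hT : (TensorAlgebra.lift ℚ LinearMap.id :
      TensorAlgebra ℚ (Lam V) →ₐ[ℚ] Lam V).toLinearMap ∘ₗ TensorAlgebra.ι ℚ ∘ₗ toCoaugKer V =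
      scale V fun n => if n = 0 then 0 else 1 := by
    rw [← toCoaugKer_eq_scale]
    ext x
    simp
  induction m with
  | zero => exact hT
  | succ m ih => rw [iterComul_succ, comp_conv, ih, hT, conv_scale, surjCount]

/-! ### The filtration by word length -/

theorem filtration_of_neg {p : ℤ} (hp : p < 0) : filtration V p = ⊥ := by
  rw [filtration, if_neg hp.not_ge]

theorem mem_filtration_natCast {p : ℕ} {x : Lam V} :
    x ∈ filtration V p ↔ ∀ n, p < n → lenProj V n x = 0 := by
  rw [filtration, if_pos (Int.natCast_nonneg p), Int.toNat_natCast, LinearMap.mem_ker]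
  constructor
  · intro h n hn
    have hscale : scale V (surjCount p) x = 0 := by
      rw [← lift_iterComul, LinearMap.comp_apply, h, map_zero]
    have hcomm : lenProj V n ∘ₗ scale V (surjCount p) = surjCount p n • lenProj V n :=
      linearMap_ext_wordLen fun m y hy => by
        obtain rfl | hmn := eq_or_ne m n
        · simp [scale_of_mem _ hy]
        · simp [scale_of_mem _ hy, lenProj_of_mem_ne hmn hy]
    have := LinearMap.congr_fun hcomm x
    rw [LinearMap.comp_apply, hscale, map_zero] at this
    exact (smul_eq_zero.1 this.symm).resolve_left (surjCount_pos hn).ne'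
  · intro h
    obtain ⟨s, hs⟩ := exists_eq_sum_lenProj x
    rw [hs, map_sum]
    refine Finset.sum_eq_zero fun n _ => ?_
    by_cases hn : n ≤ p
    · exact iterComul_of_mem hn (lenProj_mem n x)
    · rw [h n (by omega), map_zero]

theorem mem_filtration {p : ℤ} {x : Lam V} :
    x ∈ filtration V p ↔ ∀ n : ℕ, p < n → lenProj V n x = 0 := by
  obtain hp | hp := lt_or_ge p 0
  · rw [filtration_of_neg hp, Submodule.mem_bot]
    refine ⟨fun h n _ => by rw [h, map_zero], fun h => ?_⟩
    obtain ⟨s, hs⟩ := exists_eq_sum_lenProj x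
    rw [hs]
    exact Finset.sum_eq_zero fun n _ => h n (by omega)
  · lift p to ℕ using hp
    simp only [mem_filtration_natCast, Nat.cast_lt]

theorem filtration_mono : Monotone (filtration V) := fun p q hpq x hx =>
  mem_filtration.2 fun n hn => mem_filtration.1 hx n (by omega)

theorem wordLen_le_filtration {n : ℕ} {p : ℤ} (h : (n : ℤ) ≤ p) : wordLen V n ≤ filtration V p :=
  fun _ hx => mem_filtration.2 fun _ hm => lenProj_of_mem_ne (by omega) hx

theorem sub_lenProj_mem_filtration {n : ℕ} {x : Lam V} (hx : x ∈ filtration V n) :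
    x - lenProj V n x ∈ filtration V (n - 1) := by
  refine mem_filtration.2 fun m hm => ?_
  rw [map_sub, sub_eq_zero]
  obtain rfl | hne := eq_or_ne n m
  · rw [lenProj_of_mem (lenProj_mem n x)]
  · rw [mem_filtration.1 hx m (by omega), lenProj_of_mem_ne hne (lenProj_mem n x)]

theorem mem_filtration_sub_one_iff {n : ℕ} {x : Lam V} (hx : x ∈ filtration V n) :
    x ∈ filtration V (n - 1) ↔ lenProj V n x = 0 := by
  refine ⟨fun h => mem_filtration.1 h n (by omega), fun h => ?_⟩
  have := sub_lenProj_mem_filtration hx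
  rwa [h, sub_zero] at this

theorem lenProj_mem_filtration (n : ℕ) (x : Lam V) : lenProj V n x ∈ filtration V n :=
  wordLen_le_filtration le_rfl (lenProj_mem n x)

theorem filtration_le {p : ℤ} {S : Submodule ℚ (Lam V)}
    (h : ∀ n : ℕ, (n : ℤ) ≤ p → wordLen V n ≤ S) : filtration V p ≤ S := by
  intro x hx
  obtain ⟨s, hs⟩ := exists_eq_sum_lenProj x
  rw [hs]
  refine S.sum_mem fun n _ => ?_
  by_cases hn : (n : ℤ) ≤ p
  · exact h n hn (lenProj_mem n x)
  · rw [mem_filtration.1 hx n (by omega)]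
    exact S.zero_mem

theorem word_le_filtration (p : ℤ) : word V p ≤ filtration V p := by
  obtain hp | hp := lt_or_ge p 0
  · rw [word_of_neg hp]
    exact bot_le
  · lift p to ℕ using hp
    rw [word_natCast]
    exact wordLen_le_filtration le_rfl

theorem filtration_eq_sup (p : ℤ) : filtration V p = word V p ⊔ filtration V (p - 1) := by
  apply le_antisymm
  · refine filtration_le fun n hn => ?_
    rcases hn.eq_or_lt with rfl | hn
    · rw [← word_natCast]
      exact le_sup_left
    · exact (wordLen_le_filtration (by omega)).trans le_sup_right
  · exact sup_le (word_le_filtration p) (filtration_mono (by omega))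

theorem disjoint_word_filtration (p : ℤ) : Disjoint (word V p) (filtration V (p - 1)) := by
  obtain hp | hp := lt_or_ge p 0
  · rw [word_of_neg hp]
    exact disjoint_bot_left
  · lift p to ℕ using hp
    rw [word_natCast, Submodule.disjoint_def]
    intro x hx hx'
    rw [← lenProj_of_mem hx]
    exact mem_filtration.1 hx' p (by omega)

end Lam

/-- The linear map `f` raises degrees by `e`, for the gradings `A` and `B`. -/
def HasDegree {M N : Type*} [AddCommGroup M] [Module ℚ M] [AddCommGroup N] [Module ℚ N]
    (A : ℤ → Submodule ℚ M) (B : ℤ → Submodule ℚ N) (f : M →ₗ[ℚ] N) (e : ℤ) : Prop :=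
  ∀ n, ∀ x ∈ A n, f x ∈ B (n + e)

namespace Lam

variable {V : GradedSpace.{u}}

/-! ### Coderivations -/

theorem coderivation_eq_conv (f : Lam V →ₗ[ℚ] V) :
    coderivation f = conv (ι V ∘ₗ f) LinearMap.id := rfl

theorem coderivation_add (f g : Lam V →ₗ[ℚ] V) :
    coderivation (f + g) = coderivation f + coderivation g := by
  simp only [coderivation, LinearMap.comp_add, LinearMap.add_comp, TensorProduct.map_add_left]

theorem coderivation_sub (f g : Lam V →ₗ[ℚ] V) :
    coderivation (f - g) = coderivation f - coderivation g :=
  eq_sub_of_add_eq (by rw [← coderivation_add, sub_add_cancel])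

theorem coderivation_smul (c : ℚ) (f : Lam V →ₗ[ℚ] V) :
    coderivation (c • f) = c • coderivation f := by
  simp only [coderivation, LinearMap.comp_smul, LinearMap.smul_comp, TensorProduct.map_smul_left]

theorem coderivation_zero : coderivation (0 : Lam V →ₗ[ℚ] V) = 0 := by
  rw [← zero_smul ℚ (0 : Lam V →ₗ[ℚ] V), coderivation_smul, zero_smul]

theorem coderivation_one (f : Lam V →ₗ[ℚ] V) : coderivation f 1 = ι V (f 1) := by
  simp [coderivation, comul_one]

theorem coderivation_mem_of_wordLen {f : Lam V →ₗ[ℚ] V} {n : ℕ} {S : Submodule ℚ (Lam V)}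
    (h : ∀ a b : ℕ, a + b = n → ∀ y ∈ wordLen V a, ∀ z ∈ wordLen V b, ι V (f y) * z ∈ S)
    {x : Lam V} (hx : x ∈ wordLen V n) : coderivation f x ∈ S :=
  conv_mem_of_wordLen h hx

theorem coderivation_mem_filtration {f : Lam V →ₗ[ℚ] V} {m : ℕ}
    (hf : ∀ a < m, ∀ x ∈ wordLen V a, f x = 0) {p : ℤ} {x : Lam V} (hx : x ∈ filtration V p) :
    coderivation f x ∈ filtration V (p - m + 1) := by
  suffices h : filtration V p ≤ (filtration V (p - m + 1)).comap (coderivation f) from h hx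
  refine filtration_le fun n hn x hx => coderivation_mem_of_wordLen (fun a b hab y hy z hz => ?_) hx
  by_cases ha : a < m
  · rw [hf a ha y hy, map_zero, zero_mul]
    exact Submodule.zero_mem _
  · exact wordLen_le_filtration (by push_cast; omega) (ι_mul_mem_wordLen (f y) hz)

theorem coderivation_mem_word {f : Lam V →ₗ[ℚ] V} {m : ℕ}
    (hf : ∀ a, a ≠ m → ∀ x ∈ wordLen V a, f x = 0) {p : ℤ} {x : Lam V} (hx : x ∈ word V p) :
    coderivation f x ∈ word V (p - (m - 1)) := by
  obtain hp | hp := lt_or_ge p 0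
  · rw [word_of_neg hp, Submodule.mem_bot] at hx
    rw [hx, map_zero]
    exact Submodule.zero_mem _
  · lift p to ℕ using hp
    rw [word_natCast] at hx
    refine coderivation_mem_of_wordLen (fun a b hab y hy z hz => ?_) hx
    obtain rfl | ha := eq_or_ne a m
    · rw [show (p : ℤ) - (a - 1) = ((b + 1 : ℕ) : ℤ) by push_cast; omega, word_natCast]
      exact ι_mul_mem_wordLen (f y) hz
    · rw [hf a ha y hy, map_zero, zero_mul]
      exact Submodule.zero_mem _

/-- The linear map `x ↦ f (v ∧ x)`. -/
noncomputable def contract (f : Lam V →ₗ[ℚ] V) (v : V) : Lam V →ₗ[ℚ] V :=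
  f ∘ₗ LinearMap.mulLeft ℚ (ι V v)

theorem contract_apply (f : Lam V →ₗ[ℚ] V) (v : V) (x : Lam V) :
    contract f v x = f (ι V v * x) := rfl

theorem hasDegree_contract {f : Lam V →ₗ[ℚ] V} {e : ℤ} (hf : HasDegree (gr V) V.gr f e) {i : ℤ}
    {v : V} (hv : v ∈ V.gr i) : HasDegree (gr V) V.gr (contract f v) (e + i) := fun n x hx => by
  have := hf _ _ (ι_mul_mem_gr hv hx)
  rwa [show i + n + e = n + (e + i) by ring] at this

theorem ι_twist_mul_ι {f : Lam V →ₗ[ℚ] V} {e : ℤ} (hf : HasDegree (gr V) V.gr f e) {i : ℤ}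
    {v : V} (hv : v ∈ V.gr i) (x : Lam V) :
    ι V (f (twist V i x)) * ι V v = (-1 : ℚ) ^ (e * i) • (ι V v * ι V (f x)) := by
  induction x using DirectSum.Decomposition.inductionOn (gr V) with
  | zero => simp
  | add x y hx hy => simp only [map_add, add_mul, mul_add, smul_add, hx, hy]
  | @homogeneous n x =>
    rw [twist_of_mem i x.2, map_smul, map_smul, smul_mul_assoc, ι_mul_ι (hf n x x.2) hv, smul_smul,
      add_mul, negOne_zpow_add, ← mul_assoc, mul_comm i n, negOne_zpow_mul_self, one_mul]

theorem coderivation_ι_mul {f : Lam V →ₗ[ℚ] V} {e : ℤ} (hf : HasDegree (gr V) V.gr f e) {i : ℤ}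
    {v : V} (hv : v ∈ V.gr i) (x : Lam V) :
    coderivation f (ι V v * x) =
      coderivation (contract f v) x + (-1 : ℚ) ^ (e * i) • (ι V v * coderivation f x) := by
  have hcomm : conv ((ι V ∘ₗ f) ∘ₗ (twist V i).toLinearMap) (LinearMap.mulLeft ℚ (ι V v)) =
      LinearMap.mulLeft ℚ (ι V v) ∘ₗ conv (ι V ∘ₗ ((-1 : ℚ) ^ (e * i) • f)) LinearMap.id :=
    conv_mulLeft_comp_of_commute (fun y => by simp [ι_twist_mul_ι hf hv]) LinearMap.id
  rw [coderivation_eq_conv, conv_ι_mul _ _ hv, LinearMap.id_comp, hcomm, ← coderivation_eq_conv,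
    coderivation_smul]
  simp [coderivation_eq_conv, contract, LinearMap.comp_assoc]

theorem hasDegree_coderivation {f : Lam V →ₗ[ℚ] V} {e : ℤ} (hf : HasDegree (gr V) V.gr f e) :
    HasDegree (gr V) (gr V) (coderivation f) e := by
  let S (n : ℤ) : Submodule ℚ (Lam V) :=
    ⨅ (g : Lam V →ₗ[ℚ] V) (b : ℤ) (_ : HasDegree (gr V) V.gr g b),
      (gr V (n + b)).comap (coderivation g)
  suffices h : ∀ n, gr V n ≤ S n from fun n x hx => by
    have := h n hx
    simp only [S, Submodule.mem_iInf] at this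
    exact this f e hf
  refine gr_le ?_ fun i v hv n x _ hx => ?_
  · simp only [S, Submodule.mem_iInf, Submodule.mem_comap, coderivation_one]
    exact fun g b hg => ι_mem_gr (hg 0 1 SetLike.GradedOne.one_mem)
  · simp only [S, Submodule.mem_iInf, Submodule.mem_comap] at hx ⊢
    intro g b hg
    rw [coderivation_ι_mul hg hv]
    refine Submodule.add_mem _ ?_ (Submodule.smul_mem _ _ ?_)
    · have := hx _ _ (hasDegree_contract hg hv)
      rwa [show n + (b + i) = i + n + b by ring] at this
    · have := ι_mul_mem_gr hv (hx g b hg)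
      rwa [← add_assoc] at this

/-- The corestriction `f D_g - (-1)^(ab) g D_f` of the graded commutator of the coderivations `D_f`
and `D_g`, where `f` and `g` have degrees `a` and `b`. -/
noncomputable def bracket (f g : Lam V →ₗ[ℚ] V) (a b : ℤ) : Lam V →ₗ[ℚ] V :=
  f ∘ₗ coderivation g - (-1 : ℚ) ^ (a * b) • g ∘ₗ coderivation f

theorem bracket_apply (f g : Lam V →ₗ[ℚ] V) (a b : ℤ) (x : Lam V) :
    bracket f g a b x =
      f (coderivation g x) - (-1 : ℚ) ^ (a * b) • g (coderivation f x) := rfl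

theorem hasDegree_bracket {f g : Lam V →ₗ[ℚ] V} {a b : ℤ} (hf : HasDegree (gr V) V.gr f a)
    (hg : HasDegree (gr V) V.gr g b) : HasDegree (gr V) V.gr (bracket f g a b) (a + b) := by
  intro n x hx
  have hfg := hf _ _ (hasDegree_coderivation hg n x hx)
  have hgf := hg _ _ (hasDegree_coderivation hf n x hx)
  rw [show n + b + a = n + (a + b) by ring] at hfg
  rw [show n + a + b = n + (a + b) by ring] at hgf
  exact Submodule.sub_mem _ hfg (Submodule.smul_mem _ _ hgf)

theorem contract_bracket {f g : Lam V →ₗ[ℚ] V} {a b : ℤ} (hf : HasDegree (gr V) V.gr f a)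
    (hg : HasDegree (gr V) V.gr g b) {i : ℤ} {v : V} (hv : v ∈ V.gr i) :
    contract (bracket f g a b) v =
      bracket f (contract g v) a (b + i) +
        (-1 : ℚ) ^ (b * i) • bracket (contract f v) g (a + i) b := by
  ext x
  simp only [contract_apply, bracket_apply, LinearMap.smul_apply, LinearMap.add_apply,
    coderivation_ι_mul hf hv, coderivation_ι_mul hg hv, map_add, map_smul]
  rw [mul_add, add_mul, negOne_zpow_add, negOne_zpow_add, mul_comm i b]
  obtain hs | hs := mul_self_eq_one_iff.1 (negOne_zpow_mul_self (b * i)) <;> rw [hs] <;> module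

theorem coderivation_bracket {f g : Lam V →ₗ[ℚ] V} {a b : ℤ} (hf : HasDegree (gr V) V.gr f a)
    (hg : HasDegree (gr V) V.gr g b) (x : Lam V) :
    coderivation (bracket f g a b) x =
      coderivation f (coderivation g x) -
        (-1 : ℚ) ^ (a * b) • coderivation g (coderivation f x) := by
  induction x using word_induction generalizing f g a b with
  | add x y hx hy =>
    simp only [map_add, hx hf hg, hy hf hg]
    module
  | smul c x hx =>
    simp only [map_smul, hx hf hg]
    module
  | one =>
    have hf1 : f 1 ∈ V.gr a := by simpa using hf 0 1 SetLike.GradedOne.one_mem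
    have hg1 : g 1 ∈ V.gr b := by simpa using hg 0 1 SetLike.GradedOne.one_mem
    have hfg := coderivation_ι_mul hf hg1 1
    have hgf := coderivation_ι_mul hg hf1 1
    rw [mul_one, coderivation_one, coderivation_one, contract_apply, mul_one] at hfg hgf
    simp only [coderivation_one, bracket_apply, hfg, hgf, ι_mul_ι hg1 hf1, map_sub, map_smul,
      mul_comm b a]
    obtain hs | hs := mul_self_eq_one_iff.1 (negOne_zpow_mul_self (a * b)) <;> rw [hs] <;> module
  | mul i v hv x hx =>
    rw [coderivation_ι_mul (hasDegree_bracket hf hg) hv, contract_bracket hf hg hv,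
      coderivation_add, coderivation_smul, LinearMap.add_apply, LinearMap.smul_apply,
      hx hf (hasDegree_contract hg hv), hx (hasDegree_contract hf hv) hg, hx hf hg]
    simp only [coderivation_ι_mul hf hv, coderivation_ι_mul hg hv, map_add, map_smul, mul_sub,
      mul_smul_comm, mul_add, add_mul, negOne_zpow_add, mul_comm i b]
    obtain hs | hs := mul_self_eq_one_iff.1 (negOne_zpow_mul_self (b * i)) <;> rw [hs] <;> module

theorem coderivation_sq {f : Lam V →ₗ[ℚ] V} (hf : HasDegree (gr V) V.gr f (-1))
    (h : f ∘ₗ coderivation f = 0) : coderivation f ∘ₗ coderivation f = 0 := by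
  ext x
  have hD := coderivation_bracket hf hf x
  rw [bracket, h, smul_zero, sub_zero, coderivation_zero, LinearMap.zero_apply] at hD
  norm_num [← two_smul ℚ] at hD
  exact (smul_eq_zero.1 hD.symm).resolve_left two_ne_zero

/-! ### Maps given on words -/

theorem wordLen_le_of_ofFn {n : ℕ} {S : Submodule ℚ (Lam V)}
    (h : ∀ (d : Fin n → ℤ) (x : Fin n → V), (∀ i, x i ∈ V.gr (d i)) →
      (List.ofFn fun i => ι V (x i)).prod ∈ S) : wordLen V n ≤ S := by
  induction n generalizing S with
  | zero => exact wordLen_zero_le (by simpa using h finZeroElim finZeroElim finZeroElim)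
  | succ n ih =>
    refine wordLen_succ_le fun i v hv => ?_
    change wordLen V n ≤ S.comap (LinearMap.mulLeft ℚ (ι V v))
    refine ih fun d x hx => ?_
    have := h (Fin.cons i d) (Fin.cons v x) (Fin.cases hv hx)
    rwa [List.ofFn_succ, List.prod_cons] at this

variable {M : Type*} [AddCommGroup M] [Module ℚ M]

theorem descend_eq_descend_of_mem {m m' : ∀ k : ℕ, MultilinearMap ℚ (fun _ : Fin k => V) M}
    (hm) (hm') {n : ℕ} (h : m n = m' n) {x : Lam V} (hx : x ∈ wordLen V n) :
    descend m hm x = descend m' hm' x := by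
  suffices hle : wordLen V n ≤ LinearMap.eqLocus (descend m hm) (descend m' hm') from hle hx
  refine wordLen_le_of_ofFn fun d x _ => ?_
  rw [LinearMap.mem_eqLocus, descend_prod, descend_prod, h]

theorem descend_eq_zero_of_mem {m : ∀ k : ℕ, MultilinearMap ℚ (fun _ : Fin k => V) M} (hm)
    {n : ℕ} (h : m n = 0) {x : Lam V} (hx : x ∈ wordLen V n) : descend m hm x = 0 := by
  suffices hle : wordLen V n ≤ LinearMap.ker (descend m hm) from hle hx
  refine wordLen_le_of_ofFn fun d x _ => ?_
  rw [LinearMap.mem_ker, descend_prod, h, zero_apply]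

theorem hasDegree_descend {m : ∀ k : ℕ, MultilinearMap ℚ (fun _ : Fin k => V) V} (hm) {e : ℤ}
    (h : ∀ (k : ℕ) (d : Fin k → ℤ) (x : Fin k → V), (∀ i, x i ∈ V.gr (d i)) →
      m k x ∈ V.gr (∑ i, d i + e)) : HasDegree (gr V) V.gr (descend m hm) e := by
  intro n
  suffices hle : gr V n ≤ (V.gr (n + e)).comap (descend m hm) from hle
  refine Submodule.span_le.2 ?_
  rintro _ ⟨l, rfl, rfl⟩
  have hword : (l.map fun a => ι V (a.2 : V)) = List.ofFn fun i => ι V ((l.get i).2 : V) := by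
    conv_lhs => rw [← List.ofFn_get l, List.map_ofFn]
    rfl
  have hdeg : (l.map Sigma.fst).sum = ∑ i, (l.get i).1 := by
    conv_lhs => rw [← List.ofFn_get l, List.map_ofFn, List.sum_ofFn]
    rfl
  rw [SetLike.mem_coe, Submodule.mem_comap, hword, descend_prod, hdeg]
  exact h l.length (fun i => (l.get i).1) (fun i => (l.get i).2) fun i => (l.get i).2.2

/-! ### The projection onto the words of length one -/

theorem proj_ι (v : V) : proj V (ι V v) = v := by
  have := descend_prod (idFamily V) (idFamily_gradedSymm V) (fun _ : Fin 1 => v)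
  simpa [proj, idFamily] using this

theorem proj_of_mem_ne {n : ℕ} (h : n ≠ 1) {x : Lam V} (hx : x ∈ wordLen V n) :
    proj V x = 0 := by
  refine descend_eq_zero_of_mem _ ?_ hx
  match n with
  | 0 => rfl
  | 1 => exact absurd rfl h
  | _ + 2 => rfl

theorem ι_comp_proj : ι V ∘ₗ proj V = lenProj V 1 := by
  refine linearMap_ext_wordLen fun n x hx => ?_
  obtain rfl | hn := eq_or_ne n 1
  · obtain ⟨v, rfl⟩ := mem_wordLen_one.1 hx
    rw [LinearMap.comp_apply, proj_ι, lenProj_of_mem hx]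
  · rw [LinearMap.comp_apply, proj_of_mem_ne hn hx, lenProj_of_mem_ne hn hx, map_zero]

theorem hasDegree_proj : HasDegree (gr V) V.gr (proj V) 0 :=
  hasDegree_descend _ fun k d x hx => by
    match k with
    | 0 => exact Submodule.zero_mem _
    | 1 => simpa [idFamily] using hx 0
    | _ + 2 => exact Submodule.zero_mem _

theorem proj_ι_mul (v : V) (x : Lam V) : proj V (ι V v * x) = counit V x • v := by
  have h : proj V ∘ₗ LinearMap.mulLeft ℚ (ι V v) ∘ₗ toCoaugKer V = 0 :=
    linearMap_ext_wordLen fun n y hy => by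
      rw [toCoaugKer_eq_scale, LinearMap.comp_apply, LinearMap.comp_apply, scale_of_mem _ hy]
      obtain rfl | hn := eq_or_ne n 0
      · simp
      · rw [LinearMap.mulLeft_apply, mul_smul_comm, map_smul,
          proj_of_mem_ne (by omega) (ι_mul_mem_wordLen v hy), smul_zero, LinearMap.zero_apply]
  have := LinearMap.congr_fun h x
  simpa [toCoaugKer_apply, mul_sub, proj_ι, sub_eq_zero] using this

theorem proj_coderivation (f : Lam V →ₗ[ℚ] V) (x : Lam V) : proj V (coderivation f x) = f x := by
  have h : proj V ∘ₗ LinearMap.mul' ℚ (Lam V) ∘ₗ TensorProduct.map (ι V ∘ₗ f) (toCoaugKer V) = 0 :=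
    TensorProduct.ext' fun y z => by simp [proj_ι_mul, toCoaugKer_apply]
  have hker : proj V (conv (ι V ∘ₗ f) (toCoaugKer V) x) = 0 := LinearMap.congr_fun h (comul V x)
  have hid : toCoaugKer V =
      LinearMap.id - LinearMap.toSpanSingleton ℚ _ 1 ∘ₗ (counit V).toLinearMap :=
    LinearMap.ext fun y => by simp [toCoaugKer_apply]
  rwa [hid, conv_sub_right, LinearMap.sub_apply, conv_counit_smul, map_sub, LinearMap.comp_apply,
    mul_one, proj_ι, sub_eq_zero] at hker

end Lam

/-! ### Shuffles -/

section Shuffles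

variable {n : ℕ}

/-- The permutation of `Fin (n + 1)` which takes the value `0` at `p` and is given by `τ` on the
other positions. -/
def insertZero (p : Fin (n + 1)) (τ : Equiv.Perm (Fin n)) : Equiv.Perm (Fin (n + 1)) :=
  (finSuccEquiv' p).trans ((Equiv.optionCongr τ).trans (finSuccEquiv n).symm)

@[simp] theorem insertZero_self (p : Fin (n + 1)) (τ : Equiv.Perm (Fin n)) :
    insertZero p τ p = 0 := by simp [insertZero]

@[simp] theorem insertZero_succAbove (p : Fin (n + 1)) (τ : Equiv.Perm (Fin n)) (j : Fin n) :
    insertZero p τ (p.succAbove j) = (τ j).succ := by simp [insertZero]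

theorem insertZero_bijective :
    Function.Bijective fun q : Fin (n + 1) × Equiv.Perm (Fin n) => insertZero q.1 q.2 := by
  rw [Fintype.bijective_iff_injective_and_card]
  constructor
  · rintro ⟨p, τ⟩ ⟨p', τ'⟩ h
    replace h : insertZero p τ = insertZero p' τ' := h
    obtain rfl : p = p' := (insertZero p τ).injective (by rw [insertZero_self, h, insertZero_self])
    have hτ : τ = τ' := Equiv.ext fun j => by simpa using DFunLike.congr_fun h (p.succAbove j)
    rw [hτ]
  · simp [Fintype.card_perm, Nat.factorial_succ]

theorem sum_perm_succ {M : Type*} [AddCommMonoid M] (G : Equiv.Perm (Fin (n + 1)) → M) :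
    ∑ σ, G σ = ∑ p, ∑ τ, G (insertZero p τ) := by
  rw [← Fintype.sum_prod_type']
  exact (insertZero_bijective.sum_comp G).symm

theorem IsShuffle.eq_zero_or_eq {i : ℕ} {σ : Equiv.Perm (Fin (n + 1))} (h : IsShuffle i σ)
    {p : Fin (n + 1)} (hp : σ p = 0) : p = 0 ∨ (p : ℕ) = i := by
  have hfirst (a : Fin (n + 1)) (ha : a < p) : ¬ ((p : ℕ) < i ∨ i ≤ (a : ℕ)) := fun hi =>
    Fin.not_lt_zero _ (hp ▸ h a p ha hi)
  by_contra! hne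
  have hpos : 0 < p := Fin.pos_iff_ne_zero.2 hne.1
  have hi : i < p := by
    have := hfirst 0 hpos
    omega
  exact hfirst ⟨i, hi.trans p.isLt⟩ hi (Or.inr le_rfl)

theorem isShuffle_succ_insertZero_zero {i : ℕ} {τ : Equiv.Perm (Fin n)} :
    IsShuffle (i + 1) (insertZero 0 τ) ↔ IsShuffle i τ := by
  have hsucc (j : Fin n) : insertZero 0 τ j.succ = (τ j).succ := by
    rw [← Fin.succAbove_zero_apply, insertZero_succAbove]
  simp [IsShuffle, Fin.forall_fin_succ, hsucc]

theorem isShuffle_insertZero_self {p : Fin (n + 1)} {τ : Equiv.Perm (Fin n)} :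
    IsShuffle p (insertZero p τ) ↔ IsShuffle p τ := by
  have hlt (j : Fin n) : (p.succAbove j : ℕ) < p ↔ (j : ℕ) < p :=
    Fin.succAbove_lt_iff_castSucc_lt p j
  have hle (j : Fin n) : (p : ℕ) ≤ p.succAbove j ↔ (p : ℕ) ≤ j := by
    rw [← not_lt, hlt, not_lt]
  simp only [IsShuffle, Fin.forall_iff_succAbove p, insertZero_self, insertZero_succAbove, hlt, hle,
    Fin.succAbove_lt_succAbove_iff, Fin.succ_lt_succ_iff]
  exact ⟨fun h a b => (h.2 a).2 b, fun h =>
    ⟨⟨fun hp => absurd hp (lt_irrefl p), fun _ _ _ => Fin.succ_pos _⟩, fun a =>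
      ⟨fun ha hpa => absurd hpa (by have := (hlt a).1 ha; omega), h a⟩⟩⟩

theorem sum_sum_of_ne_zero_imp {M : Type*} [AddCommMonoid M] (F : Fin (n + 2) → Fin (n + 1) → M)
    (hF : ∀ i p, F i p ≠ 0 → p = 0 ∨ p.castSucc = i) :
    ∑ i, ∑ p, F i p = ∑ j : Fin (n + 1), (F j.succ 0 + F j.castSucc j) := by
  have hsingle (q : Fin n) : ∑ i, F i q.succ = F q.succ.castSucc q.succ :=
    Fintype.sum_eq_single _ fun i hi => not_not.1 fun h =>
      (hF i _ h).elim (Fin.succ_ne_zero q) hi.symm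
  rw [Finset.sum_comm, Fin.sum_univ_succ, Fin.sum_univ_succ fun i => F i 0,
    Finset.sum_congr rfl fun q _ => hsingle q, Finset.sum_add_distrib,
    Fin.sum_univ_succ fun j : Fin (n + 1) => F j.castSucc j, Fin.castSucc_zero]
  abel

theorem sum_shuffle_succ {M : Type*} [AddCommMonoid M]
    (G : Fin (n + 2) → Equiv.Perm (Fin (n + 1)) → M) :
    ∑ i : Fin (n + 2), ∑ σ with IsShuffle i σ, G i σ =
      ∑ i : Fin (n + 1), ∑ τ with IsShuffle i τ,
        (G i.succ (insertZero 0 τ) + G i.castSucc (insertZero i τ)) := by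
  simp only [Finset.sum_filter, sum_perm_succ]
  rw [sum_sum_of_ne_zero_imp]
  · refine Finset.sum_congr rfl fun i _ => ?_
    simp only [Fin.val_succ, Fin.val_castSucc, isShuffle_succ_insertZero_zero,
      isShuffle_insertZero_self, ← Finset.sum_filter, Finset.sum_add_distrib]
  · intro i p h
    obtain ⟨τ, -, hτ⟩ := Finset.exists_ne_zero_of_sum_ne_zero h
    obtain rfl | hp := (ite_ne_right_iff.1 hτ).1.eq_zero_or_eq (insertZero_self p τ)
    · exact Or.inl rfl
    · exact Or.inr (Fin.ext hp)

theorem negOne_zpow_sum {ι : Type*} (s : Finset ι) (d : ι → ℤ) :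
    (-1 : ℚ) ^ (∑ a ∈ s, d a) = ∏ a ∈ s, (-1 : ℚ) ^ d a := by
  classical
  induction s using Finset.induction_on with
  | empty => simp
  | insert a s ha ih => rw [Finset.sum_insert ha, Finset.prod_insert ha, negOne_zpow_add, ih]

theorem koszulSign_insertZero (d : Fin (n + 1) → ℤ) (p : Fin (n + 1)) (τ : Equiv.Perm (Fin n)) :
    koszulSign d (insertZero p τ) =
      (-1 : ℚ) ^ ((∑ j : Fin n, if (j : ℕ) < p then d (τ j).succ else 0) * d 0) *
        koszulSign (fun j => d j.succ) τ := by
  have hp : (∏ b, if p < b ∧ insertZero p τ b < insertZero p τ p then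
      (-1 : ℚ) ^ (d (insertZero p τ p) * d (insertZero p τ b)) else 1) = 1 :=
    Finset.prod_eq_one fun b _ => by
      rw [insertZero_self, if_neg fun h => Fin.not_lt_zero _ h.2]
  rw [koszulSign, koszulSign, Fin.prod_univ_succAbove _ p, hp, one_mul, Finset.sum_mul,
    negOne_zpow_sum, ← Finset.prod_mul_distrib]
  refine Finset.prod_congr rfl fun a _ => ?_
  rw [Fin.prod_univ_succAbove _ p]
  simp only [ite_mul, zero_mul, apply_ite ((-1 : ℚ) ^ · : ℤ → ℚ), zpow_zero,
    insertZero_self, insertZero_succAbove, Fin.succ_pos, and_true, Fin.succAbove_lt_succAbove_iff,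
    Fin.succ_lt_succ_iff, Fin.succAbove_lt_iff_castSucc_lt]
  rfl

theorem ofFn_eq_take_append {α : Type*} (p : Fin (n + 1)) (g : Fin (n + 1) → α) :
    List.ofFn g = (List.ofFn fun j => g (p.succAbove j)).take p ++
      g p :: (List.ofFn fun j => g (p.succAbove j)).drop p := by
  induction n with
  | zero => simp [Fin.fin_one_eq_zero p]
  | succ n ih =>
    induction p using Fin.cases with
    | zero => simp
    | succ p => simpa [List.ofFn_succ (f := g)] using ih p fun j => g j.succ

end Shuffles

namespace Lam

variable {V : GradedSpace.{u}} {n : ℕ}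

theorem take_prod_mem_gr {d : Fin n → ℤ} {x : Fin n → V} (hx : ∀ i, x i ∈ V.gr (d i)) (i : ℕ) :
    ((List.ofFn fun j => ι V (x j)).take i).prod ∈
      gr V (∑ j : Fin n, if (j : ℕ) < i then d j else 0) := by
  induction n generalizing i with
  | zero => simpa using SetLike.GradedOne.one_mem (A := gr V)
  | succ n ih =>
    cases i with
    | zero => simpa using SetLike.GradedOne.one_mem (A := gr V)
    | succ i =>
      rw [List.ofFn_succ, List.take_succ_cons, List.prod_cons, Fin.sum_univ_succ]
      simpa using ι_mul_mem_gr (hx 0) (ih (fun j => hx j.succ) i)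

/-- The term `f (x_σ(1) ∧ ⋯ ∧ x_σ(i)) ∧ x_σ(i+1) ∧ ⋯ ∧ x_σ(n)`, up to its Koszul sign, of a
coderivation on the word `x₁ ∧ ⋯ ∧ xₙ`. -/
noncomputable def shuffleTerm (f : Lam V →ₗ[ℚ] V) (x : Fin n → V) (i : ℕ)
    (σ : Equiv.Perm (Fin n)) : Lam V :=
  ι V (f ((List.ofFn fun j => ι V (x (σ j))).take i).prod) *
    ((List.ofFn fun j => ι V (x (σ j))).drop i).prod

theorem ofFn_insertZero (x : Fin (n + 1) → V) (p : Fin (n + 1)) (τ : Equiv.Perm (Fin n)) :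
    (List.ofFn fun j => ι V (x (insertZero p τ j))) =
      (List.ofFn fun j => ι V (x (τ j).succ)).take p ++
        ι V (x 0) :: (List.ofFn fun j => ι V (x (τ j).succ)).drop p := by
  simpa using ofFn_eq_take_append p fun j => ι V (x (insertZero p τ j))

theorem shuffleTerm_insertZero_zero (f : Lam V →ₗ[ℚ] V) (x : Fin (n + 1) → V) (i : ℕ)
    (τ : Equiv.Perm (Fin n)) :
    shuffleTerm f x (i + 1) (insertZero 0 τ) =
      shuffleTerm (contract f (x 0)) (fun j => x j.succ) i τ := by
  rw [shuffleTerm, ofFn_insertZero]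
  simp [shuffleTerm, contract_apply]

theorem shuffleTerm_insertZero_self (f : Lam V →ₗ[ℚ] V) (x : Fin (n + 1) → V) (p : Fin (n + 1))
    (τ : Equiv.Perm (Fin n)) :
    shuffleTerm f x p (insertZero p τ) =
      ι V (f ((List.ofFn fun j => ι V (x (τ j).succ)).take p).prod) *
        (ι V (x 0) * ((List.ofFn fun j => ι V (x (τ j).succ)).drop p).prod) := by
  have hlen : ((List.ofFn fun j => ι V (x (τ j).succ)).take p).length = p := by simp; omega
  rw [shuffleTerm, ofFn_insertZero, List.take_left' hlen, List.drop_left' hlen, List.prod_cons]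

theorem koszulSign_smul_shuffleTerm_insertZero_self {f : Lam V →ₗ[ℚ] V} {e : ℤ}
    (hf : HasDegree (gr V) V.gr f e) {d : Fin (n + 1) → ℤ} {x : Fin (n + 1) → V}
    (hx : ∀ i, x i ∈ V.gr (d i)) (p : Fin (n + 1)) (τ : Equiv.Perm (Fin n)) :
    koszulSign d (insertZero p τ) • shuffleTerm f x p (insertZero p τ) =
      (-1 : ℚ) ^ (e * d 0) • (ι V (x 0) *
        (koszulSign (fun j => d j.succ) τ • shuffleTerm f (fun j => x j.succ) p τ)) := by
  have hdeg := hf _ _ (take_prod_mem_gr (fun j => hx (τ j).succ) p)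
  rw [koszulSign_insertZero, shuffleTerm_insertZero_self, ← mul_assoc, ι_mul_ι hdeg (hx 0),
    smul_mul_assoc, mul_assoc]
  set D := ∑ j : Fin n, if (j : ℕ) < p then d (τ j).succ else 0
  change _ • _ • (ι V (x 0) * shuffleTerm f (fun j => x j.succ) p τ) = _
  rw [mul_smul_comm, add_mul, negOne_zpow_add]
  linear_combination (norm := module) ((-1 : ℚ) ^ (e * d 0) * koszulSign (fun j => d j.succ) τ *
    negOne_zpow_mul_self (D * d 0)) • (ι V (x 0) * shuffleTerm f (fun j => x j.succ) p τ)

theorem coderivation_ofFn {f : Lam V →ₗ[ℚ] V} {e : ℤ} (hf : HasDegree (gr V) V.gr f e)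
    {d : Fin n → ℤ} {x : Fin n → V} (hx : ∀ i, x i ∈ V.gr (d i)) :
    coderivation f (List.ofFn fun i => ι V (x i)).prod =
      ∑ i : Fin (n + 1), ∑ σ with IsShuffle i σ, koszulSign d σ • shuffleTerm f x i σ := by
  induction n generalizing f e with
  | zero =>
    have hshuffle (σ : Equiv.Perm (Fin 0)) : IsShuffle 0 σ := fun a => a.elim0
    simp [coderivation_one, Finset.filter_true_of_mem, hshuffle, koszulSign, shuffleTerm]
  | succ n ih =>
    rw [List.ofFn_succ, List.prod_cons, coderivation_ι_mul hf (hx 0),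
      ih (hasDegree_contract hf (hx 0)) fun j => hx j.succ, ih hf fun j => hx j.succ,
      sum_shuffle_succ fun i σ => koszulSign d σ • shuffleTerm f x i σ]
    simp only [Finset.mul_sum, Finset.smul_sum, ← Finset.sum_add_distrib]
    refine Finset.sum_congr rfl fun i _ => Finset.sum_congr rfl fun τ _ => ?_
    rw [Fin.val_castSucc, koszulSign_smul_shuffleTerm_insertZero_self hf hx, Fin.val_succ,
      shuffleTerm_insertZero_zero, koszulSign_insertZero]
    simp

end Lam

/-! ### Suspension signs -/

section Signs

variable {n : ℕ}

theorem sgn_eq_prod (σ : Equiv.Perm (Fin n)) :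
    sgn σ = ∏ a, ∏ b, if a < b ∧ σ b < σ a then (-1 : ℚ) else 1 := by
  rw [sgn, Equiv.Perm.sign_eq_prod_prod_Ioi]
  push_cast
  refine Finset.prod_congr rfl fun a _ => ?_
  rw [← Finset.filter_lt_eq_Ioi, Finset.prod_filter]
  refine Finset.prod_congr rfl fun b _ => ?_
  by_cases hab : a < b
  · obtain h | h := (σ.injective.ne hab.ne).lt_or_gt
    · simp [h, h.asymm]
    · simp [hab, h, h.asymm]
  · simp [hab]

theorem prod_inversions {u : Fin n → ℚ} (hu : ∀ a, u a * u a = 1) (σ : Equiv.Perm (Fin n)) :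
    (∏ a, ∏ b, if a < b ∧ σ b < σ a then u (σ a) * u (σ b) else 1) =
      ∏ a, u (σ a) ^ ((a : ℕ) + σ a) := by
  have hsplit : (∏ a, ∏ b, if a < b ∧ σ b < σ a then u (σ a) * u (σ b) else 1) =
      (∏ a, ∏ b, if a < b ∧ σ b < σ a then u (σ a) else 1) *
        ∏ a, ∏ b, if b < a ∧ σ a < σ b then u (σ a) else 1 := by
    rw [Finset.prod_comm (f := fun a b => if b < a ∧ σ a < σ b then u (σ a) else 1)]
    simp only [← Finset.prod_mul_distrib, ite_mul_ite, mul_one]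
  have hpow (c : ℚ) (a : Fin n) : (∏ b, if b < a then c else 1) = c ^ (a : ℕ) := by
    rw [← Finset.prod_filter, Finset.prod_const, Finset.filter_gt_eq_Iio, Fin.card_Iio]
  rw [hsplit, ← Finset.prod_mul_distrib]
  refine Finset.prod_congr rfl fun a _ => ?_
  rw [pow_add, ← hpow, ← hpow, ← Equiv.prod_comp σ fun b => if b < σ a then u (σ a) else 1,
    ← Finset.prod_mul_distrib, ← Finset.prod_mul_distrib]
  refine Finset.prod_congr rfl fun b _ => ?_
  obtain hab | rfl | hab := lt_trichotomy a b
  · simp [hab, hab.asymm]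
  · simp
  · obtain h | h := (σ.injective.ne hab.ne').lt_or_gt <;> simp [hab, hab.asymm, h, h.asymm, hu]

/-- The sign of the décalage `hₙ = ± s ∘ ℓₙ ∘ (s⁻¹)^{⊗n}` on elements of degrees `d`. -/
def suspSign (n : ℕ) (d : Fin n → ℤ) : ℚ :=
  (-1) ^ (n * (n - 1) / 2) * ∏ a, ((-1 : ℚ) ^ d a) ^ (n - 1 - (a : ℕ))

theorem koszulSign_mul_suspSign (d : Fin n → ℤ) (σ : Equiv.Perm (Fin n)) :
    koszulSign d σ * suspSign n (fun a => d (σ a)) =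
      koszulSign (fun a => d a - 1) σ * sgn σ * suspSign n d := by
  have hu (a) : (-1 : ℚ) ^ d a * (-1 : ℚ) ^ d a = 1 := negOne_zpow_mul_self _
  have hk : koszulSign d σ = koszulSign (fun a => d a - 1) σ * sgn σ *
      ∏ a, ((-1 : ℚ) ^ d (σ a)) ^ ((a : ℕ) + σ a) := by
    simp only [← prod_inversions hu, sgn_eq_prod, koszulSign, ← Finset.prod_mul_distrib]
    refine Finset.prod_congr rfl fun a _ => Finset.prod_congr rfl fun b _ => ?_
    have hd : d (σ a) * d (σ b) =
        (d (σ a) - 1) * (d (σ b) - 1) + (d (σ a) + d (σ b)) + -1 := by ring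
    simp only [ite_mul_ite, mul_one, hd, negOne_zpow_add]
    norm_num
  have hexp (a : Fin n) : ((-1 : ℚ) ^ d (σ a)) ^ ((a : ℕ) + σ a) *
      ((-1 : ℚ) ^ d (σ a)) ^ (n - 1 - (a : ℕ)) = ((-1 : ℚ) ^ d (σ a)) ^ (n - 1 - (σ a : ℕ)) := by
    rw [← pow_add, show (a : ℕ) + σ a + (n - 1 - a) = 2 * (σ a : ℕ) + (n - 1 - σ a) by omega,
      pow_add, pow_mul, pow_two, hu, one_pow, one_mul]
  rw [suspSign, suspSign, hk, ← Equiv.prod_comp σ fun a => ((-1 : ℚ) ^ d a) ^ (n - 1 - (a : ℕ)),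
    ← Finset.prod_congr rfl fun a _ => hexp a, Finset.prod_mul_distrib]
  ring

theorem negOne_pow_triangle (m r : ℕ) :
    (-1 : ℚ) ^ (m * (m - 1) / 2) * (-1) ^ ((r + 1) * (r + 1 - 1) / 2) * (-1) ^ r =
      (-1) ^ ((m + r) * (m + r - 1) / 2) * (-1) ^ (m * r) := by
  have htriangle : (m + r) * (m + r - 1) / 2 = m * (m - 1) / 2 + r * (r - 1) / 2 + m * r := by
    induction r with
    | zero => simp
    | succ r ih =>
      rw [← add_assoc, Nat.triangle_succ (m + r), Nat.triangle_succ r, ih]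
      ring
  have hsq (k : ℕ) : (-1 : ℚ) ^ k * (-1) ^ k = 1 := by rw [← mul_pow]; simp
  rw [htriangle, Nat.triangle_succ]
  simp only [pow_add]
  rw [mul_assoc _ ((-1 : ℚ) ^ (m * r)), hsq, mul_one, mul_assoc, mul_assoc, hsq, mul_one]

theorem suspSign_mul_suspSign_cons {m r : ℕ} (d : Fin (m + r) → ℤ) :
    suspSign m (fun a => d (a.castAdd r)) *
        suspSign (r + 1) (Fin.cons (∑ a : Fin m, d (a.castAdd r) + -1) fun b => d (b.natAdd m)) =
      (-1) ^ (m * r) * suspSign (m + r) d := by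
  have hfirst : ((-1 : ℚ) ^ (∑ a : Fin m, d (a.castAdd r) + -1)) ^ r =
      (∏ a : Fin m, ((-1 : ℚ) ^ d (a.castAdd r)) ^ r) * (-1) ^ r := by
    rw [negOne_zpow_add, negOne_zpow_sum, mul_pow, Finset.prod_pow]
    norm_num
  have hleft (a : Fin m) : ((-1 : ℚ) ^ d (a.castAdd r)) ^ (m + r - 1 - (a : ℕ)) =
      ((-1 : ℚ) ^ d (a.castAdd r)) ^ (m - 1 - (a : ℕ)) * ((-1 : ℚ) ^ d (a.castAdd r)) ^ r := by
    rw [← pow_add]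
    congr 1
    omega
  have hright (b : Fin r) : m + r - 1 - (m + (b : ℕ)) = r - 1 - (b : ℕ) := by omega
  have hcons (b : Fin r) : r - ((b : ℕ) + 1) = r - 1 - (b : ℕ) := by omega
  simp only [suspSign, Fin.prod_univ_succ, Fin.prod_univ_add, Fin.cons_zero, Fin.cons_succ,
    Fin.val_zero, Fin.val_succ, Fin.val_castAdd, Fin.val_natAdd, hleft, hright, hcons,
    Finset.prod_mul_distrib, Nat.sub_zero, Nat.add_sub_cancel, hfirst]
  have := negOne_pow_triangle m r
  rw [Nat.add_sub_cancel] at this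
  linear_combination (∏ a : Fin m, ((-1 : ℚ) ^ d (a.castAdd r)) ^ (m - 1 - (a : ℕ))) *
    (∏ a : Fin m, ((-1 : ℚ) ^ d (a.castAdd r)) ^ r) *
    (∏ b : Fin r, ((-1 : ℚ) ^ d (b.natAdd m)) ^ (r - 1 - (b : ℕ))) * this

end Signs

/-! ### The differential of the chain coalgebra -/

namespace LInfinityStructure

variable {V : GradedSpace.{u}} (L : LInfinityStructure V)

theorem h_eq_suspSign_smul {n : ℕ} {d : Fin n → ℤ} {x : Fin n → V.susp}
    (hx : ∀ i, x i ∈ V.susp.gr (d i)) :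
    L.h n x = suspSign n d • V.s (L.ℓ n fun i => V.s.symm (x i)) := by
  rw [L.h_apply d x hx, smul_smul, suspSign]

theorem h_mem {k : ℕ} {d : Fin k → ℤ} {x : Fin k → V.susp} (hx : ∀ i, x i ∈ V.susp.gr (d i)) :
    L.h k x ∈ V.susp.gr (∑ i, d i + -1) := by
  rw [L.h_eq_suspSign_smul hx]
  refine Submodule.smul_mem _ _ ?_
  have := L.degree k (fun i => d i - 1) (fun i => V.s.symm (x i)) hx
  rw [Finset.sum_sub_distrib] at this
  simp only [Finset.sum_const, Finset.card_univ, Fintype.card_fin, nsmul_eq_mul, mul_one] at this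
  rwa [show ∑ i, d i - (k : ℤ) + k - 2 = ∑ i, d i + -1 - 1 by ring] at this

theorem h_of_ℓ_eq_zero {k : ℕ} (hk : L.ℓ k = 0) : L.h k = 0 := by
  ext x
  simp [h, hk]

theorem h_cons_h {m r : ℕ} {d : Fin (m + r) → ℤ} {x : Fin (m + r) → V.susp}
    (hx : ∀ i, x i ∈ V.susp.gr (d i)) :
    L.h (r + 1) (Fin.cons (L.h m fun a => x (a.castAdd r)) fun b => x (b.natAdd m)) =
      ((-1) ^ (m * r) * suspSign (m + r) d) • V.s (L.ℓ (r + 1)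
        (Fin.cons (L.ℓ m fun a => V.s.symm (x (a.castAdd r)))
          fun b => V.s.symm (x (b.natAdd m)))) := by
  have hmem := L.h_mem fun a => hx (a.castAdd r)
  have hdeg (i : Fin (r + 1)) :
      (Fin.cons (L.h m fun a => x (a.castAdd r)) fun b => x (b.natAdd m) : Fin (r + 1) → V.susp) i ∈
        V.susp.gr ((Fin.cons (∑ a : Fin m, d (a.castAdd r) + -1) fun b => d (b.natAdd m) :
          Fin (r + 1) → ℤ) i) :=
    Fin.cases hmem (fun b => hx (b.natAdd m)) i
  have hdesusp : (fun i => V.s.symm ((Fin.cons (L.h m fun a => x (a.castAdd r))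
      fun b => x (b.natAdd m) : Fin (r + 1) → V.susp) i)) =
      Fin.cons (suspSign m (fun a => d (a.castAdd r)) • L.ℓ m fun a => V.s.symm (x (a.castAdd r)))
        fun b => V.s.symm (x (b.natAdd m)) := by
    funext i
    refine Fin.cases ?_ (fun b => rfl) i
    simp only [Fin.cons_zero]
    rw [L.h_eq_suspSign_smul fun a => hx (a.castAdd r), map_smul, LinearEquiv.symm_apply_apply]
  rw [L.h_eq_suspSign_smul hdeg, hdesusp, MultilinearMap.cons_smul, map_smul, smul_smul, mul_comm,
    suspSign_mul_suspSign_cons]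

/-- The linear map `ΛsL → sL` with components `hₖ`. -/
noncomputable def hTotal : Lam V.susp →ₗ[ℚ] V.susp := Lam.descend L.h L.h_gradedSymm

theorem hasDegree_hTotal : HasDegree (Lam.gr V.susp) V.susp.gr L.hTotal (-1) :=
  Lam.hasDegree_descend _ fun _ _ _ hx => L.h_mem hx

theorem hTotal_of_lt {k : ℕ} (hk : ∀ j < k, L.ℓ j = 0) {a : ℕ} (ha : a < k) {x : Lam V.susp}
    (hx : x ∈ Lam.wordLen V.susp a) : L.hTotal x = 0 :=
  Lam.descend_eq_zero_of_mem _ (L.h_of_ℓ_eq_zero (hk a ha)) hx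

theorem ℓ_of_lt_one {j : ℕ} (hj : j < 1) : L.ℓ j = 0 := by
  obtain rfl : j = 0 := by omega
  exact L.ℓ_zero

theorem hTotal_one : L.hTotal 1 = 0 :=
  L.hTotal_of_lt (fun _ => L.ℓ_of_lt_one) zero_lt_one Lam.one_mem_wordLen

theorem hTotal_shuffleTerm {m r : ℕ} (x : Fin (m + r) → V.susp) (σ : Equiv.Perm (Fin (m + r))) :
    L.hTotal (Lam.shuffleTerm L.hTotal x m σ) =
      L.h (r + 1)
        (Fin.cons (L.h m fun a => x (σ (a.castAdd r))) fun b => x (σ (b.natAdd m))) := by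
  have hlen : (List.ofFn fun a : Fin m => Lam.ι V.susp (x (σ (a.castLE (m.le_add_right r))))).length
      = m := List.length_ofFn
  have hprod := Lam.descend_prod L.h L.h_gradedSymm
    (Fin.cons (L.h m fun a => x (σ (a.castAdd r))) fun b => x (σ (b.natAdd m)))
  rw [List.ofFn_succ, List.prod_cons] at hprod
  rw [Lam.shuffleTerm, List.ofFn_add, List.take_left' hlen, List.drop_left' hlen, ← hprod]
  congr 3
  exact Lam.descend_prod L.h L.h_gradedSymm _

theorem koszulSign_smul_hTotal_shuffleTerm {n m r : ℕ} (h : m + r = n) {d : Fin n → ℤ}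
    {x : Fin n → V.susp} (hx : ∀ i, x i ∈ V.susp.gr (d i)) (σ : Equiv.Perm (Fin n)) :
    koszulSign d σ • L.hTotal (Lam.shuffleTerm L.hTotal x m σ) =
      suspSign n d • V.s ((koszulSign (fun a => d a - 1) σ * sgn σ * (-1 : ℚ) ^ (m * r)) •
        L.ℓ (r + 1) (Fin.cons (L.ℓ m fun a => V.s.symm (x (σ ⟨a, by omega⟩)))
          fun b => V.s.symm (x (σ ⟨m + b, by omega⟩)))) := by
  subst h
  rw [L.hTotal_shuffleTerm, L.h_cons_h fun i => hx (σ i), map_smul, smul_smul, smul_smul,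
    mul_left_comm, koszulSign_mul_suspSign d σ]
  congr 1
  ring

theorem hTotal_δ : L.hTotal ∘ₗ L.δ = 0 := by
  refine Lam.linearMap_ext_wordLen fun n x hx => ?_
  suffices h : Lam.wordLen V.susp n ≤ LinearMap.ker (L.hTotal ∘ₗ L.δ) from h hx
  refine Lam.wordLen_le_of_ofFn fun d x hx => ?_
  change L.hTotal (Lam.coderivation L.hTotal _) = 0
  rw [Lam.coderivation_ofFn L.hasDegree_hTotal hx, Fin.sum_univ_succ, map_add]
  have hempty (σ) : L.hTotal (koszulSign d σ • Lam.shuffleTerm L.hTotal x 0 σ) = 0 := by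
    simp [Lam.shuffleTerm, L.hTotal_one]
  simp only [map_sum, Fin.val_zero, hempty, Finset.sum_const_zero, zero_add, map_smul, Fin.val_succ]
  obtain rfl | hn := Nat.eq_zero_or_pos n
  · rfl
  have hjacobi := congrArg (fun y => suspSign n d • V.s y)
    (L.jacobi n hn (fun a => d a - 1) (fun a => V.s.symm (x a)) hx)
  simp only [map_zero, smul_zero, map_sum, Finset.smul_sum] at hjacobi
  rw [← hjacobi]
  exact Finset.sum_congr rfl fun i _ => Finset.sum_congr rfl fun σ _ =>
    L.koszulSign_smul_hTotal_shuffleTerm (by omega) hx σ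

theorem δ_sq : L.δ ∘ₗ L.δ = 0 := Lam.coderivation_sq L.hasDegree_hTotal L.hTotal_δ

theorem δ_mem_filtration {k : ℕ} (hk : ∀ j < k, L.ℓ j = 0) {p : ℤ} {x : Lam V.susp}
    (hx : x ∈ Lam.filtration V.susp p) : L.δ x ∈ Lam.filtration V.susp (p - k + 1) :=
  Lam.coderivation_mem_filtration (fun _ ha _ hx => L.hTotal_of_lt hk ha hx) hx

theorem isFilteredComplex : IsFilteredComplex L.δ (Lam.filtration V.susp) where
  sq_zero := L.δ_sq
  mono := Lam.filtration_mono
  map_le p := by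
    rintro _ ⟨x, hx, rfl⟩
    have := L.δ_mem_filtration (fun _ => L.ℓ_of_lt_one) hx
    rwa [Nat.cast_one, sub_add_cancel] at this

/-- The component `hₖ` of `h`, as a linear map on `ΛsL`. -/
noncomputable def hPart (k : ℕ) : Lam V.susp →ₗ[ℚ] V.susp :=
  Lam.descend (fun j => if j = k then L.h j else 0) (Lam.gradedSymm_single L.h L.h_gradedSymm k)

theorem hPart_of_ne {k a : ℕ} (h : a ≠ k) {x : Lam V.susp} (hx : x ∈ Lam.wordLen V.susp a) :
    L.hPart k x = 0 :=
  Lam.descend_eq_zero_of_mem _ (if_neg h) hx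

theorem hPart_self {k : ℕ} {x : Lam V.susp} (hx : x ∈ Lam.wordLen V.susp k) :
    L.hPart k x = L.hTotal x :=
  Lam.descend_eq_descend_of_mem _ _ (if_pos rfl) hx

theorem δPart_mem_word (k : ℕ) {p : ℤ} {x : Lam V.susp} (hx : x ∈ Lam.word V.susp p) :
    L.δPart k x ∈ Lam.word V.susp (p - (k - 1)) :=
  Lam.coderivation_mem_word (fun _ ha _ hx => L.hPart_of_ne ha hx) hx

theorem δ_sub_δPart_mem_filtration {k : ℕ} (hk : ∀ j < k, L.ℓ j = 0) {p : ℤ} {x : Lam V.susp}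
    (hx : x ∈ Lam.filtration V.susp p) :
    L.δ x - L.δPart k x ∈ Lam.filtration V.susp (p - k) := by
  have hvanish (a) (ha : a < k + 1) (x) (hx : x ∈ Lam.wordLen V.susp a) :
      (L.hTotal - L.hPart k) x = 0 := by
    rw [LinearMap.sub_apply]
    obtain rfl | hak := eq_or_ne a k
    · rw [L.hPart_self hx, sub_self]
    · rw [L.hPart_of_ne hak hx, L.hTotal_of_lt hk (by omega) hx, sub_zero]
  have := Lam.coderivation_mem_filtration hvanish hx
  rw [Lam.coderivation_sub, show p - ((k + 1 : ℕ) : ℤ) + 1 = p - k by push_cast; ring] at this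
  exact this

end LInfinityStructure

/-! ### Pages of a filtered complex -/

section Pages

variable {C : Type u} [AddCommGroup C] [Module ℚ C] {δ : C →ₗ[ℚ] C} {F : ℤ → Submodule ℚ C}

theorem IsFilteredComplex.apply_apply (hδ : IsFilteredComplex δ F) (x : C) : δ (δ x) = 0 :=
  LinearMap.congr_fun hδ.sq_zero x

theorem cyc_eq_of_lowering (hδ : IsFilteredComplex δ F) {m : ℤ}
    (hm : ∀ p, ∀ x ∈ F p, δ x ∈ F (p - m)) {r : ℤ} (hr : r ≤ m) (p : ℤ) : cyc δ F r p = F p :=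
  inf_eq_left.2 fun x hx => hδ.mono (by omega) (hm p x hx)

theorem den_eq_of_lowering (hδ : IsFilteredComplex δ F) {m : ℤ}
    (hm : ∀ p, ∀ x ∈ F p, δ x ∈ F (p - m)) {r : ℤ} (hr : r ≤ m) (p : ℤ) :
    den δ F r p = F (p - 1) := by
  rw [den, cyc_eq_of_lowering hδ hm (by omega)]
  refine sup_eq_left.2 ?_
  rintro _ ⟨-, x, hx, rfl⟩
  exact hδ.mono (by omega) (hm _ x hx)

theorem pageMk_eq_iff {r p : ℤ} (x y : cyc δ F r p) :
    pageMk δ F r p x = pageMk δ F r p y ↔ (x - y : C) ∈ den δ F r p :=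
  Submodule.Quotient.eq _

theorem pageMk_surjective (r p : ℤ) : Function.Surjective (pageMk δ F r p) :=
  Submodule.mkQ_surjective _

theorem pageD_pageMk (hδ : IsFilteredComplex δ F) (r p : ℤ) (x : C) (hx : x ∈ cyc δ F r p) :
    pageD hδ r p (pageMk δ F r p ⟨x, hx⟩) =
      pageMk δ F r (p - r) ⟨δ x, map_cyc hδ r p x hx⟩ := rfl

theorem pageD_eq_zero_iff (hδ : IsFilteredComplex δ F) (r p : ℤ) :
    pageD hδ r p = 0 ↔ ∀ x ∈ cyc δ F r p, δ x ∈ den δ F r (p - r) := by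
  have apply_eq_zero_iff (x : C) (hx : x ∈ cyc δ F r p) :
      pageD hδ r p (pageMk δ F r p ⟨x, hx⟩) = 0 ↔ δ x ∈ den δ F r (p - r) := by
    rw [pageD_pageMk, ← map_zero (pageMk δ F r (p - r)), pageMk_eq_iff]
    simp
  constructor
  · intro h x hx
    rw [← apply_eq_zero_iff x hx, h, LinearMap.zero_apply]
  · intro h
    refine LinearMap.ext fun y => ?_
    obtain ⟨⟨x, hx⟩, rfl⟩ := pageMk_surjective r p y
    exact (apply_eq_zero_iff x hx).2 (h x hx)

theorem bijective_pageMk_inclusion (hδ : IsFilteredComplex δ F) {m : ℤ}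
    (hm : ∀ p, ∀ x ∈ F p, δ x ∈ F (p - m)) {p : ℤ} {G : Submodule ℚ C}
    (hsup : F p = G ⊔ F (p - 1)) (hdisj : Disjoint G (F (p - 1))) (hG : G ≤ cyc δ F m p) :
    Function.Bijective (pageMk δ F m p ∘ₗ Submodule.inclusion hG) := by
  have hden := den_eq_of_lowering hδ hm le_rfl p
  constructor
  · rw [← LinearMap.ker_eq_bot, LinearMap.ker_eq_bot']
    intro x hx
    rw [LinearMap.comp_apply, ← map_zero (pageMk δ F m p), pageMk_eq_iff, hden] at hx
    exact Subtype.ext (Submodule.disjoint_def.1 hdisj x x.2 (by simpa using hx))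
  · intro y
    obtain ⟨⟨x, hx⟩, rfl⟩ := pageMk_surjective m p y
    obtain ⟨g, hg, f, hf, rfl⟩ := Submodule.mem_sup.1 (hsup ▸ hx.1)
    refine ⟨⟨g, hg⟩, ?_⟩
    rw [LinearMap.comp_apply, pageMk_eq_iff, hden]
    simpa using Submodule.neg_mem _ hf

theorem exists_page_equiv (hδ : IsFilteredComplex δ F) {m : ℤ}
    (hm : ∀ p, ∀ x ∈ F p, δ x ∈ F (p - m)) {G : ℤ → Submodule ℚ C}
    (hsup : ∀ p, F p = G p ⊔ F (p - 1)) (hdisj : ∀ p, Disjoint (G p) (F (p - 1)))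
    {δ' : C →ₗ[ℚ] C} (hG : ∀ p, ∀ x ∈ G p, δ' x ∈ G (p - m))
    (hδ' : ∀ p, ∀ x ∈ F p, δ x - δ' x ∈ F (p - m - 1)) :
    ∃ φ : ∀ p : ℤ, G p ≃ₗ[ℚ] Page δ F m p,
      (∀ (p : ℤ) (x : G p), ∃ hx : (x : C) ∈ cyc δ F m p, φ p x = pageMk δ F m p ⟨x, hx⟩) ∧
      ∀ (p : ℤ) (x : G p), ∃ hy : δ' x ∈ G (p - m),
        pageD hδ m p (φ p x) = φ (p - m) ⟨δ' x, hy⟩ := by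
  have hGF (p : ℤ) : G p ≤ F p := le_sup_left.trans_eq (hsup p).symm
  have hGcyc (p : ℤ) : G p ≤ cyc δ F m p :=
    (hGF p).trans_eq (cyc_eq_of_lowering hδ hm le_rfl p).symm
  refine ⟨fun p => LinearEquiv.ofBijective _
      (bijective_pageMk_inclusion hδ hm (hsup p) (hdisj p) (hGcyc p)),
    fun p x => ⟨hGcyc p x.2, rfl⟩, fun p x => ⟨hG p x x.2, ?_⟩⟩
  change pageD hδ m p (pageMk δ F m p ⟨x, hGcyc p x.2⟩) =
    pageMk δ F m (p - m) ⟨δ' x, hGcyc _ (hG p x x.2)⟩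
  rw [pageD_pageMk, pageMk_eq_iff, den_eq_of_lowering hδ hm le_rfl]
  exact hδ' p x (hGF p x.2)

/-- The condition `dʳ = 0` on `E^r_p`, in terms of elements: a cycle modulo `F_{p-r}` can be
corrected, without changing its leading part, to a cycle modulo `F_{p-r-1}`. Unlike `pageD`, it
makes sense without a proof of `IsFilteredComplex δ F`. -/
def ExtendsCycles (δ : C →ₗ[ℚ] C) (F : ℤ → Submodule ℚ C) (r p : ℤ) : Prop :=
  ∀ x ∈ F p, δ x ∈ F (p - r) → ∃ w ∈ F (p - 1), δ (x - w) ∈ F (p - r - 1)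

theorem pageD_eq_zero_iff_extendsCycles (hδ : IsFilteredComplex δ F) (r p : ℤ) :
    pageD hδ r p = 0 ↔ ExtendsCycles δ F r p := by
  have hp : p - r + (r - 1) = p - 1 := by ring
  rw [pageD_eq_zero_iff]
  constructor
  · intro h x hx hx'
    obtain ⟨y, ⟨hy, -⟩, z, ⟨-, w, hw, rfl⟩, e⟩ := Submodule.mem_sup.1 (h x ⟨hx, hx'⟩)
    refine ⟨w, hp ▸ hw, ?_⟩
    rwa [map_sub, ← e, add_sub_cancel_right]
  · rintro h x ⟨hx, hx'⟩
    obtain ⟨w, hw, hxw⟩ := h x hx hx'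
    have hδw : δ w ∈ F (p - r) := by
      rw [← sub_sub_cancel (δ x) (δ w), ← map_sub]
      exact Submodule.sub_mem _ hx' (hδ.mono (by omega) hxw)
    have hδδ : δ (δ (x - w)) ∈ F (p - r - 1 - (r - 1)) := by
      rw [hδ.apply_apply]
      exact Submodule.zero_mem _
    rw [← sub_add_cancel (δ x) (δ w), ← map_sub]
    exact Submodule.add_mem_sup ⟨hxw, hδδ⟩ ⟨hδw, w, hp.symm ▸ hw, rfl⟩

end Pages

section Comparison

variable {C C' : Type u} [AddCommGroup C] [Module ℚ C] [AddCommGroup C'] [Module ℚ C']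
  {δ : C →ₗ[ℚ] C} {F : ℤ → Submodule ℚ C} {δ' : C' →ₗ[ℚ] C'} {F' : ℤ → Submodule ℚ C'}

/-- `f` induces an injection on the homology of `F_p / F_q`. -/
def InjBetween (δ : C →ₗ[ℚ] C) (F : ℤ → Submodule ℚ C) (δ' : C' →ₗ[ℚ] C')
    (F' : ℤ → Submodule ℚ C') (f : C →ₗ[ℚ] C') (p q : ℤ) : Prop :=
  ∀ x ∈ F p, δ x ∈ F q → ∀ w ∈ F' p, f x - δ' w ∈ F' q → ∃ z ∈ F p, x - δ z ∈ F q

/-- `f` induces a surjection on the homology of `F_p / F_q`. -/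
def SurjBetween (δ : C →ₗ[ℚ] C) (F : ℤ → Submodule ℚ C) (δ' : C' →ₗ[ℚ] C')
    (F' : ℤ → Submodule ℚ C') (f : C →ₗ[ℚ] C') (p q : ℤ) : Prop :=
  ∀ x' ∈ F' p, δ' x' ∈ F' q → ∃ x ∈ F p, δ x ∈ F q ∧ ∃ w ∈ F' p, f x - x' - δ' w ∈ F' q

variable {f : C →ₗ[ℚ] C'}

theorem InjBetween.trans (hδ : IsFilteredComplex δ F) (hδ' : IsFilteredComplex δ' F')
    (hf : ∀ x, δ' (f x) = f (δ x)) (hF : ∀ p, ∀ x ∈ F p, f x ∈ F' p) {p q r : ℤ} (hqp : q ≤ p)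
    (hrq : r ≤ q) (hinj : InjBetween δ F δ' F' f p q) (hsurj : SurjBetween δ F δ' F' f p q)
    (hinj' : InjBetween δ F δ' F' f q r) : InjBetween δ F δ' F' f p r := by
  intro x hx hdx w hw hxw
  obtain ⟨z, hz, hxz⟩ := hinj x hx (hδ.mono hrq hdx) w hw (hδ'.mono hrq hxw)
  have cycle_quot : δ' (w - f z) ∈ F' q := by
    have : δ' (w - f z) = f (x - δ z) - (f x - δ' w) := by rw [map_sub, map_sub, hf]; abel
    rw [this]
    exact Submodule.sub_mem _ (hF _ _ hxz) (hδ'.mono hrq hxw)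
  obtain ⟨u, hu, hdu, e, -, huw⟩ :=
    hsurj (w - f z) (Submodule.sub_mem _ hw (hF _ _ hz)) cycle_quot
  have bounds : f (x - δ z - δ u) - δ' (-(f u - (w - f z) - δ' e)) = f x - δ' w := by
    simp only [map_sub, map_neg, hδ'.apply_apply, hf]
    abel
  obtain ⟨v, hv, hxv⟩ := hinj' (x - δ z - δ u) (Submodule.sub_mem _ hxz hdu)
    (by simpa only [map_sub, hδ.apply_apply, sub_zero] using hdx) _ (Submodule.neg_mem _ huw)
    (bounds ▸ hxw)
  refine ⟨z + u + v, Submodule.add_mem _ (Submodule.add_mem _ hz hu) (hδ.mono hqp hv), ?_⟩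
  rwa [map_add, map_add, ← sub_sub, ← sub_sub]

theorem SurjBetween.trans (hδ : IsFilteredComplex δ F) (hδ' : IsFilteredComplex δ' F')
    (hf : ∀ x, δ' (f x) = f (δ x)) (hF : ∀ p, ∀ x ∈ F p, f x ∈ F' p) {p q r : ℤ} (hqp : q ≤ p)
    (hrq : r ≤ q) (hsurj : SurjBetween δ F δ' F' f p q) (hinj' : InjBetween δ F δ' F' f q r)
    (hsurj' : SurjBetween δ F δ' F' f q r) : SurjBetween δ F δ' F' f p r := by
  intro x' hx' hdx'
  obtain ⟨x, hx, hdx, w, hw, hxw⟩ := hsurj x' hx' (hδ'.mono hrq hdx')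
  have bounds : f (δ x) - δ' (f x - x' - δ' w) = δ' x' := by
    simp only [map_sub, hδ'.apply_apply, hf]
    abel
  obtain ⟨z, hz, hxz⟩ := hinj' (δ x) hdx (by rw [hδ.apply_apply]; exact Submodule.zero_mem _) _ hxw
    (bounds ▸ hdx')
  have error_mem : f (x - z) - x' - δ' w ∈ F' q := by
    have : f (x - z) - x' - δ' w = f x - x' - δ' w - f z := by rw [map_sub]; abel
    rw [this]
    exact Submodule.sub_mem _ hxw (hF _ _ hz)
  have error_cycle : δ' (f (x - z) - x' - δ' w) ∈ F' r := by
    have : δ' (f (x - z) - x' - δ' w) = f (δ x - δ z) - δ' x' := by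
      simp only [map_sub, hδ'.apply_apply, hf]
      abel
    rw [this]
    exact Submodule.sub_mem _ (hF _ _ hxz) hdx'
  obtain ⟨y, hy, hdy, v, hv, hyv⟩ := hsurj' _ error_mem error_cycle
  refine ⟨x - z - y, Submodule.sub_mem _ (Submodule.sub_mem _ hx (hδ.mono hqp hz))
    (hδ.mono hqp hy), ?_, w - v, Submodule.sub_mem _ hw (hδ'.mono hqp hv), ?_⟩
  · rw [map_sub, map_sub]
    exact Submodule.sub_mem _ hxz hdy
  · have : f (x - z - y) - x' - δ' (w - v) = -(f y - (f (x - z) - x' - δ' w) - δ' v) := by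
      simp only [map_sub]
      abel
    rw [this]
    exact Submodule.neg_mem _ hyv

theorem injBetween_and_surjBetween (hδ : IsFilteredComplex δ F) (hδ' : IsFilteredComplex δ' F')
    (hf : ∀ x, δ' (f x) = f (δ x)) (hF : ∀ p, ∀ x ∈ F p, f x ∈ F' p)
    (hinj : ∀ p, InjBetween δ F δ' F' f p (p - 1)) (hsurj : ∀ p, SurjBetween δ F δ' F' f p (p - 1))
    (p : ℤ) (n : ℕ) : InjBetween δ F δ' F' f p (p - n) ∧ SurjBetween δ F δ' F' f p (p - n) := by
  induction n generalizing p with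
  | zero =>
    rw [Nat.cast_zero, sub_zero]
    exact ⟨fun x hx _ _ _ _ => ⟨0, Submodule.zero_mem _, by simpa using hx⟩, fun x' hx' _ =>
      ⟨0, Submodule.zero_mem _, by simp, 0, Submodule.zero_mem _, by simpa using hx'⟩⟩
  | succ n ih =>
    have hn : p - 1 - (n : ℤ) = p - ((n + 1 : ℕ) : ℤ) := by push_cast; ring
    obtain ⟨ihinj, ihsurj⟩ := hn ▸ ih (p - 1)
    exact ⟨InjBetween.trans hδ hδ' hf hF (by omega) (by omega) (hinj p) (hsurj p) ihinj,
      SurjBetween.trans hδ hδ' hf hF (by omega) (by omega) (hsurj p) ihinj ihsurj⟩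

theorem extendsCycles_iff (hδ : IsFilteredComplex δ F) (hδ' : IsFilteredComplex δ' F')
    (hf : ∀ x, δ' (f x) = f (δ x)) (hF : ∀ p, ∀ x ∈ F p, f x ∈ F' p)
    (hinj : ∀ p, InjBetween δ F δ' F' f p (p - 1)) (hsurj : ∀ p, SurjBetween δ F δ' F' f p (p - 1))
    {r : ℤ} (hr : 1 ≤ r) (p : ℤ) : ExtendsCycles δ F r p ↔ ExtendsCycles δ' F' r p := by
  obtain ⟨n, rfl⟩ := Int.eq_ofNat_of_zero_le (by omega : 0 ≤ r)
  have between (p : ℤ) := injBetween_and_surjBetween hδ hδ' hf hF hinj hsurj p n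
  constructor
  · intro h x' hx' hdx'
    obtain ⟨x, hx, hdx, w, -, hxw⟩ := (between p).2 x' hx' hdx'
    obtain ⟨u, hu, hxu⟩ := h x hx hdx
    refine ⟨f u - (f x - x' - δ' w),
      Submodule.sub_mem _ (hF _ _ hu) (hδ'.mono (by omega) hxw), ?_⟩
    have : δ' (x' - (f u - (f x - x' - δ' w))) = f (δ (x - u)) := by
      simp only [map_sub, hδ'.apply_apply, hf]
      abel
    rw [this]
    exact hF _ _ hxu
  · intro h x hx hdx
    obtain ⟨w', hw', hxw⟩ := h (f x) (hF _ _ hx) (by rw [hf]; exact hF _ _ hdx)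
    have hinj := (between (p - 1)).1
    rw [sub_right_comm] at hinj
    obtain ⟨z, hz, hxz⟩ := hinj (δ x) (hδ.mono (by omega) hdx)
      (by rw [hδ.apply_apply]; exact Submodule.zero_mem _) w' hw' (by rwa [← hf, ← map_sub])
    exact ⟨z, hz, by rwa [map_sub]⟩

end Comparison

namespace LInfinityStructure

variable {V : GradedSpace.{u}} (L : LInfinityStructure V)

theorem extendsCycles_of_binary (h : ∀ k, k ≠ 2 → L.ℓ k = 0) {r : ℤ} (hr : 2 ≤ r) (p : ℤ) :
    ExtendsCycles L.δ (Lam.filtration V.susp) r p := by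
  have hTotal_of_ne (a : ℕ) (ha : a ≠ 2) (x) (hx : x ∈ Lam.wordLen V.susp a) : L.hTotal x = 0 :=
    Lam.descend_eq_zero_of_mem _ (L.h_of_ℓ_eq_zero (h a ha)) hx
  have lowering (q : ℤ) (x) (hx : x ∈ Lam.filtration V.susp q) :
      L.δ x ∈ Lam.filtration V.susp (q - 1) := by
    have := L.δ_mem_filtration (k := 2) (fun j hj => h j hj.ne) hx
    rwa [show q - ((2 : ℕ) : ℤ) + 1 = q - 1 by push_cast; ring] at this
  intro x hx hdx
  obtain ⟨g, hg, y, hy, rfl⟩ := Submodule.mem_sup.1 ((Lam.filtration_eq_sup p).le hx)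
  have hδg : L.δ g ∈ Lam.word V.susp (p - 1) := by
    have := Lam.coderivation_mem_word (m := 2) hTotal_of_ne hg
    rwa [show p - (((2 : ℕ) : ℤ) - 1) = p - 1 by push_cast; ring] at this
  have hδg' : L.δ g ∈ Lam.filtration V.susp (p - 1 - 1) := by
    rw [← add_sub_cancel_right (L.δ g) (L.δ y), ← map_add]
    exact Submodule.sub_mem _ (Lam.filtration_mono (by omega) hdx) (lowering _ y hy)
  refine ⟨y, hy, ?_⟩
  rw [add_sub_cancel_right,
    Submodule.disjoint_def.1 (Lam.disjoint_word_filtration (p - 1)) _ hδg hδg']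
  exact Submodule.zero_mem _

end LInfinityStructure

/-! ### Homology isomorphisms and contractions -/

section HomologyIso

variable {C C' : Type*} [AddCommGroup C] [Module ℚ C] [AddCommGroup C'] [Module ℚ C']

/-- The map `f` of complexes `(C, d) → (C', d')` is bijective on homology. -/
structure IsHomologyIso (d : C →ₗ[ℚ] C) (d' : C' →ₗ[ℚ] C') (f : C →ₗ[ℚ] C') : Prop where
  injective : ∀ x, d x = 0 → (∃ w, d' w = f x) → ∃ y, d y = x
  surjective : ∀ x', d' x' = 0 → ∃ x, d x = 0 ∧ ∃ w, f x - x' = d' w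

theorem IsHomologyIso.of_homotopyInverse {d : C →ₗ[ℚ] C} {d' : C' →ₗ[ℚ] C'} {f : C →ₗ[ℚ] C'}
    {g : C' →ₗ[ℚ] C} {e : C →ₗ[ℚ] C} {e' : C' →ₗ[ℚ] C'} (hf : ∀ x, d' (f x) = f (d x))
    (hg : ∀ x, d (g x) = g (d' x)) (he : ∀ x, d x = 0 → x - e x ∈ LinearMap.range d)
    (he' : ∀ x, d' x = 0 → x - e' x ∈ LinearMap.range d') (hleft : ∀ x, g (f (e x)) = e x)
    (hright : ∀ x, e' (f (g x)) = e' x) : IsHomologyIso d d' f where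
  injective := by
    rintro x hx ⟨w, hw⟩
    obtain ⟨y, hy⟩ := he x hx
    have hex : e x = x - d y := by rw [hy, sub_sub_cancel]
    refine ⟨y + g (w - f y), ?_⟩
    rw [map_add, hg, map_sub, hw, hf, ← map_sub, ← hex, hleft, hy, sub_add_cancel]
  surjective := by
    intro x' hx'
    have hgx : d (g x') = 0 := by rw [hg, hx', map_zero]
    obtain ⟨y, hy⟩ := he' x' hx'
    obtain ⟨z, hz⟩ := he' (f (g x')) (by rw [hf, hgx, map_zero])
    exact ⟨g x', hgx, z - y, by rw [map_sub, hy, hz, hright, sub_sub_sub_cancel_right]⟩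

end HomologyIso

namespace HasDegree

variable {U V W : GradedSpace.{u}} {a : V →ₗ[ℚ] W} {e : ℤ}

theorem proj_comm (ha : HasDegree V.gr W.gr a e) (n : ℤ) (x : V) :
    a (V.proj n x) = W.proj (n + e) (a x) := by
  induction x using GradedSpace.homogeneous_induction with
  | zero => simp only [map_zero]
  | add x y hx hy => simp only [map_add, hx, hy]
  | mem i x hx =>
    obtain rfl | h := eq_or_ne i n
    · rw [V.proj_of_mem hx, W.proj_of_mem (ha _ _ hx)]
    · rw [V.proj_of_mem_ne hx h, W.proj_of_mem_ne (ha _ _ hx) (by omega), map_zero]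

theorem comp {b : U →ₗ[ℚ] V} {e' : ℤ} (ha : HasDegree V.gr W.gr a e)
    (hb : HasDegree U.gr V.gr b e') : HasDegree U.gr W.gr (a ∘ₗ b) (e + e') := fun n v hv => by
  rw [add_comm e, ← add_assoc]
  exact ha _ _ (hb n v hv)

theorem add {b : V →ₗ[ℚ] W} (ha : HasDegree V.gr W.gr a e) (hb : HasDegree V.gr W.gr b e) :
    HasDegree V.gr W.gr (a + b) e := fun n v hv => Submodule.add_mem _ (ha n v hv) (hb n v hv)

theorem sub {b : V →ₗ[ℚ] W} (ha : HasDegree V.gr W.gr a e) (hb : HasDegree V.gr W.gr b e) :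
    HasDegree V.gr W.gr (a - b) e := fun n v hv => Submodule.sub_mem _ (ha n v hv) (hb n v hv)

end HasDegree

theorem hasDegree_zero_iff {V W : GradedSpace.{u}} {a : V →ₗ[ℚ] W} :
    HasDegree V.gr W.gr a 0 ↔ ∀ n, ∀ v ∈ V.gr n, a v ∈ W.gr n := by
  simp only [HasDegree, add_zero]

theorem hasDegree_id (V : GradedSpace.{u}) : HasDegree V.gr V.gr LinearMap.id 0 :=
  hasDegree_zero_iff.2 fun _ _ hv => hv

theorem exists_generalizedInverse {K M N : Type*} [Field K] [AddCommGroup M] [Module K M]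
    [AddCommGroup N] [Module K N] (a : M →ₗ[K] N) : ∃ b : N →ₗ[K] M, a ∘ₗ b ∘ₗ a = a := by
  obtain ⟨g, hg⟩ := a.rangeRestrict.exists_rightInverse_of_surjective a.range_rangeRestrict
  obtain ⟨b, hb⟩ := LinearMap.exists_extend g
  refine ⟨b, LinearMap.ext fun v => ?_⟩
  have hbv : b (a v) = g (a.rangeRestrict v) := LinearMap.congr_fun hb (a.rangeRestrict v)
  rw [LinearMap.comp_apply, LinearMap.comp_apply, hbv]
  exact congrArg Subtype.val (LinearMap.congr_fun hg (a.rangeRestrict v))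

namespace GradedSpace

variable {V W : GradedSpace.{u}}

/-- The degree `e` component of a linear map. -/
noncomputable def homogeneousPart (b : V →ₗ[ℚ] W) (e : ℤ) : V →ₗ[ℚ] W :=
  DirectSum.toModule ℚ ℤ W (fun n => W.proj (n + e) ∘ₗ b ∘ₗ (V.gr n).subtype) ∘ₗ
    (DirectSum.decomposeLinearEquiv V.gr).toLinearMap

theorem homogeneousPart_of_mem (b : V →ₗ[ℚ] W) (e : ℤ) {n : ℤ} {v : V} (hv : v ∈ V.gr n) :
    homogeneousPart b e v = W.proj (n + e) (b v) := by
  lift v to V.gr n using hv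
  simp only [homogeneousPart, LinearMap.comp_apply, LinearEquiv.coe_coe,
    DirectSum.decomposeLinearEquiv_apply, DirectSum.decompose_coe]
  rw [← DirectSum.lof_eq_of ℚ, DirectSum.toModule_lof]
  rfl

theorem hasDegree_homogeneousPart (b : V →ₗ[ℚ] W) (e : ℤ) :
    HasDegree V.gr W.gr (homogeneousPart b e) e := fun n v hv => by
  rw [homogeneousPart_of_mem b e hv]
  exact W.proj_mem _ _

end GradedSpace

theorem HasDegree.exists_generalizedInverse {V W : GradedSpace.{u}} {a : V →ₗ[ℚ] W} {e : ℤ}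
    (ha : HasDegree V.gr W.gr a e) :
    ∃ b : W →ₗ[ℚ] V, HasDegree W.gr V.gr b (-e) ∧ a ∘ₗ b ∘ₗ a = a := by
  obtain ⟨b, hb⟩ := Quillen.exists_generalizedInverse a
  refine ⟨GradedSpace.homogeneousPart b (-e), GradedSpace.hasDegree_homogeneousPart b (-e),
    LinearMap.ext fun v => ?_⟩
  induction v using GradedSpace.homogeneous_induction with
  | zero => simp only [map_zero]
  | add x y hx hy => simp only [map_add, hx, hy]
  | mem n v hv =>
    have hbv : a (b (a v)) = a v := LinearMap.congr_fun hb v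
    rw [LinearMap.comp_apply, LinearMap.comp_apply,
      GradedSpace.homogeneousPart_of_mem b _ (ha n v hv), ha.proj_comm, hbv, add_assoc,
      neg_add_cancel, add_zero, W.proj_of_mem (ha n v hv)]

/-- A homotopy `h` contracting the complex `(V, d)` onto its homology. -/
structure IsContraction {V : GradedSpace.{u}} (d h : V →ₗ[ℚ] V) : Prop where
  hasDegree_d : HasDegree V.gr V.gr d (-1)
  hasDegree_h : HasDegree V.gr V.gr h 1
  d_d : ∀ v, d (d v) = 0
  d_h_d : ∀ v, d (h (d v)) = d v
  h_h : ∀ v, h (h v) = 0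

theorem exists_isContraction {V : GradedSpace.{u}} {d : V →ₗ[ℚ] V}
    (hd : HasDegree V.gr V.gr d (-1)) (hdd : ∀ v, d (d v) = 0) : ∃ h, IsContraction d h := by
  obtain ⟨b, hb, hdbd⟩ := hd.exists_generalizedInverse
  have hdb : ∀ v, d (b (d v)) = d v := fun v => LinearMap.congr_fun hdbd v
  rw [neg_neg] at hb
  refine ⟨b ∘ₗ d ∘ₗ b ∘ₗ (LinearMap.id - b ∘ₗ d), hd, ?_, hdd, fun v => ?_, fun v => ?_⟩
  · exact hb.comp (hd.comp (hb.comp ((hasDegree_id V).sub (hb.comp hd))))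
  · simp [hdd, hdb]
  · simp [hdb]

section Projections

variable {V : GradedSpace.{u}} (d h : V →ₗ[ℚ] V)

/-- The projection `dh + hd` onto the acyclic part of a contraction. -/
def acyclicProj : V →ₗ[ℚ] V := d ∘ₗ h + h ∘ₗ d

/-- The projection `1 - (dh + hd)` onto the copy of the homology singled out by a contraction. -/
def harmonicProj : V →ₗ[ℚ] V := LinearMap.id - acyclicProj d h

theorem acyclicProj_apply (v : V) : acyclicProj d h v = d (h v) + h (d v) := rfl

theorem harmonicProj_apply (v : V) : harmonicProj d h v = v - acyclicProj d h v := rfl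

theorem harmonicProj_of_cycle {v : V} (hv : d v = 0) : harmonicProj d h v = v - d (h v) := by
  rw [harmonicProj_apply, acyclicProj_apply, hv, map_zero, add_zero]

end Projections

namespace IsContraction

variable {V W : GradedSpace.{u}} {d h : V →ₗ[ℚ] V}

theorem hasDegree_acyclicProj (hc : IsContraction d h) : HasDegree V.gr V.gr (acyclicProj d h) 0 :=
  (hc.hasDegree_d.comp hc.hasDegree_h).add (hc.hasDegree_h.comp hc.hasDegree_d)

theorem hasDegree_harmonicProj (hc : IsContraction d h) :
    HasDegree V.gr V.gr (harmonicProj d h) 0 :=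
  (hasDegree_id V).sub hc.hasDegree_acyclicProj

theorem harmonicProj_mem (hc : IsContraction d h) :
    ∀ n, ∀ v ∈ V.gr n, harmonicProj d h v ∈ V.gr n :=
  hasDegree_zero_iff.1 hc.hasDegree_harmonicProj

theorem acyclicProj_acyclicProj (hc : IsContraction d h) (v : V) :
    acyclicProj d h (acyclicProj d h v) = acyclicProj d h v := by
  simp [acyclicProj_apply, hc.d_d, hc.d_h_d, hc.h_h]

theorem acyclicProj_harmonicProj (hc : IsContraction d h) (v : V) :
    acyclicProj d h (harmonicProj d h v) = 0 := by
  rw [harmonicProj_apply, map_sub, hc.acyclicProj_acyclicProj, sub_self]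

theorem harmonicProj_harmonicProj (hc : IsContraction d h) (v : V) :
    harmonicProj d h (harmonicProj d h v) = harmonicProj d h v := by
  rw [harmonicProj_apply d h (harmonicProj d h v), hc.acyclicProj_harmonicProj, sub_zero]

theorem d_harmonicProj (hc : IsContraction d h) (v : V) : d (harmonicProj d h v) = 0 := by
  simp [harmonicProj_apply, acyclicProj_apply, hc.d_d, hc.d_h_d]

theorem harmonicProj_d (hc : IsContraction d h) (v : V) : harmonicProj d h (d v) = 0 := by
  simp [harmonicProj_apply, acyclicProj_apply, hc.d_d, hc.d_h_d]

variable {d' h' : W →ₗ[ℚ] W} {φ : V →ₗ[ℚ] W}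

theorem harmonicProj_eq_zero_of_isHomologyIso (hc : IsContraction d h)
    (hφd : ∀ v, d' (φ v) = φ (d v)) (hφ : IsHomologyIso d d' φ) {v : V}
    (hv : harmonicProj d' h' (φ (harmonicProj d h v)) = 0) : harmonicProj d h v = 0 := by
  have hcycle : d' (φ (harmonicProj d h v)) = 0 := by rw [hφd, hc.d_harmonicProj, map_zero]
  rw [harmonicProj_of_cycle _ _ hcycle, sub_eq_zero] at hv
  obtain ⟨y, hy⟩ := hφ.injective _ (hc.d_harmonicProj v) ⟨_, hv.symm⟩
  rw [← hc.harmonicProj_harmonicProj, ← hy, hc.harmonicProj_d]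

theorem exists_harmonicProj_eq_of_isHomologyIso (hc' : IsContraction d' h')
    (hφd : ∀ v, d' (φ v) = φ (d v)) (hφ : IsHomologyIso d d' φ) (w : W) :
    ∃ v, harmonicProj d' h' (φ (harmonicProj d h v)) = harmonicProj d' h' w := by
  obtain ⟨v, hv, y, hy⟩ := hφ.surjective (harmonicProj d' h' w) (hc'.d_harmonicProj w)
  refine ⟨v, ?_⟩
  rw [harmonicProj_of_cycle _ _ hv, map_sub, ← hφd, map_sub, hc'.harmonicProj_d, sub_zero,
    ← sub_add_cancel (φ v) (harmonicProj d' h' w), hy, map_add, hc'.harmonicProj_d, zero_add,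
    hc'.harmonicProj_harmonicProj]

theorem exists_homotopyInverse (hc : IsContraction d h) (hc' : IsContraction d' h')
    (hφ₀ : HasDegree V.gr W.gr φ 0) (hφd : ∀ v, d' (φ v) = φ (d v))
    (hφ : IsHomologyIso d d' φ) :
    ∃ ψ : W →ₗ[ℚ] V, HasDegree W.gr V.gr ψ 0 ∧ (∀ w, d (ψ w) = ψ (d' w)) ∧
      (∀ v, ψ (φ (harmonicProj d h v)) = harmonicProj d h v) ∧
      ∀ w, harmonicProj d' h' (φ (ψ w)) = harmonicProj d' h' w := by
  obtain ⟨b, hb, hba⟩ := (hc'.hasDegree_harmonicProj.comp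
    (hφ₀.comp hc.hasDegree_harmonicProj)).exists_generalizedInverse
  have hba : ∀ v, harmonicProj d' h'
        (φ (harmonicProj d h (b (harmonicProj d' h' (φ (harmonicProj d h v)))))) =
      harmonicProj d' h' (φ (harmonicProj d h v)) := fun v => LinearMap.congr_fun hba v
  refine ⟨harmonicProj d h ∘ₗ b ∘ₗ harmonicProj d' h', ?_, fun w => ?_, fun v => ?_, fun w => ?_⟩
  · exact hc.hasDegree_harmonicProj.comp (hb.comp hc'.hasDegree_harmonicProj)
  · simp only [LinearMap.comp_apply, hc.d_harmonicProj, hc'.harmonicProj_d, map_zero]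
  · simp only [LinearMap.comp_apply]
    rw [← sub_eq_zero, ← map_sub]
    refine hc.harmonicProj_eq_zero_of_isHomologyIso (h' := h') hφd hφ ?_
    simp only [map_sub, hba, sub_self]
  · obtain ⟨v, hv⟩ := hc'.exists_harmonicProj_eq_of_isHomologyIso (h := h) hφd hφ w
    simp only [LinearMap.comp_apply]
    rw [← hv, hba]

end IsContraction

theorem eq_zero_of_sum_eigenvectors_eq_zero {M : Type*} [AddCommGroup M] [Module ℚ M]
    {N : Module.End ℚ M} {s : Finset ℕ} {y : ℕ → M} (hy : ∀ n : ℕ, y n ∈ N.eigenspace (n : ℚ))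
    (hsum : ∑ n ∈ s, y n = 0) {n : ℕ} (hn : n ∈ s) : y n = 0 := by
  have hind := N.eigenspaces_iSupIndep.comp (Nat.cast_injective (R := ℚ))
  exact (iSupIndep_iff_finsetSum_eq_zero_imp_eq_zero _).1 hind s y (fun n _ => hy n) hsum n hn

namespace Lam

variable {V W : GradedSpace.{u}}

/-! ### Derivations -/

/-- The extension of a linear endomorphism of `V` to a derivation of `ΛV`. -/
noncomputable def derivation (a : V →ₗ[ℚ] V) : Lam V →ₗ[ℚ] Lam V := coderivation (a ∘ₗ proj V)

theorem hasDegree_comp_proj {a : V →ₗ[ℚ] V} {e : ℤ} (ha : HasDegree V.gr V.gr a e) :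
    HasDegree (gr V) V.gr (a ∘ₗ proj V) e :=
  fun n x hx => by simpa using ha _ _ (hasDegree_proj n x hx)

theorem derivation_one (a : V →ₗ[ℚ] V) : derivation a 1 = 0 := by
  rw [derivation, coderivation_one, LinearMap.comp_apply,
    proj_of_mem_ne zero_ne_one one_mem_wordLen, map_zero, map_zero]

theorem coderivation_counit_smul (w : V) (x : Lam V) :
    coderivation (LinearMap.toSpanSingleton ℚ V w ∘ₗ (counit V).toLinearMap) x = ι V w * x := by
  have h : ι V ∘ₗ LinearMap.toSpanSingleton ℚ V w ∘ₗ (counit V).toLinearMap =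
      LinearMap.toSpanSingleton ℚ (Lam V) (ι V w) ∘ₗ (counit V).toLinearMap :=
    LinearMap.ext fun y => by simp
  rw [coderivation_eq_conv, h, conv_counit_smul_left, LinearMap.id_apply]

theorem derivation_ι_mul {a : V →ₗ[ℚ] V} {e : ℤ} (ha : HasDegree V.gr V.gr a e) {i : ℤ} {v : V}
    (hv : v ∈ V.gr i) (x : Lam V) :
    derivation a (ι V v * x) = ι V (a v) * x + (-1 : ℚ) ^ (e * i) • (ι V v * derivation a x) := by
  have hcontract : contract (a ∘ₗ proj V) v =
      LinearMap.toSpanSingleton ℚ V (a v) ∘ₗ (counit V).toLinearMap := by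
    ext x
    simp [contract_apply, proj_ι_mul]
  rw [derivation, coderivation_ι_mul (hasDegree_comp_proj ha) hv, hcontract,
    coderivation_counit_smul]

theorem derivation_mem_wordLen (a : V →ₗ[ℚ] V) {n : ℕ} {x : Lam V} (hx : x ∈ wordLen V n) :
    derivation a x ∈ wordLen V n := by
  have hword := coderivation_mem_word (f := a ∘ₗ proj V) (m := 1) (p := n)
    (fun k hk x hx => by rw [LinearMap.comp_apply, proj_of_mem_ne hk hx, map_zero])
    (by rwa [word_natCast])
  rwa [Nat.cast_one, sub_self, sub_zero, word_natCast] at hword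

theorem lenProj_comm {f : Lam V →ₗ[ℚ] Lam W} (hf : ∀ n, ∀ x ∈ wordLen V n, f x ∈ wordLen W n)
    (n : ℕ) (x : Lam V) : lenProj W n (f x) = f (lenProj V n x) := by
  refine LinearMap.congr_fun (linearMap_ext_wordLen (f := lenProj W n ∘ₗ f)
    (g := f ∘ₗ lenProj V n) fun m x hx => ?_) x
  rw [LinearMap.comp_apply, LinearMap.comp_apply]
  obtain rfl | h := eq_or_ne m n
  · rw [lenProj_of_mem hx, lenProj_of_mem (hf _ _ hx)]
  · rw [lenProj_of_mem_ne h hx, lenProj_of_mem_ne h (hf _ _ hx), map_zero]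

theorem derivation_derivation {d : V →ₗ[ℚ] V} (hd : HasDegree V.gr V.gr d (-1))
    (hdd : ∀ v, d (d v) = 0) (x : Lam V) : derivation d (derivation d x) = 0 := by
  refine LinearMap.congr_fun (coderivation_sq (hasDegree_comp_proj hd) ?_) x
  ext y
  simp [proj_coderivation, hdd]

theorem derivation_anticommutator {d h : V →ₗ[ℚ] V} (hd : HasDegree V.gr V.gr d (-1))
    (hh : HasDegree V.gr V.gr h 1) (x : Lam V) :
    derivation d (derivation h x) + derivation h (derivation d x) =
      derivation (d ∘ₗ h + h ∘ₗ d) x := by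
  have hbracket : bracket (d ∘ₗ proj V) (h ∘ₗ proj V) (-1) 1 =
      (d ∘ₗ h + h ∘ₗ d) ∘ₗ proj V := by
    ext y
    simp [bracket_apply, proj_coderivation]
  rw [derivation, derivation, derivation, ← hbracket,
    coderivation_bracket (hasDegree_comp_proj hd) (hasDegree_comp_proj hh)]
  simp

theorem map_derivation {φ : V →ₗ[ℚ] W} (hφ) {d : V →ₗ[ℚ] V} {d' : W →ₗ[ℚ] W} {e : ℤ}
    (hd : HasDegree V.gr V.gr d e) (hd' : HasDegree W.gr W.gr d' e)
    (h : ∀ v, d' (φ v) = φ (d v)) (x : Lam V) :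
    derivation d' (map φ hφ x) = map φ hφ (derivation d x) := by
  induction x using word_induction with
  | add x y hx hy => simp only [map_add, hx, hy]
  | smul c x hx => simp only [map_smul, hx]
  | one => simp [derivation_one]
  | mul i v hv x hx =>
    rw [map_mul, map_ι, derivation_ι_mul hd' (hφ i v hv), derivation_ι_mul hd hv, hx]
    simp [map_ι, h]

/-! ### Homotopy invariance -/

theorem iSup_eigenspace_derivation_inf_eigenspace_map {q : V →ₗ[ℚ] V}
    (hq : HasDegree V.gr V.gr q 0) (hqq : ∀ v, q (q v) = q v) {e : V →ₗ[ℚ] V}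
    (he : ∀ n, ∀ v ∈ V.gr n, e v ∈ V.gr n) (hev : ∀ v, e v = v - q v) :
    ⨆ n : ℕ, Module.End.eigenspace (derivation q) (n : ℚ) ⊓
      Module.End.eigenspace (map e he).toLinearMap (0 ^ n) = ⊤ := by
  set P : ℕ → Submodule ℚ (Lam V) := fun n => Module.End.eigenspace (derivation q) (n : ℚ) ⊓
    Module.End.eigenspace (map e he).toLinearMap (0 ^ n)
  have mem_P : ∀ n x, x ∈ P n ↔ derivation q x = (n : ℚ) • x ∧ map e he x = (0 : ℚ) ^ n • x :=
    fun n x => by simp [P]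
  have hN : ∀ {i : ℤ} {v : V}, v ∈ V.gr i → ∀ x,
      derivation q (ι V v * x) = ι V (q v) * x + ι V v * derivation q x := fun hv x => by
    simpa using derivation_ι_mul hq hv x
  have ι_mul_mem : ∀ i, ∀ v ∈ V.gr i, ∀ n, ∀ x ∈ P n, ι V v * x ∈ ⨆ n, P n := by
    intro i v hv n x hx
    obtain ⟨hNx, hex⟩ := (mem_P n x).1 hx
    have hqe : q (e v) = 0 := by rw [hev, map_sub, hqq, sub_self]
    have hee : e (e v) = e v := by rw [hev (e v), hqe, sub_zero]
    have heq : e (q v) = 0 := by rw [hev, hqq, sub_self]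
    have hqv : q v ∈ V.gr i := hasDegree_zero_iff.1 hq i v hv
    rw [← sub_add_cancel v (q v), ← hev, map_add, add_mul]
    refine add_mem (Submodule.mem_iSup_of_mem n ((mem_P n _).2 ⟨?_, ?_⟩))
      (Submodule.mem_iSup_of_mem (n + 1) ((mem_P (n + 1) _).2 ⟨?_, ?_⟩))
    · rw [hN (he i v hv), hqe, map_zero, zero_mul, zero_add, hNx, mul_smul_comm]
    · rw [map_mul, map_ι, hee, hex, mul_smul_comm]
    · rw [hN hqv, hqq, hNx, mul_smul_comm, Nat.cast_succ, add_smul, one_smul, add_comm]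
    · rw [map_mul, map_ι, heq, map_zero, zero_mul, zero_pow n.succ_ne_zero, zero_smul]
  refine eq_top_iff.2 fun x _ => ?_
  induction x using word_induction with
  | add x y hx hy => exact add_mem (hx trivial) (hy trivial)
  | smul c x hx => exact Submodule.smul_mem _ _ (hx trivial)
  | one => exact Submodule.mem_iSup_of_mem 0 ((mem_P 0 1).2 (by simp [derivation_one]))
  | mul i v hv x hx =>
    exact (iSup_le fun n y hy => ι_mul_mem i v hv n y hy :
      ⨆ n, P n ≤ (⨆ n, P n).comap (LinearMap.mulLeft ℚ (ι V v))) (hx trivial)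

theorem sub_map_harmonicProj_mem_range {d h : V →ₗ[ℚ] V} (hc : IsContraction d h) {x : Lam V}
    (hx : derivation d x = 0) :
    x - map (harmonicProj d h) hc.harmonicProj_mem x ∈
      LinearMap.range (derivation d) := by
  set N : Module.End ℚ (Lam V) := derivation (acyclicProj d h)
  have anticomm : ∀ y, derivation d (derivation h y) + derivation h (derivation d y) = N y :=
    derivation_anticommutator hc.hasDegree_d hc.hasDegree_h
  have hdd := derivation_derivation hc.hasDegree_d hc.d_d
  obtain ⟨c, hmem, rfl⟩ := (Submodule.mem_iSup_iff_exists_finsupp _ _).1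
    (iSup_eigenspace_derivation_inf_eigenspace_map hc.hasDegree_acyclicProj
      hc.acyclicProj_acyclicProj hc.harmonicProj_mem (harmonicProj_apply d h) ▸
        Submodule.mem_top (x := x))
  have hN : ∀ n, N (c n) = (n : ℚ) • c n := fun n => Module.End.mem_eigenspace_iff.1 (hmem n).1
  have cycle : ∀ n ∈ c.support, derivation d (c n) = 0 := fun n hn => by
    refine eq_zero_of_sum_eigenvectors_eq_zero (N := N) (fun n => ?_)
      ((map_sum _ _ _).symm.trans hx) hn
    rw [Module.End.mem_eigenspace_iff, ← map_smul, ← hN, ← anticomm, ← anticomm, map_add, hdd, hdd,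
      map_zero, zero_add, add_zero]
  rw [Finsupp.sum, map_sum, ← Finset.sum_sub_distrib]
  refine Submodule.sum_mem _ fun n hn => ?_
  have hmap : map (harmonicProj d h) hc.harmonicProj_mem (c n) = (0 : ℚ) ^ n • c n :=
    Module.End.mem_eigenspace_iff.1 (hmem n).2
  rw [hmap]
  obtain rfl | h0 := eq_or_ne n 0
  · simp
  · refine ⟨(n : ℚ)⁻¹ • derivation h (c n), ?_⟩
    have hdh := anticomm (c n)
    rw [cycle n hn, map_zero, add_zero, hN] at hdh
    rw [map_smul, hdh, smul_smul, inv_mul_cancel₀ (Nat.cast_ne_zero.2 h0), one_smul, zero_pow h0,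
      zero_smul, sub_zero]

theorem isHomologyIso_map {φ : V →ₗ[ℚ] W} {d : V →ₗ[ℚ] V} {d' : W →ₗ[ℚ] W} (hφ)
    (hd : HasDegree V.gr V.gr d (-1)) (hd' : HasDegree W.gr W.gr d' (-1)) (hdd : ∀ v, d (d v) = 0)
    (hdd' : ∀ v, d' (d' v) = 0) (hφd : ∀ v, d' (φ v) = φ (d v)) (hiso : IsHomologyIso d d' φ) :
    IsHomologyIso (derivation d) (derivation d') (map φ hφ).toLinearMap := by
  obtain ⟨h, hc⟩ := exists_isContraction hd hdd
  obtain ⟨h', hc'⟩ := exists_isContraction hd' hdd'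
  obtain ⟨ψ, hψ, hψd, hleft, hright⟩ :=
    hc.exists_homotopyInverse hc' (hasDegree_zero_iff.2 hφ) hφd hiso
  rw [hasDegree_zero_iff] at hψ
  have hGF : (map ψ hψ).comp ((map φ hφ).comp (map _ hc.harmonicProj_mem)) =
      map _ hc.harmonicProj_mem :=
    algHom_ext (LinearMap.ext fun v => by simp [map_ι, hleft])
  have hFG : (map _ hc'.harmonicProj_mem).comp ((map φ hφ).comp (map ψ hψ)) =
      map _ hc'.harmonicProj_mem :=
    algHom_ext (LinearMap.ext fun w => by simp [map_ι, hright])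
  exact .of_homotopyInverse (g := (map ψ hψ).toLinearMap)
    (e := (map _ hc.harmonicProj_mem).toLinearMap)
    (e' := (map _ hc'.harmonicProj_mem).toLinearMap)
    (map_derivation hφ hd hd' hφd) (map_derivation hψ hd' hd hψd)
    (fun _ => sub_map_harmonicProj_mem_range hc) (fun _ => sub_map_harmonicProj_mem_range hc')
    (DFunLike.congr_fun hGF) (DFunLike.congr_fun hFG)

end Lam

namespace LInfinityStructure

variable {V : GradedSpace.{u}} (L : LInfinityStructure V)

/-- The suspension `s ∘ ℓ₁ ∘ s⁻¹` of the differential, which is `h₁`. -/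
noncomputable def sDiff : V.susp →ₗ[ℚ] V.susp :=
  V.s.toLinearMap ∘ₗ L.diff ∘ₗ V.s.symm.toLinearMap

theorem hasDegree_sDiff : HasDegree V.susp.gr V.susp.gr L.sDiff (-1) := fun n x hx => by
  have := L.diff_mem _ (V.s.symm x) hx
  rwa [sub_right_comm] at this

theorem h_one (v : V.susp) : L.h 1 (fun _ => v) = L.sDiff v := by
  simp [h, sDiff, diff_apply]

theorem hTotal_ι (v : V.susp) : L.hTotal (Lam.ι V.susp v) = L.sDiff v := by
  have := Lam.descend_prod L.h L.h_gradedSymm (fun _ : Fin 1 => v)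
  rwa [h_one, List.ofFn_succ, List.ofFn_zero, List.prod_singleton] at this

theorem hPart_one : L.hPart 1 = L.sDiff ∘ₗ Lam.proj V.susp := by
  refine Lam.linearMap_ext_wordLen fun n x hx => ?_
  obtain rfl | hn := eq_or_ne n 1
  · obtain ⟨v, rfl⟩ := Lam.mem_wordLen_one.1 hx
    rw [L.hPart_self hx, L.hTotal_ι, LinearMap.comp_apply, Lam.proj_ι]
  · rw [L.hPart_of_ne hn hx, LinearMap.comp_apply, Lam.proj_of_mem_ne hn hx, map_zero]

theorem δPart_one : L.δPart 1 = Lam.derivation L.sDiff := by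
  rw [Lam.derivation, ← hPart_one]
  rfl

theorem sDiff_sDiff (v : V.susp) : L.sDiff (L.sDiff v) = 0 := by
  induction v using GradedSpace.homogeneous_induction with
  | zero => rw [map_zero, map_zero]
  | add x y hx hy => rw [map_add, map_add, hx, hy, add_zero]
  | mem i v hv =>
    have hδ : L.δ (Lam.ι V.susp v) = Lam.ι V.susp (L.sDiff v) := by
      have := Lam.coderivation_ι_mul L.hasDegree_hTotal hv 1
      rw [mul_one, Lam.coderivation_one, Lam.coderivation_one, Lam.contract_apply, mul_one,
        hTotal_one, map_zero, mul_zero, smul_zero, add_zero, hTotal_ι] at this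
      exact this
    have hzero := LinearMap.congr_fun L.hTotal_δ (Lam.ι V.susp v)
    rwa [LinearMap.comp_apply, hδ, hTotal_ι] at hzero

end LInfinityStructure

namespace Lam

/-! ### Coalgebra maps -/

variable {V W : GradedSpace.{u}}

/-- The linear part `π ∘ f ∘ ι` of `f : ΛV → ΛW`. -/
noncomputable def linearPart (f : Lam V →ₗ[ℚ] Lam W) : V →ₗ[ℚ] W := proj W ∘ₗ f ∘ₗ ι V

section CoalgebraHom

variable {f : Lam V →ₗ[ℚ] Lam W} (hone : f 1 = 1)
  (hcomul : comul W ∘ₗ f = TensorProduct.map f f ∘ₗ comul V)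
  (hφ : ∀ n, ∀ v ∈ V.gr n, linearPart f v ∈ W.gr n)

include hone hcomul

theorem lenProj_apply_of_mem_wordLen {n a : ℕ} (ha : a ≤ n) {x : Lam V} (hx : x ∈ wordLen V a) :
    lenProj W n (f x) = map (linearPart f) hφ (lenProj V n x) := by
  induction n generalizing a x with
  | zero =>
    obtain rfl : a = 0 := by omega
    obtain ⟨c, rfl⟩ := mem_wordLen_zero.1 hx
    simp only [map_smul, hone, lenProj_of_mem one_mem_wordLen, map_one]
  | succ n ih =>
    have hcongr : conv (lenProj W n ∘ₗ f) (lenProj W 1 ∘ₗ f) x =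
        conv ((map (linearPart f) hφ).toLinearMap ∘ₗ lenProj V n)
          ((map (linearPart f) hφ).toLinearMap ∘ₗ lenProj V 1) x := by
      refine conv_congr_of_wordLen (fun b c hbc y hy z hz => ?_) hx
      simp only [LinearMap.comp_apply, AlgHom.toLinearMap_apply]
      obtain rfl | rfl | hc : c = 0 ∨ c = 1 ∨ 2 ≤ c := by omega
      · obtain ⟨r, rfl⟩ := mem_wordLen_zero.1 hz
        simp only [map_smul, hone, lenProj_of_mem_ne zero_ne_one one_mem_wordLen, map_zero,
          smul_zero, mul_zero]
      · obtain ⟨v, rfl⟩ := mem_wordLen_one.1 hz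
        rw [ih (by omega) hy, lenProj_of_mem hz, map_ι, ← ι_comp_proj]
        rfl
      · rw [ih (by omega) hy, lenProj_of_mem_ne (by omega) hy, map_zero, zero_mul, zero_mul]
    rw [← conv_comp hcomul, ← comp_conv, conv_lenProj, conv_lenProj] at hcongr
    simp only [LinearMap.comp_apply, LinearMap.smul_apply, AlgHom.toLinearMap_apply, map_smul]
      at hcongr
    exact smul_right_injective _ (Nat.cast_ne_zero.2 (Nat.choose_pos n.le_succ).ne') hcongr

theorem lenProj_apply_of_mem_filtration {n : ℕ} {x : Lam V} (hx : x ∈ filtration V n) :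
    lenProj W n (f x) = map (linearPart f) hφ (lenProj V n x) := by
  have hle : filtration V n ≤ LinearMap.eqLocus (lenProj W n ∘ₗ f)
      ((map (linearPart f) hφ).toLinearMap ∘ₗ lenProj V n) :=
    filtration_le fun a ha _ hy =>
      lenProj_apply_of_mem_wordLen hone hcomul hφ (by omega) hy
  exact hle hx

include hφ

theorem map_mem_filtration {p : ℤ} {x : Lam V} (hx : x ∈ filtration V p) :
    f x ∈ filtration W p := by
  refine mem_filtration.2 fun n hn => ?_
  rw [lenProj_apply_of_mem_filtration hone hcomul hφ (filtration_mono hn.le hx),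
    mem_filtration.1 hx n hn, map_zero]

end CoalgebraHom

end Lam

/-! ### Quasi-isomorphisms -/

namespace LInfinityAlgebra

theorem δ_mem_F (L : LInfinityAlgebra.{u}) {p : ℤ} {x : L.Chains} (hx : x ∈ L.F p) :
    L.δ x ∈ L.F p :=
  L.str.isFilteredComplex.map_le p ⟨x, hx, rfl⟩

theorem lenProj_δPart_one (L : LInfinityAlgebra.{u}) (n : ℕ) (x : L.Chains) :
    Lam.lenProj L.space.susp n (L.str.δPart 1 x) =
      L.str.δPart 1 (Lam.lenProj L.space.susp n x) := by
  rw [L.str.δPart_one]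
  exact Lam.lenProj_comm (fun _ _ => Lam.derivation_mem_wordLen _) n x

theorem lenProj_δ (L : LInfinityAlgebra.{u}) {n : ℕ} {x : L.Chains} (hx : x ∈ L.F n) :
    Lam.lenProj L.space.susp n (L.δ x) = L.str.δPart 1 (Lam.lenProj L.space.susp n x) := by
  have hsub := L.str.δ_sub_δPart_mem_filtration (k := 1) (fun j => L.str.ℓ_of_lt_one) hx
  have hzero := Lam.mem_filtration.1 hsub n (by omega)
  rwa [map_sub, lenProj_δPart_one, sub_eq_zero] at hzero

namespace Hom

variable {L L' : LInfinityAlgebra.{u}} (f : Hom L L')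

/-- The suspension `s ∘ f₁ ∘ s⁻¹` of the linear part of an `L∞` morphism. -/
noncomputable abbrev sLinearPart : L.space.susp →ₗ[ℚ] L'.space.susp :=
  Lam.linearPart f.toLinearMap

theorem sLinearPart_mem (n : ℤ) (v : L.space.susp) (hv : v ∈ L.space.susp.gr n) :
    f.sLinearPart v ∈ L'.space.susp.gr n := by
  have := Lam.hasDegree_proj n _ (f.map_gr n _ (Lam.ι_mem_gr hv))
  rwa [add_zero] at this

/-- The map `ΛsL → ΛsL'` of algebras induced by the linear part of an `L∞` morphism. -/
noncomputable def lamLinearPart : L.Chains →ₐ[ℚ] L'.Chains :=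
  Lam.map f.sLinearPart f.sLinearPart_mem

theorem lenProj_lamLinearPart (n : ℕ) (x : L.Chains) :
    Lam.lenProj L'.space.susp n (f.lamLinearPart x) =
      f.lamLinearPart (Lam.lenProj L.space.susp n x) :=
  Lam.lenProj_comm (f := f.lamLinearPart.toLinearMap)
    (fun _ _ => Lam.map_mem_wordLen _ f.sLinearPart_mem) n x

theorem lenProj_apply {n : ℕ} {x : L.Chains} (hx : x ∈ L.F n) :
    Lam.lenProj L'.space.susp n (f.toLinearMap x) =
      f.lamLinearPart (Lam.lenProj L.space.susp n x) :=
  Lam.lenProj_apply_of_mem_filtration f.map_one f.comul_comp f.sLinearPart_mem hx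

theorem map_mem_F (p : ℤ) (x : L.Chains) (hx : x ∈ L.F p) : f.toLinearMap x ∈ L'.F p :=
  Lam.map_mem_filtration f.map_one f.comul_comp f.sLinearPart_mem hx

theorem IsQuasiIso.isHomologyIso_lamLinearPart {f : Hom L L'} (hf : f.IsQuasiIso) :
    IsHomologyIso (L.str.δPart 1) (L'.str.δPart 1) f.lamLinearPart.toLinearMap := by
  obtain ⟨hcomm, hinj, hsurj⟩ := hf
  rw [L.str.δPart_one, L'.str.δPart_one]
  exact Lam.isHomologyIso_map f.sLinearPart_mem L.str.hasDegree_sDiff L'.str.hasDegree_sDiff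
    L.str.sDiff_sDiff L'.str.sDiff_sDiff hcomm ⟨hinj, hsurj⟩

theorem IsQuasiIso.injBetween {f : Hom L L'} (hf : f.IsQuasiIso) (p : ℤ) :
    InjBetween L.δ L.F L'.δ L'.F f.toLinearMap p (p - 1) := by
  intro x hx hdx w hw hxw
  obtain hp | hp := lt_or_ge p 0
  · obtain rfl : x = 0 := (Lam.filtration_of_neg hp).le hx
    exact ⟨0, Submodule.zero_mem _, by simp⟩
  lift p to ℕ using hp
  rw [Lam.mem_filtration_sub_one_iff (L.δ_mem_F hx), L.lenProj_δ hx] at hdx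
  rw [Lam.mem_filtration_sub_one_iff (Submodule.sub_mem _ (f.map_mem_F _ _ hx) (L'.δ_mem_F hw)),
    map_sub, f.lenProj_apply hx, L'.lenProj_δ hw, sub_eq_zero] at hxw
  obtain ⟨z, hz⟩ := hf.isHomologyIso_lamLinearPart.injective _ hdx ⟨_, hxw.symm⟩
  have hzF := Lam.lenProj_mem_filtration p z
  refine ⟨Lam.lenProj _ p z, hzF, ?_⟩
  rw [Lam.mem_filtration_sub_one_iff (Submodule.sub_mem _ hx (L.δ_mem_F hzF)), map_sub,
    L.lenProj_δ hzF, Lam.lenProj_of_mem (Lam.lenProj_mem p z), ← L.lenProj_δPart_one, hz,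
    Lam.lenProj_of_mem (Lam.lenProj_mem p x), sub_self]

theorem IsQuasiIso.surjBetween {f : Hom L L'} (hf : f.IsQuasiIso) (p : ℤ) :
    SurjBetween L.δ L.F L'.δ L'.F f.toLinearMap p (p - 1) := by
  intro x' hx' hdx'
  obtain hp | hp := lt_or_ge p 0
  · obtain rfl : x' = 0 := (Lam.filtration_of_neg hp).le hx'
    exact ⟨0, Submodule.zero_mem _, by simp, 0, Submodule.zero_mem _, by simp⟩
  lift p to ℕ using hp
  rw [Lam.mem_filtration_sub_one_iff (L'.δ_mem_F hx'), L'.lenProj_δ hx'] at hdx'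
  obtain ⟨x, hx, w, hw⟩ := hf.isHomologyIso_lamLinearPart.surjective _ hdx'
  have hxF := Lam.lenProj_mem_filtration p x
  have hwF := Lam.lenProj_mem_filtration p w
  refine ⟨Lam.lenProj _ p x, hxF, ?_, Lam.lenProj _ p w, hwF, ?_⟩
  · rw [Lam.mem_filtration_sub_one_iff (L.δ_mem_F hxF), L.lenProj_δ hxF,
      Lam.lenProj_of_mem (Lam.lenProj_mem p x), ← L.lenProj_δPart_one, hx, map_zero]
  · have hlead := congrArg (Lam.lenProj L'.space.susp p) hw
    rw [AlgHom.toLinearMap_apply, map_sub, f.lenProj_lamLinearPart, L'.lenProj_δPart_one,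
      Lam.lenProj_of_mem (Lam.lenProj_mem p x')] at hlead
    rw [Lam.mem_filtration_sub_one_iff (Submodule.sub_mem _
      (Submodule.sub_mem _ (f.map_mem_F _ _ hxF) hx') (L'.δ_mem_F hwF)), map_sub, map_sub,
      f.lenProj_apply hxF, L'.lenProj_δ hwF, Lam.lenProj_of_mem (Lam.lenProj_mem p x),
      Lam.lenProj_of_mem (Lam.lenProj_mem p w), hlead, sub_self]

end Hom

theorem WeaklyEquivalent.extendsCycles_iff {L L' : LInfinityAlgebra.{u}}
    (h : WeaklyEquivalent L L') {r : ℤ} (hr : 1 ≤ r) (p : ℤ) :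
    ExtendsCycles L.δ L.F r p ↔ ExtendsCycles L'.δ L'.F r p := by
  induction h with
  | rel L L' h =>
    obtain ⟨f, hf⟩ := h
    exact Quillen.extendsCycles_iff L.str.isFilteredComplex L'.str.isFilteredComplex
      (LinearMap.congr_fun f.δ_comp) f.map_mem_F hf.injBetween hf.surjBetween hr p
  | refl => exact Iff.rfl
  | symm _ _ _ ih => exact ih.symm
  | trans _ _ _ _ _ ih ih' => exact ih.trans ih'

theorem IsFormal.collapsesAt_two {L : LInfinityAlgebra.{u}} (h : L.IsFormal) :
    CollapsesAt L.str.isFilteredComplex 2 := by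
  obtain ⟨M, hM, -, hLM⟩ := h
  intro r hr p
  rw [pageD_eq_zero_iff_extendsCycles, hLM.extendsCycles_iff (by omega) p]
  exact M.extendsCycles_of_binary hM hr p

end LInfinityAlgebra

end Quillen

open Quillen in
theorem proposition2p1_general (L : LInfinityAlgebra.{u}) :
    ∃ hC : IsFilteredComplex L.δ L.F,
      (L.IsFormal → CollapsesAt hC 2) ∧
      (∀ k : ℕ, (∀ j < k, L.str.ℓ j = 0) →
        (∀ r : ℤ, 0 ≤ r → r ≤ (k : ℤ) - 1 → ∀ p : ℤ,
          cyc L.δ L.F r p = cyc L.δ L.F 0 p ∧ den L.δ L.F r p = den L.δ L.F 0 p) ∧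
        (∀ r : ℤ, 0 ≤ r → r < (k : ℤ) - 1 → ∀ p : ℤ, pageD hC r p = 0) ∧
        ∃ φ : ∀ p : ℤ, Lam.word L.space.susp p ≃ₗ[ℚ] Page L.δ L.F ((k : ℤ) - 1) p,
          (∀ (p : ℤ) (x : Lam.word L.space.susp p),
            ∃ hx : (x : L.Chains) ∈ cyc L.δ L.F ((k : ℤ) - 1) p,
              φ p x = pageMk L.δ L.F ((k : ℤ) - 1) p ⟨x, hx⟩) ∧
          (∀ (p : ℤ) (x : Lam.word L.space.susp p),
            ∃ hy : L.str.δPart k x ∈ Lam.word L.space.susp (p - ((k : ℤ) - 1)),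
              pageD hC ((k : ℤ) - 1) p (φ p x) =
                φ (p - ((k : ℤ) - 1)) ⟨L.str.δPart k x, hy⟩)) := by
  have hC := L.str.isFilteredComplex
  refine ⟨hC, fun h => h.collapsesAt_two, fun k hℓ => ?_⟩
  have lowering (p : ℤ) (x) (hx : x ∈ L.F p) : L.δ x ∈ L.F (p - ((k : ℤ) - 1)) := by
    have := L.str.δ_mem_filtration hℓ hx
    rwa [sub_add] at this
  refine ⟨fun r hr hrk p => ⟨?_, ?_⟩, fun r _ hrk p => ?_, ?_⟩
  · rw [cyc_eq_of_lowering hC lowering hrk, cyc_eq_of_lowering hC lowering (by omega)]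
  · rw [den_eq_of_lowering hC lowering hrk, den_eq_of_lowering hC lowering (by omega)]
  · rw [pageD_eq_zero_iff, den_eq_of_lowering hC lowering hrk.le]
    exact fun x hx => hC.mono (by omega) (lowering p x hx.1)
  · exact exists_page_equiv hC lowering Lam.filtration_eq_sup Lam.disjoint_word_filtration
      (fun _ _ => L.str.δPart_mem_word k) fun p x hx => by
        have := L.str.δ_sub_δPart_mem_filtration hℓ hx
        rwa [show p - (k : ℤ) = p - ((k : ℤ) - 1) - 1 by ring] at this

open Quillen in
theorem proposition2p1 (L : LInfinityAlgebra.{u}) :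
    ∃ hC : IsFilteredComplex L.δ L.F,
      -- A formal `L∞` algebra concentrated in non-negative degrees: collapse at `E²`.
      (L.Nonneg → L.IsFormal → CollapsesAt hC 2) ∧
      -- If `ℓⱼ = 0` for `j < k`, then `E⁰ = ⋯ = E^{k-1} ≅ ΛsL` and `d^{k-1}` is `δₖ`.
      (∀ k : ℕ, 1 ≤ k → (∀ j < k, L.str.ℓ j = 0) →
        (∀ r : ℤ, 0 ≤ r → r ≤ (k : ℤ) - 1 → ∀ p : ℤ,
          cyc L.δ L.F r p = cyc L.δ L.F 0 p ∧ den L.δ L.F r p = den L.δ L.F 0 p) ∧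
        (∀ r : ℤ, 0 ≤ r → r < (k : ℤ) - 1 → ∀ p : ℤ, pageD hC r p = 0) ∧
        ∃ φ : ∀ p : ℤ, Lam.word L.space.susp p ≃ₗ[ℚ] Page L.δ L.F ((k : ℤ) - 1) p,
          (∀ (p : ℤ) (x : Lam.word L.space.susp p),
            ∃ hx : (x : L.Chains) ∈ cyc L.δ L.F ((k : ℤ) - 1) p,
              φ p x = pageMk L.δ L.F ((k : ℤ) - 1) p ⟨x, hx⟩) ∧
          (∀ (p : ℤ) (x : Lam.word L.space.susp p),
            ∃ hy : L.str.δPart k x ∈ Lam.word L.space.susp (p - ((k : ℤ) - 1)),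
              pageD hC ((k : ℤ) - 1) p (φ p x) =
                φ (p - ((k : ℤ) - 1)) ⟨L.str.δPart k x, hy⟩)) := by
  obtain ⟨hC, hformal, hpages⟩ := proposition2p1_general L
  exact ⟨hC, fun _ => hformal, fun k _ => hpages k⟩
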